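/- Let $t \ge 4$ and let $X$ be a $t$-uniform simplicial complex; that is, $X$ is a flag, simply connected simplicial complex such that for every loop in $X$ and every minimal filling diagram $(D,f)$ of it, every interior vertex of $D$ has exactly $t$ neighbours in $D$. Here a loop is a subcomplex of $X$ that is a triangulated circle; a filling diagram for a loop $\gamma$ is a simplicial map $f : D \to X$ from a triangulated $2$-disc $D$ that maps $\partial D$ isomorphically onto $\gamma$; it is minimal if $D$ has the least number of triangles among all filling diagrams for $\gamma$. Let $\gamma$ be a loop in $X$, let $(D,f)$ be a minimal filling diagram for $\gamma$, and let $v$ be an interior vertex of $D$. Distances between vertices of $D$ are numbers of edges of shortest paths in the $1$-skeleton of $D$. For $k \ge 0$ let $S_k^t$ be the sphere of radius $k$ centred at $v$, i.e. the set of edges of $D$ both of whose endpoints are at distance $k$ from $v$, and let $|S_k^t|$ be the number of these edges. Let $A_n^t$ be the number of triangles of $D$ inside the sphere of radius $n$, i.e. of triangles all of whose vertices are at distance at most $n$ from $v$. Then for every $n \ge 0$ such that all vertices of $D$ at distance less than $n$ from $v$ are interior vertices of $D$ (the sphere of radius $n$ is not cut off by the boundary of $D$), $$A_n^t = 2\left(\sum_{k=0}^{n}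 |S_k^t|\right) - |S_n^t| .$$ -/

import Mathlib

namespace AbstractSimplicialComplex

variable {V W : Type*}

open Classical in
/-- The 1-skeleton of a simplicial complex, as a graph on its set of vertices. -/
def skeleton (K : AbstractSimplicialComplex V) : SimpleGraph V where
  Adj a b := a ≠ b ∧ ({a, b} : Finset V) ∈ K
  symm := ⟨fun a b h => ⟨h.1.symm, by rw [Finset.pair_comm]; exact h.2⟩⟩
  loopless := ⟨fun _ h => h.1 rfl⟩

/-- The edges (1-simplices) of `K`. -/
def edges (K : AbstractSimplicialComplex V) : Set (Finset V) :=
  {s | s ∈ K ∧ s.card = 2}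

/-- The triangles (2-simplices) of `K`. -/
def triangles (K : AbstractSimplicialComplex V) : Set (Finset V) :=
  {s | s ∈ K ∧ s.card = 3}

/-- The area of a finite complex: its number of triangles. -/
noncomputable def area (K : AbstractSimplicialComplex V) : ℕ := K.triangles.ncard

/-- `K` is flag: every nonempty finite set of vertices that are pairwise joined by edges spans a
simplex. -/
def IsFlag (K : AbstractSimplicialComplex V) : Prop :=
  ∀ s : Finset V, s.Nonempty → (∀ a ∈ s, ∀ b ∈ s, a ≠ b → K.skeleton.Adj a b) → s ∈ K

open Classical in
/-- Homotopy of edge paths with fixed endpoints: the congruence generated by cancelling a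
backtracking `a, b, a`, and by replacing two sides `a, b, c` of a triangle by its third side. -/
inductive EdgeHomotopic (K : AbstractSimplicialComplex V) :
    ∀ {a b : V}, K.skeleton.Walk a b → K.skeleton.Walk a b → Prop
  | refl {a b : V} (p : K.skeleton.Walk a b) : EdgeHomotopic K p p
  | symm {a b : V} {p q : K.skeleton.Walk a b} :
      EdgeHomotopic K p q → EdgeHomotopic K q p
  | trans {a b : V} {p q r : K.skeleton.Walk a b} :
      EdgeHomotopic K p q → EdgeHomotopic K q r → EdgeHomotopic K p r
  | cons {a b c : V} (h : K.skeleton.Adj a b) {p q : K.skeleton.Walk b c} :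
      EdgeHomotopic K p q → EdgeHomotopic K (.cons h p) (.cons h q)
  | backtrack {a b c : V} (h : K.skeleton.Adj a b) (h' : K.skeleton.Adj b a)
      (p : K.skeleton.Walk a c) : EdgeHomotopic K (.cons h (.cons h' p)) p
  | triangle {a b c d : V} (hab : K.skeleton.Adj a b) (hbc : K.skeleton.Adj b c)
      (hac : K.skeleton.Adj a c) (hs : ({a, b, c} : Finset V) ∈ K)
      (p : K.skeleton.Walk c d) :
      EdgeHomotopic K (.cons hab (.cons hbc p)) (.cons hac p)

/-- `K` is simply connected: it is connected and its edge-path group (which is the fundamental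
group of the geometric realization) is trivial. -/
def IsSimplyConnected (K : AbstractSimplicialComplex V) : Prop :=
  K.skeleton.Connected ∧
    ∀ (a : V) (p : K.skeleton.Walk a a), K.EdgeHomotopic p .nil

open Classical in
/-- The 1-dimensional part of the link of the vertex `v`: its vertices are the neighbours of `v`,
and `a`, `b` are joined when `v, a, b` span a triangle. -/
def linkGraph (K : AbstractSimplicialComplex V) (v : V) :
    SimpleGraph {w : V // K.skeleton.Adj v w} where
  Adj a b := a ≠ b ∧ ({v, a.1, b.1} : Finset V) ∈ K
  symm := ⟨fun a b h => ⟨h.1.symm, by rw [Finset.pair_comm]; exact h.2⟩⟩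
  loopless := ⟨fun _ h => h.1 rfl⟩

/-- The number of triangles of `K` that contain `e`. -/
noncomputable def cofaceCount (K : AbstractSimplicialComplex V) (e : Finset V) : ℕ :=
  {s | s ∈ K.triangles ∧ e ⊆ s}.ncard

/-- The edges in the boundary of a triangulated surface: those in exactly one triangle. -/
def boundaryEdges (K : AbstractSimplicialComplex V) : Set (Finset V) :=
  {e | e ∈ K.edges ∧ K.cofaceCount e = 1}

/-- The vertices in the boundary of a triangulated surface. -/
def boundaryVertices (K : AbstractSimplicialComplex V) : Set V :=
  {v | ∃ e ∈ K.boundaryEdges, v ∈ e}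

/-- Interior vertices of a triangulated surface. -/
def IsInterior (K : AbstractSimplicialComplex V) (v : V) : Prop := v ∉ K.boundaryVertices

/-- `D` is a triangulated 2-disc. The fields up to `link_connected` say that `D` is a triangulated
compact surface with boundary: by `edge_cofaces` the vertices of a link have degree 1 or 2 in the
link, so that a connected link is a path with at least one edge (for boundary vertices) or a cycle
(for interior vertices). By the classification of surfaces, a connected compact surface with
nonempty boundary is a disc exactly when its Euler characteristic is 1. -/
structure IsDisc (D : AbstractSimplicialComplex W) : Prop where
  finite : Finite W
  card_le_three : ∀ s ∈ D, s.card ≤ 3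
  edge_cofaces : ∀ e ∈ D.edges, D.cofaceCount e = 1 ∨ D.cofaceCount e = 2
  link_connected : ∀ v : W, (D.linkGraph v).Connected
  connected : D.skeleton.Connected
  boundary_nonempty : D.boundaryEdges.Nonempty
  euler_char : (Nat.card W : ℤ) - D.edges.ncard + D.triangles.ncard = 1

open Classical in
/-- `f` is a simplicial map: it sends the vertices of each simplex onto those of a simplex. -/
def IsSimplicialMap (D : AbstractSimplicialComplex W) (X : AbstractSimplicialComplex V)
    (f : W → V) : Prop :=
  ∀ s ∈ D, s.image f ∈ X

open Classical in
/-- `(D, f)` is a filling diagram for the loop `γ` of `X`: `D` is a triangulated disc, `f` is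
simplicial, and `f` maps the boundary of `D` isomorphically onto `γ`. -/
structure IsFilling {X : AbstractSimplicialComplex V} {x : V} (γ : X.skeleton.Walk x x)
    (D : AbstractSimplicialComplex W) (f : W → V) : Prop where
  disc : D.IsDisc
  simplicial : D.IsSimplicialMap X f
  injOn_boundary : Set.InjOn f D.boundaryVertices
  boundary_edges : ∀ y z : V, s(y, z) ∈ γ.edges ↔
    ∃ a b : W, ({a, b} : Finset W) ∈ D.boundaryEdges ∧ f a = y ∧ f b = z

/-- `(D, f)` is a minimal filling diagram for `γ`: no filling diagram has smaller area. (Discs are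
finite, so that vertex sets in `Type` represent all of them.) -/
structure IsMinimalFilling {X : AbstractSimplicialComplex V} {x : V} (γ : X.skeleton.Walk x x)
    (D : AbstractSimplicialComplex W) (f : W → V) : Prop extends IsFilling γ D f where
  area_le : ∀ (W' : Type) (D' : AbstractSimplicialComplex W') (f' : W' → V),
    IsFilling γ D' f' → D.area ≤ D'.area

/-- `X` is `t`-uniform, `t ≥ 4`: it is flag and simply connected, and in every minimal filling
diagram for a loop of `X` every interior vertex of the disc has exactly `t` neighbours. A loop is
a closed walk in the 1-skeleton without repeated vertices, of length at least 3. -/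
structure IsUniform (X : AbstractSimplicialComplex V) (t : ℕ) : Prop where
  four_le : 4 ≤ t
  flag : X.IsFlag
  simplyConnected : X.IsSimplyConnected
  degree_eq : ∀ (x : V) (γ : X.skeleton.Walk x x), γ.IsCycle →
    ∀ (W : Type) (D : AbstractSimplicialComplex W) (f : W → V), IsMinimalFilling γ D f →
      ∀ w : W, D.IsInterior w → (D.skeleton.neighborSet w).ncard = t

/-- The sphere of radius `n` centred at `v`: the set of edges spanned by the vertices at distance
`n` from `v` in the 1-skeleton. -/
def sphere (D : AbstractSimplicialComplex W) (v : W) (n : ℕ) : Set (Finset W) :=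
  {e | e ∈ D.edges ∧ ∀ w ∈ e, D.skeleton.dist v w = n}

/-- The length of the sphere of radius `n` centred at `v`: its number of edges. -/
noncomputable def sphereLength (D : AbstractSimplicialComplex W) (v : W) (n : ℕ) : ℕ :=
  (D.sphere v n).ncard

/-- The area of the sphere of radius `n` centred at `v`: the number of triangles inside it, that
is, of triangles all of whose vertices are at distance at most `n` from `v`. -/
noncomputable def sphereArea (D : AbstractSimplicialComplex W) (v : W) (n : ℕ) : ℕ :=
  {s | s ∈ D.triangles ∧ ∀ w ∈ s, D.skeleton.dist v w ≤ n}.ncard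

end AbstractSimplicialComplex

/-! Count the pairs (sphere edge, triangle of the ball of radius `n` containing it). Adjacent
vertices have distances to `v` differing by at most one, so a triangle whose vertices are not all
equidistant from `v` has exactly one edge on a sphere. A sphere edge of radius `k < n` has interior
endpoints, hence lies in two triangles, and both are in the ball; an edge of radius `n` lies in
exactly one triangle of the ball. This gives `A_n = 2 ∑_{k<n} |S_k| + |S_n|`
(`IsSurface.sphereArea_eq`). What has to be shown is that no triangle is equidistant from `v` and
that every sphere edge has exactly one apex on the previous sphere. Both follow from the local
convexity recorded in `GoodSphere`.

For `t ≥ 6` convexity is proved by induction on the radius, together with `NoEnclosed`. A failure at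
radius `k + 1` produces a path of two or three edges that leaves the ball of radius `k` and returns
to it. In a disc such a path bounds, modulo 2 and relative to the ball, a set `Q` of triangles. The
relative first homology of `Q` vanishes, so its relative Euler characteristic is nonnegative
(`IsDisc.sum_curv_nonneg`); by Gauss–Bonnet (`sum_curv`) six times that number is the total
curvature. Degree at least 6 and convexity of the ball make the curvature nonpositive away from the
path, and an explicit estimate along the path makes the total negative, a contradiction
(`IsDisc.exists_lower_apex`, `IsDisc.tri_of_lower_neighbors`). The disc enters only through homology
with coefficients in `ZMod 2`: Euler characteristic 1 amounts to every cycle being a boundary.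

For `t = 4` and `t = 5` only small balls occur: if enough vertices are interior, the surface closes
up to an octahedron or an icosahedron and has no boundary. This forces `n ≤ 1` and `n ≤ 2`
respectively, and the spheres of radius at most 2 are checked by hand. That check needs 3-cycles to
bound triangles (`IsMinimalFilling.tri_of_adj`): otherwise the region bounded by the 3-cycle could
be replaced by a single triangle, which maps to the flag complex `X`, against minimality. -/

namespace AbstractSimplicialComplex

/-! ### Triangles, edges and links in triangulated surfaces -/

section
open scoped Classical

variable {V W : Type*}

/-- `a`, `b`, `c` are the vertices of a triangle of `D`. -/
def Tri (D : AbstractSimplicialComplex W) (a b c : W) : Prop :=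
  a ≠ b ∧ a ≠ c ∧ b ≠ c ∧ ({a, b, c} : Finset W) ∈ D

theorem Tri.swap {D : AbstractSimplicialComplex W} {a b c : W} (h : D.Tri a b c) :
    D.Tri b a c :=
  ⟨h.1.symm, h.2.2.1, h.2.1, by rw [Finset.insert_comm]; exact h.2.2.2⟩

theorem Tri.swap' {D : AbstractSimplicialComplex W} {a b c : W} (h : D.Tri a b c) :
    D.Tri a c b :=
  ⟨h.2.1, h.1, h.2.2.1.symm, by rw [Finset.pair_comm]; exact h.2.2.2⟩

theorem Tri.rot {D : AbstractSimplicialComplex W} {a b c : W} (h : D.Tri a b c) :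
    D.Tri b c a := h.swap.swap'

theorem mem_of_subset {D : AbstractSimplicialComplex W} {s t : Finset W} (hs : s ∈ D)
    (h : t ⊆ s) (ht : t.Nonempty) : t ∈ D :=
  (D.isRelLowerSet_faces hs).2 h ht

theorem Tri.adj {D : AbstractSimplicialComplex W} {a b c : W} (h : D.Tri a b c) :
    D.skeleton.Adj a b :=
  ⟨h.1, mem_of_subset h.2.2.2 (by intro x; simp; tauto) (by simp)⟩

theorem Tri.adj₁₃ {D : AbstractSimplicialComplex W} {a b c : W} (h : D.Tri a b c) :
    D.skeleton.Adj a c := h.swap'.adj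

theorem Tri.adj₂₃ {D : AbstractSimplicialComplex W} {a b c : W} (h : D.Tri a b c) :
    D.skeleton.Adj b c := h.rot.adj

theorem Tri.mem_triangles {D : AbstractSimplicialComplex W} {a b c : W} (h : D.Tri a b c) :
    ({a, b, c} : Finset W) ∈ D.triangles :=
  ⟨h.2.2.2, Finset.card_eq_three.2 ⟨a, b, c, h.1, h.2.1, h.2.2.1, rfl⟩⟩

theorem exists_tri_of_mem_triangles {D : AbstractSimplicialComplex W} {s : Finset W}
    (h : s ∈ D.triangles) : ∃ a b c, D.Tri a b c ∧ s = {a, b, c} := by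
  obtain ⟨a, b, c, h1, h2, h3, rfl⟩ := Finset.card_eq_three.1 h.2
  exact ⟨a, b, c, ⟨h1, h2, h3, h.1⟩, rfl⟩

theorem tri_of_mem {D : AbstractSimplicialComplex W} {a b c : W}
    (h : ({a, b, c} : Finset W) ∈ D.triangles) : D.Tri a b c := by
  have := h.2
  refine ⟨?_, ?_, ?_, h.1⟩ <;> rintro rfl <;> revert this
  · simp only [Finset.insert_eq_of_mem, Finset.mem_insert, true_or]
    exact fun h => by have := Finset.card_le_two (a := a) (b := c); omega
  · rw [Finset.insert_comm, Finset.pair_eq_singleton]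
    exact fun h => by have := Finset.card_le_two (a := b) (b := a); omega
  · rw [Finset.pair_eq_singleton]
    exact fun h => by have := Finset.card_le_two (a := a) (b := b); omega

theorem exists_apex_of_subset {D : AbstractSimplicialComplex W} {s : Finset W} {a b : W}
    (h : s ∈ D.triangles) (hab : a ≠ b) (hs : {a, b} ⊆ s) :
    ∃ c, D.Tri a b c ∧ s = {a, b, c} := by
  have h1 : (s \ {a, b}).card = 1 := by
    rw [Finset.card_sdiff_of_subset hs, h.2, Finset.card_pair hab]
  obtain ⟨c, hc⟩ := Finset.card_eq_one.1 h1
  have : s = {a, b, c} := by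
    rw [← Finset.sdiff_union_of_subset hs, hc]
    ext x; simp; tauto
  exact ⟨c, tri_of_mem (this ▸ h), this⟩

theorem exists_tri_of_mem {D : AbstractSimplicialComplex W} {s : Finset W} {a : W}
    (h : s ∈ D.triangles) (ha : a ∈ s) : ∃ b c, D.Tri a b c ∧ s = {a, b, c} := by
  have : (s.erase a).card = 2 := by rw [Finset.card_erase_of_mem ha, h.2]
  obtain ⟨b, c, hbc, h'⟩ := Finset.card_eq_two.1 this
  have : s = {a, b, c} := by rw [← Finset.insert_erase ha, h']
  exact ⟨b, c, tri_of_mem (this ▸ h), this⟩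

theorem mem_edges_pair {D : AbstractSimplicialComplex W} {a b : W} :
    ({a, b} : Finset W) ∈ D.edges ↔ D.skeleton.Adj a b := by
  constructor
  · rintro ⟨h, h2⟩
    exact ⟨Finset.card_pair_eq_two_iff.1 h2, h⟩
  · rintro ⟨h, h2⟩
    exact ⟨h2, Finset.card_pair h⟩

theorem exists_adj_of_mem_edges {D : AbstractSimplicialComplex W} {e : Finset W}
    (h : e ∈ D.edges) : ∃ a b, D.skeleton.Adj a b ∧ e = {a, b} := by
  obtain ⟨a, b, hab, rfl⟩ := Finset.card_eq_two.1 h.2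
  exact ⟨a, b, ⟨hab, h.1⟩, rfl⟩

theorem exists_adj_of_mem_edge {D : AbstractSimplicialComplex W} {e : Finset W} {a : W}
    (h : e ∈ D.edges) (ha : a ∈ e) : ∃ b, D.skeleton.Adj a b ∧ e = {a, b} := by
  obtain ⟨b, c, hab, rfl⟩ := exists_adj_of_mem_edges h
  simp only [Finset.mem_insert, Finset.mem_singleton] at ha
  rcases ha with rfl | rfl
  · exact ⟨c, hab, rfl⟩
  · exact ⟨b, hab.symm, Finset.pair_comm _ _⟩

theorem eq_of_triple_eq {a b c d : W} (hc : c ≠ a) (hc' : c ≠ b)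
    (h : ({a, b, c} : Finset W) = {a, b, d}) : c = d := by
  have : c ∈ ({a, b, d} : Finset W) := h ▸ by simp
  simpa [hc, hc'] using this

theorem eq_of_pair_eq {a b c : W} (h : ({a, b} : Finset W) = {a, c}) (hb : b ≠ a) : b = c := by
  have : b ∈ ({a, c} : Finset W) := h ▸ by simp
  simpa [hb] using this

theorem pair_eq_pair_iff {a b c d : W} :
    ({a, b} : Finset W) = {c, d} ↔ a = c ∧ b = d ∨ a = d ∧ b = c := by
  rw [← Finset.coe_inj]
  push_cast
  exact Set.pair_eq_pair_iff

theorem cofaceCount_pair (D : AbstractSimplicialComplex W) {a b : W} (hab : a ≠ b) :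
    D.cofaceCount {a, b} = {c | D.Tri a b c}.ncard := by
  symm
  refine Set.ncard_congr (fun c _ => {a, b, c}) ?_ ?_ ?_
  · intro c hc
    exact ⟨hc.mem_triangles, by intro x; simp; tauto⟩
  · intro c d hc hd h
    exact eq_of_triple_eq hc.2.1.symm hc.2.2.1.symm h
  · rintro s ⟨hs, hs'⟩
    obtain ⟨c, hc, rfl⟩ := exists_apex_of_subset hs hab hs'
    exact ⟨c, hc, rfl⟩

/-- Otherwise the edge from `w` to `a` would have a single coface and `w` would be a boundary
vertex. This is the tool for walking around the link of an interior vertex. -/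
theorem IsInterior.exists_tri_ne {D : AbstractSimplicialComplex W} {w a b : W}
    (hw : D.IsInterior w) (h : D.Tri w a b) :
    ∃ c, c ≠ b ∧ D.Tri w a c := by
  by_contra! hc
  apply hw
  refine ⟨{w, a}, ⟨mem_edges_pair.2 h.adj, ?_⟩, by simp⟩
  rw [cofaceCount_pair D h.1]
  refine Set.ncard_eq_one.2 ⟨b, ?_⟩
  ext x
  simp only [Set.mem_ofPred_eq, Set.mem_singleton_iff]
  constructor
  · intro hx
    by_contra hxb
    exact hc x hxb hx
  · rintro rfl
    exact h

theorem isInterior_of {D : AbstractSimplicialComplex W} {w : W}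
    (h : ∀ x, D.skeleton.Adj w x → ∃ b c, b ≠ c ∧ D.Tri w x b ∧ D.Tri w x c) :
    D.IsInterior w := by
  rintro ⟨e, ⟨he, he'⟩, hw⟩
  obtain ⟨x, hx, rfl⟩ := exists_adj_of_mem_edge he hw
  obtain ⟨b, c, hbc, hb, hc⟩ := h x hx
  rw [cofaceCount_pair D hx.1] at he'
  obtain ⟨y, hy⟩ := Set.ncard_eq_one.1 he'
  have h1 : b ∈ ({y} : Set W) := hy ▸ hb
  have h2 : c ∈ ({y} : Set W) := hy ▸ hc
  exact hbc (h1.trans h2.symm)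

/-- `D` is a connected triangulated compact surface with nonempty boundary. -/
structure IsSurface (D : AbstractSimplicialComplex W) : Prop where
  finite : Finite W
  card_le_three : ∀ s ∈ D, s.card ≤ 3
  edge_cofaces : ∀ e ∈ D.edges, D.cofaceCount e = 1 ∨ D.cofaceCount e = 2
  link_connected : ∀ v : W, (D.linkGraph v).Connected
  connected : D.skeleton.Connected
  boundary_nonempty : D.boundaryEdges.Nonempty

theorem IsDisc.isSurface {D : AbstractSimplicialComplex W} (h : D.IsDisc) : D.IsSurface :=
  ⟨h.finite, h.card_le_three, h.edge_cofaces, h.link_connected, h.connected,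
    h.boundary_nonempty⟩

namespace IsSurface

variable {D : AbstractSimplicialComplex W}

theorem exists_tri (hD : D.IsSurface) {a b : W} (h : D.skeleton.Adj a b) :
    ∃ c, D.Tri a b c := by
  have h1 := hD.edge_cofaces _ (mem_edges_pair.2 h)
  rw [cofaceCount_pair D h.1] at h1
  by_contra! hc
  have : {c | D.Tri a b c} = ∅ := by ext; simp [hc]
  rw [this] at h1
  simp at h1

theorem tri_eq (hD : D.IsSurface) {a b c d e : W} (hc : D.Tri a b c) (hd : D.Tri a b d)
    (he : D.Tri a b e) (hcd : c ≠ d) : e = c ∨ e = d := by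
  have h1 := hD.edge_cofaces _ (mem_edges_pair.2 hc.adj)
  rw [cofaceCount_pair D hc.1] at h1
  by_contra! h
  have := hD.finite
  have h3 : ({c, d, e} : Set W).ncard ≤ {c | D.Tri a b c}.ncard := by
    refine Set.ncard_le_ncard ?_ (Set.toFinite _)
    rintro x (rfl | rfl | rfl) <;> assumption
  rw [Set.ncard_eq_three.2 ⟨c, d, e, hcd, h.1.symm, h.2.symm, rfl⟩] at h3
  omega

/-- Induction over the link of a vertex, which is connected. -/
theorem link_induction (hD : D.IsSurface) {w x : W} (S : Set W) (hx : x ∈ S)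
    (hwx : D.skeleton.Adj w x) (hS : ∀ y ∈ S, ∀ z, D.Tri w y z → z ∈ S) {y : W}
    (hy : D.skeleton.Adj w y) : y ∈ S := by
  obtain ⟨p⟩ := (hD.link_connected w).preconnected ⟨x, hwx⟩ ⟨y, hy⟩
  have key : ∀ (u u' : {z : W // D.skeleton.Adj w z}), (D.linkGraph w).Walk u u' →
      u.1 ∈ S → u'.1 ∈ S := by
    intro u u' p
    induction p with
    | nil => exact id
    | @cons a b c h p ih =>
      intro ha
      exact ih (hS _ ha _ ⟨a.2.1, b.2.1, fun h' => h.1 (Subtype.ext h'), h.2⟩)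
  exact key _ _ p hx

/-- Induction over the vertices of a connected complex. -/
theorem vertex_induction (hD : D.IsSurface) {x : W} (S : Set W) (hx : x ∈ S)
    (hS : ∀ y ∈ S, ∀ z, D.skeleton.Adj y z → z ∈ S) (y : W) : y ∈ S := by
  obtain ⟨p⟩ := hD.connected.preconnected x y
  induction p with
  | nil => exact hx
  | cons h p ih => exact ih (hS _ hx _ h)

theorem exists_adj (hD : D.IsSurface) (w : W) : ∃ x, D.skeleton.Adj w x :=
  let ⟨x⟩ := (hD.link_connected w).nonempty
  ⟨x.1, x.2⟩

/-- A nonempty set of vertices of the link of `w` in which each vertex has two neighbours is the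
whole link, and then `w` is an interior vertex. -/
theorem closed_link (hD : D.IsSurface) {w : W} {S : Finset W} (hne : S.Nonempty)
    (hS : ∀ x ∈ S, ∃ y ∈ S, ∃ z ∈ S, y ≠ z ∧ D.Tri w x y ∧ D.Tri w x z) :
    D.IsInterior w ∧ D.skeleton.neighborSet w = S := by
  obtain ⟨x, hx⟩ := hne
  have hall : ∀ y, D.skeleton.Adj w y → y ∈ S := by
    intro y hy
    obtain ⟨z, -, -, -, -, hz, -⟩ := hS x hx
    -- An edge has at most two apexes, and `S` already contains two over each edge from `w` to `S`,
    -- so no step in the link leaves `S`.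
    refine hD.link_induction (S : Set W) hx hz.adj ?_ hy
    intro u hu u' hu'
    obtain ⟨p, hp, q, hq, hpq, h1, h2⟩ := hS u hu
    rcases hD.tri_eq h1 h2 hu' hpq with rfl | rfl <;> assumption
  refine ⟨isInterior_of fun y hy => ?_, ?_⟩
  · obtain ⟨p, hp, q, hq, hpq, h1, h2⟩ := hS y (hall y hy)
    exact ⟨p, q, hpq, h1, h2⟩
  · ext y
    constructor
    · exact hall y
    · intro hy
      obtain ⟨p, hp, q, hq, hpq, h1, h2⟩ := hS y hy
      exact h1.adj

end IsSurface

/-! ### Counting the triangles of a set over an edge -/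

/-- The number of triangles in `R` that contain `e`. -/
noncomputable def cnt (R : Finset (Finset W)) (e : Finset W) : ℕ := {s ∈ R | e ⊆ s}.card

section cnt

variable {D : AbstractSimplicialComplex W} {R Q : Finset (Finset W)} {a b c d : W}

theorem cnt_mono (h : R ⊆ Q) (e : Finset W) : cnt R e ≤ cnt Q e :=
  Finset.card_le_card (Finset.filter_subset_filter _ h)

theorem cnt_union (h : Disjoint R Q) (e : Finset W) : cnt (R ∪ Q) e = cnt R e + cnt Q e := by
  unfold cnt
  rw [Finset.filter_union, Finset.card_union_of_disjoint (Finset.disjoint_filter_filter h)]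

theorem cnt_sdiff_add (R Q : Finset (Finset W)) (e : Finset W) :
    cnt (R \ Q) e + cnt (R ∩ Q) e = cnt R e := by
  rw [← cnt_union (Finset.disjoint_sdiff_inter R Q), Finset.sdiff_union_inter]

theorem cnt_pos_of_mem (h : {a, b, c} ∈ R) : 0 < cnt R {a, b} :=
  Finset.card_pos.2 ⟨_, Finset.mem_filter.2 ⟨h, by intro x; simp; tauto⟩⟩

theorem exists_mem_of_cnt_pos (hR : ∀ s ∈ R, s ∈ D.triangles) (hab : a ≠ b)
    (h : 0 < cnt R {a, b}) : ∃ c, {a, b, c} ∈ R ∧ D.Tri a b c := by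
  obtain ⟨s, hs⟩ := Finset.card_pos.1 h
  rw [Finset.mem_filter] at hs
  obtain ⟨c, hc, rfl⟩ := exists_apex_of_subset (hR s hs.1) hab hs.2
  exact ⟨c, hs.1, hc⟩

theorem exists_two_of_one_lt_cnt (hR : ∀ s ∈ R, s ∈ D.triangles) (hab : a ≠ b)
    (h : 1 < cnt R {a, b}) : ∃ c d, c ≠ d ∧ {a, b, c} ∈ R ∧ D.Tri a b c ∧
      {a, b, d} ∈ R ∧ D.Tri a b d := by
  obtain ⟨s, hs, s', hs', hne⟩ := Finset.one_lt_card.1 h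
  rw [Finset.mem_filter] at hs hs'
  obtain ⟨c, hc, rfl⟩ := exists_apex_of_subset (hR s hs.1) hab hs.2
  obtain ⟨d, hd, rfl⟩ := exists_apex_of_subset (hR s' hs'.1) hab hs'.2
  exact ⟨c, d, fun h => hne (by rw [h]), hs.1, hc, hs'.1, hd⟩

theorem one_lt_cnt (h : D.Tri a b c) (hc : {a, b, c} ∈ R) (hd : {a, b, d} ∈ R) (hcd : c ≠ d) :
    1 < cnt R {a, b} := by
  refine Finset.one_lt_card.2 ⟨{a, b, c}, ?_, {a, b, d}, ?_, fun h' => hcd ?_⟩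
  · exact Finset.mem_filter.2 ⟨hc, by intro x; simp; tauto⟩
  · exact Finset.mem_filter.2 ⟨hd, by intro x; simp; tauto⟩
  · exact eq_of_triple_eq h.2.1.symm h.2.2.1.symm h'

theorem IsSurface.cnt_le_two (hD : D.IsSurface) (hR : ∀ s ∈ R, s ∈ D.triangles) (hab : a ≠ b) :
    cnt R {a, b} ≤ 2 := by
  by_contra! h
  obtain ⟨s, hs, s', hs', s'', hs'', h1, h2, h3⟩ := Finset.two_lt_card.1 h
  rw [Finset.mem_filter] at hs hs' hs''
  obtain ⟨c, hc, rfl⟩ := exists_apex_of_subset (hR s hs.1) hab hs.2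
  obtain ⟨d, hd, rfl⟩ := exists_apex_of_subset (hR s' hs'.1) hab hs'.2
  obtain ⟨e, he, rfl⟩ := exists_apex_of_subset (hR s'' hs''.1) hab hs''.2
  rcases hD.tri_eq hc hd he (fun h => h1 (by rw [h])) with rfl | rfl
  · exact h2 rfl
  · exact h3 rfl

theorem IsSurface.mem_of_cnt_eq_two (hD : D.IsSurface) (hR : ∀ s ∈ R, s ∈ D.triangles)
    (h : D.Tri a b c) (h2 : cnt R {a, b} = 2) : {a, b, c} ∈ R := by
  obtain ⟨x, y, hxy, hx, hx', hy, hy'⟩ := exists_two_of_one_lt_cnt hR h.1 (by omega)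
  rcases hD.tri_eq hx' hy' h hxy with rfl | rfl <;> assumption

theorem eq_of_cnt_eq_one (h : D.Tri a b c) (h1 : cnt R {a, b} = 1) (hc : {a, b, c} ∈ R)
    (hd : {a, b, d} ∈ R) : c = d := by
  by_contra hne
  have := one_lt_cnt h hc hd hne
  omega

end cnt

end
end AbstractSimplicialComplex

/-! ### Rank counts for chain complexes over `ZMod 2` -/

namespace AbstractSimplicialComplex

section
open scoped Classical

/-- Chains modulo 2 are finite sets, so rank–nullity can be used while all geometric statements
speak of sets of edges and triangles. -/
theorem exists_indicator {β : Type*} (E : Finset β) (x : E → ZMod 2) :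
    ∃ z ⊆ E, x = fun e : E => if e.1 ∈ z then 1 else 0 := by
  refine ⟨(Finset.univ.filter (x · = 1)).map (Function.Embedding.subtype _), ?_, ?_⟩
  · intro e he
    simp only [Finset.mem_map] at he
    obtain ⟨a, -, rfl⟩ := he
    exact a.2
  · ext e
    have key : ∀ y : ZMod 2, y = if y = 1 then 1 else 0 := by decide
    rw [key (x e)]
    simp

/-- The incidence matrix over `ZMod 2` of a relation between two finite sets. -/
noncomputable def incMatrix {β γ : Type*} (E : Finset β) (U : Finset γ) (r : γ → β → Prop)
    [∀ w e, Decidable (r w e)] : Matrix U E (ZMod 2) :=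
  Matrix.of fun w e => if r w.1 e.1 then 1 else 0

theorem incMatrix_mulVec {β γ : Type*} {E : Finset β} {U : Finset γ} {r : γ → β → Prop}
    [∀ w e, Decidable (r w e)] {z : Finset β} (hz : z ⊆ E) (w : U) :
    (incMatrix E U r).mulVec (fun e : E => if e.1 ∈ z then 1 else 0) w =
      (({e ∈ z | r w.1 e}.card : ℕ) : ZMod 2) := by
  simp only [Matrix.mulVec, dotProduct, incMatrix, Matrix.of_apply]
  rw [Finset.sum_coe_sort E
    (fun e => (if r w.1 e then (1 : ZMod 2) else 0) * if e ∈ z then 1 else 0)]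
  simp only [← ite_and, mul_ite, mul_one, mul_zero]
  rw [Finset.sum_boole]
  congr 2
  ext e
  simp only [Finset.mem_filter]
  exact ⟨fun h => ⟨h.2.1, h.2.2⟩, fun h => ⟨hz h.1, h.1, h.2⟩⟩

theorem natCast_eq_ite_iff (p : Prop) [Decidable p] (n : ℕ) :
    ((n : ZMod 2) = if p then 1 else 0) ↔ (p ↔ Odd n) := by
  split_ifs with h
  · simp [h, ZMod.natCast_eq_one_iff_odd]
  · simp [h, ZMod.natCast_eq_zero_iff_even]

section rank

variable {α β γ : Type*} {T : Finset α} {E : Finset β} {U : Finset γ}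
  {r : γ → β → Prop} {q : β → α → Prop}
  [∀ w e, Decidable (r w e)] [∀ e s, Decidable (q e s)]

/-- A lower Euler characteristic bound: if all cycles are boundaries, then
`#U - #E + #T ≥ 0`. -/
theorem card_le_of_cycles_bound
    (h : ∀ z ⊆ E, (∀ w ∈ U, Even {e ∈ z | r w e}.card) →
      ∃ R ⊆ T, ∀ e ∈ E, (e ∈ z ↔ Odd {s ∈ R | q e s}.card)) :
    E.card ≤ U.card + T.card := by
  set M := (incMatrix E U r).mulVecLin with hM
  set N := (incMatrix T E q).mulVecLin with hN
  have hle : LinearMap.ker M ≤ LinearMap.range N := by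
    intro x hx
    obtain ⟨z, hz, rfl⟩ := exists_indicator E x
    obtain ⟨R, hR, hR'⟩ := h z hz (by
      intro w hw
      have := congrFun (LinearMap.mem_ker.1 hx) ⟨w, hw⟩
      rw [hM, Matrix.mulVecLin_apply, incMatrix_mulVec hz] at this
      simpa [ZMod.natCast_eq_zero_iff_even] using this)
    refine ⟨fun s : T => if s.1 ∈ R then 1 else 0, ?_⟩
    ext e
    rw [hN, Matrix.mulVecLin_apply, incMatrix_mulVec hR]
    exact (natCast_eq_ite_iff _ _).2 (hR' e.1 e.2)
  -- `#E = rank M + dim ker M ≤ #U + rank N ≤ #U + #T`.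
  have h1 := LinearMap.finrank_range_add_finrank_ker M
  have h2 := Submodule.finrank_mono hle
  have h3 := LinearMap.finrank_range_le N
  have h4 := Submodule.finrank_le (LinearMap.range M)
  simp only [Module.finrank_fintype_fun_eq_card, Fintype.card_coe] at h1 h3 h4
  omega

/-- The three hypotheses say, in terms of sets, that the second homology vanishes, that the boundary
map from edges to the vertices in `U` is onto, and that the boundary of a boundary is zero. -/
theorem boundary_maps
    (hinj : ∀ R ⊆ T, (∀ e ∈ E, Even {s ∈ R | q e s}.card) → R = ∅)
    (hsurj : ∀ Y ⊆ U, ∃ z ⊆ E, ∀ w ∈ U, (w ∈ Y ↔ Odd {e ∈ z | r w e}.card))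
    (hcomp : ∀ R ⊆ T, ∀ w ∈ U, Even {e ∈ E | Odd {s ∈ R | q e s}.card ∧ r w e}.card) :
    Function.Injective (incMatrix T E q).mulVecLin ∧
    Function.Surjective (incMatrix E U r).mulVecLin ∧
    LinearMap.range (incMatrix T E q).mulVecLin ≤ LinearMap.ker (incMatrix E U r).mulVecLin := by
  refine ⟨?_, ?_, ?_⟩
  · rw [← LinearMap.ker_eq_bot, eq_bot_iff]
    intro y hy
    obtain ⟨R, hR, rfl⟩ := exists_indicator T y
    have := hinj R hR (by
      intro e he
      have := congrFun (LinearMap.mem_ker.1 hy) ⟨e, he⟩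
      rw [Matrix.mulVecLin_apply, incMatrix_mulVec hR] at this
      simpa [ZMod.natCast_eq_zero_iff_even] using this)
    subst this
    rw [Submodule.mem_bot]
    ext; simp
  · intro y
    obtain ⟨Y, hY, rfl⟩ := exists_indicator U y
    obtain ⟨z, hz, h⟩ := hsurj Y hY
    refine ⟨fun e : E => if e.1 ∈ z then 1 else 0, ?_⟩
    ext w
    rw [Matrix.mulVecLin_apply, incMatrix_mulVec hz]
    exact (natCast_eq_ite_iff _ _).2 (h w.1 w.2)
  · rintro _ ⟨y, rfl⟩
    obtain ⟨R, hR, rfl⟩ := exists_indicator T y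
    have key : (incMatrix T E q).mulVecLin (fun s : T => if s.1 ∈ R then 1 else 0) =
        fun e : E => if e.1 ∈ ({e ∈ E | Odd {s ∈ R | q e s}.card} : Finset β) then 1 else 0 := by
      ext e
      rw [Matrix.mulVecLin_apply, incMatrix_mulVec hR]
      refine (natCast_eq_ite_iff _ _).2 ?_
      simp
    rw [LinearMap.mem_ker, key]
    ext w
    rw [Matrix.mulVecLin_apply, incMatrix_mulVec (Finset.filter_subset _ _),
      Finset.filter_filter]
    have := hcomp R hR w.1 w.2
    rw [← ZMod.natCast_eq_zero_iff_even] at this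
    rw [this]; rfl

/-- The image of the boundary map on triangles has dimension `#T` and lies in a kernel of dimension
`#E - #U`. -/
theorem card_add_card_le
    (hinj : ∀ R ⊆ T, (∀ e ∈ E, Even {s ∈ R | q e s}.card) → R = ∅)
    (hsurj : ∀ Y ⊆ U, ∃ z ⊆ E, ∀ w ∈ U, (w ∈ Y ↔ Odd {e ∈ z | r w e}.card))
    (hcomp : ∀ R ⊆ T, ∀ w ∈ U, Even {e ∈ E | Odd {s ∈ R | q e s}.card ∧ r w e}.card) :
    T.card + U.card ≤ E.card := by
  obtain ⟨h1, h2, h3⟩ := boundary_maps hinj hsurj hcomp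
  have h4 := LinearMap.finrank_range_add_finrank_ker (incMatrix E U r).mulVecLin
  have h5 := Submodule.finrank_mono h3
  rw [LinearMap.finrank_range_of_inj h1] at h5
  rw [LinearMap.range_eq_top.2 h2, finrank_top] at h4
  simp only [Module.finrank_fintype_fun_eq_card, Fintype.card_coe] at h4 h5
  omega

/-- In the equality case this image and this kernel have the same dimension, so they coincide. -/
theorem cycles_bound_of_card_eq
    (hinj : ∀ R ⊆ T, (∀ e ∈ E, Even {s ∈ R | q e s}.card) → R = ∅)
    (hsurj : ∀ Y ⊆ U, ∃ z ⊆ E, ∀ w ∈ U, (w ∈ Y ↔ Odd {e ∈ z | r w e}.card))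
    (hcomp : ∀ R ⊆ T, ∀ w ∈ U, Even {e ∈ E | Odd {s ∈ R | q e s}.card ∧ r w e}.card)
    (hcard : T.card + U.card = E.card) {z : Finset β}
    (hz : z ⊆ E) (hz' : ∀ w ∈ U, Even {e ∈ z | r w e}.card) :
    ∃ R ⊆ T, ∀ e ∈ E, (e ∈ z ↔ Odd {s ∈ R | q e s}.card) := by
  obtain ⟨h1, h2, h3⟩ := boundary_maps hinj hsurj hcomp
  have h4 := LinearMap.finrank_range_add_finrank_ker (incMatrix E U r).mulVecLin
  rw [LinearMap.range_eq_top.2 h2, finrank_top] at h4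
  simp only [Module.finrank_fintype_fun_eq_card, Fintype.card_coe] at h4
  have h5 := Submodule.eq_of_le_of_finrank_eq h3 (by
    rw [LinearMap.finrank_range_of_inj h1]
    simp only [Module.finrank_fintype_fun_eq_card, Fintype.card_coe]
    omega)
  have hx : (fun e : E => if e.1 ∈ z then (1 : ZMod 2) else 0) ∈
      LinearMap.ker (incMatrix E U r).mulVecLin := by
    rw [LinearMap.mem_ker]
    ext w
    rw [Matrix.mulVecLin_apply, incMatrix_mulVec hz,
      ZMod.natCast_eq_zero_iff_even.2 (hz' w.1 w.2)]
    rfl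
  rw [← h5] at hx
  obtain ⟨y, hy⟩ := hx
  obtain ⟨R, hR, rfl⟩ := exists_indicator T y
  refine ⟨R, hR, fun e he => ?_⟩
  have := congrFun hy ⟨e, he⟩
  rw [Matrix.mulVecLin_apply, incMatrix_mulVec hR] at this
  exact (natCast_eq_ite_iff _ _).1 this

end rank

end
end AbstractSimplicialComplex

/-! ### Homology modulo 2 of surfaces and discs -/

namespace AbstractSimplicialComplex

section
open scoped Classical

variable {W : Type*} {D : AbstractSimplicialComplex W}

/-- The number of elements of `z` that contain `w`. -/
noncomputable def degIn (z : Finset (Finset W)) (w : W) : ℕ := {e ∈ z | w ∈ e}.card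

theorem even_card_symmDiff {α : Type*} (A B : Finset α) :
    Even (symmDiff A B).card ↔ (Even A.card ↔ Even B.card) := by
  have h1 := Finset.card_sdiff_add_card_inter A B
  have h2 := Finset.card_sdiff_add_card_inter B A
  rw [Finset.inter_comm] at h2
  have h3 : (symmDiff A B).card = (A \ B).card + (B \ A).card := by
    rw [symmDiff_def, Finset.sup_eq_union,
      Finset.card_union_of_disjoint disjoint_sdiff_sdiff]
  rw [h3, ← h1, ← h2]
  simp only [Nat.even_add]
  tauto

theorem even_degIn_symmDiff (z z' : Finset (Finset W)) (w : W) :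
    Even (degIn (symmDiff z z') w) ↔ (Even (degIn z w) ↔ Even (degIn z' w)) := by
  unfold degIn
  rw [← even_card_symmDiff]
  congr! 2
  ext e
  simp only [Finset.mem_filter, Finset.mem_symmDiff]
  tauto

/-- The link of `w` is connected, so crossing edges at `w` leads from one triangle of the star to
all others. -/
theorem IsSurface.all_mem_of_star (hD : D.IsSurface) {R : Finset (Finset W)}
    {w a b : W} (hab : D.Tri w a b) (hmem : {w, a, b} ∈ R)
    (h : ∀ x c d, D.Tri w x c → D.Tri w x d → {w, x, c} ∈ R → {w, x, d} ∈ R) {c d : W}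
    (hcd : D.Tri w c d) : {w, c, d} ∈ R := by
  have key : c ∈ {x | ∃ y, D.Tri w x y ∧ {w, x, y} ∈ R} := by
    refine hD.link_induction {x | ∃ y, D.Tri w x y ∧ {w, x, y} ∈ R} ⟨b, hab, hmem⟩ hab.adj ?_
      hcd.adj
    rintro x ⟨y, hy, hy'⟩ z hz
    exact ⟨x, hz.swap', by rw [Finset.pair_comm]; exact h x y z hy hz hy'⟩
  obtain ⟨y, hy, hy'⟩ := key
  exact h c y d hy hcd hy'

/-- A set of triangles without boundary in a surface with nonempty boundary is empty. -/
theorem IsSurface.eq_empty_of_even_cnt (hD : D.IsSurface) {R : Finset (Finset W)}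
    (hR : ∀ s ∈ R, s ∈ D.triangles) (h : ∀ e ∈ D.edges, Even (cnt R e)) : R = ∅ := by
  by_contra hne
  obtain ⟨s, hs⟩ := Finset.nonempty_iff_ne_empty.2 hne
  obtain ⟨a, b, c, habc, rfl⟩ := exists_tri_of_mem_triangles (hR s hs)
  -- A positive even count that is at most 2 equals 2, so `R` contains every coface of each edge it
  -- meets.
  have hpair : ∀ w x c d, D.Tri w x c → D.Tri w x d → {w, x, c} ∈ R → {w, x, d} ∈ R := by
    intro w x c d hc hd hmem
    have h1 := h _ (mem_edges_pair.2 hc.adj)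
    have h2 := cnt_pos_of_mem hmem
    have h3 := hD.cnt_le_two hR hc.1
    refine hD.mem_of_cnt_eq_two hR hd ?_
    rcases h1 with ⟨k, hk⟩
    omega
  have hstar : ∀ w a b, D.Tri w a b → {w, a, b} ∈ R → ∀ c d, D.Tri w c d → {w, c, d} ∈ R :=
    fun w a b hab hmem c d hcd => hD.all_mem_of_star hab hmem (hpair w) hcd
  -- By connectedness `R` spreads to the star of every vertex, but a boundary edge has an odd number
  -- of cofaces.
  obtain ⟨e, he, he'⟩ := hD.boundary_nonempty
  obtain ⟨p, q, hpq, rfl⟩ := exists_adj_of_mem_edges he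
  have hp : p ∈ {w | ∀ c d, D.Tri w c d → ({w, c, d} : Finset W) ∈ R} := by
    refine hD.vertex_induction {w | ∀ c d, D.Tri w c d → ({w, c, d} : Finset W) ∈ R}
      (hstar a b c habc hs) ?_ p
    intro y hy z hz
    obtain ⟨x, hx⟩ := hD.exists_tri hz
    refine hstar z y x hx.swap ?_
    rw [Finset.insert_comm]
    exact hy _ _ hx
  rw [cofaceCount_pair D hpq.1] at he'
  obtain ⟨x, hx⟩ := Set.ncard_eq_one.1 he'
  have hx' : D.Tri p q x := by
    have : x ∈ {c | D.Tri p q c} := hx ▸ rfl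
    exact this
  have h1 := h _ (mem_edges_pair.2 hpq)
  have h2 := cnt_pos_of_mem (hp q x hx')
  have h3 := hD.cnt_le_two hR hpq.1
  obtain ⟨c, d, hcd, -, hc, -, hd⟩ := exists_two_of_one_lt_cnt hR hpq.1
    (show 1 < cnt R {p, q} by rcases h1 with ⟨k, hk⟩; omega)
  have h4 : c ∈ ({x} : Set W) := hx ▸ hc
  have h5 : d ∈ ({x} : Set W) := hx ▸ hd
  exact hcd (h4.trans h5.symm)

variable [Fintype W]

/-- The finite set of triangles of a finite complex. -/
noncomputable def triFinset (D : AbstractSimplicialComplex W) : Finset (Finset W) :=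
  {s | s ∈ D.triangles}

/-- The finite set of edges of a finite complex. -/
noncomputable def edgeFinset (D : AbstractSimplicialComplex W) : Finset (Finset W) :=
  {s | s ∈ D.edges}

@[simp] theorem mem_triFinset {s : Finset W} : s ∈ D.triFinset ↔ s ∈ D.triangles := by
  simp [triFinset]

@[simp] theorem mem_edgeFinset {s : Finset W} : s ∈ D.edgeFinset ↔ s ∈ D.edges := by
  simp [edgeFinset]

theorem ncard_triangles (D : AbstractSimplicialComplex W) :
    D.triangles.ncard = D.triFinset.card := by
  rw [← Set.ncard_coe_finset]; congr; ext; simp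

theorem ncard_edges (D : AbstractSimplicialComplex W) :
    D.edges.ncard = D.edgeFinset.card := by
  rw [← Set.ncard_coe_finset]; congr; ext; simp

theorem degIn_eq_card {z : Finset (Finset W)} (hz : ∀ e ∈ z, e.card = 2) (w : W) :
    degIn z w = (Finset.univ.filter fun x => x ≠ w ∧ {w, x} ∈ z).card := by
  symm
  refine Finset.card_bij (fun x _ => {w, x}) ?_ ?_ ?_
  · intro x hx
    simp only [Finset.mem_filter, Finset.mem_univ, true_and] at hx ⊢
    exact ⟨hx.2, by simp⟩
  · intro x hx y hy h
    simp only [Finset.mem_filter, Finset.mem_univ, true_and] at hx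
    exact eq_of_pair_eq h hx.1
  · intro e he
    simp only [Finset.mem_filter] at he
    obtain ⟨a, b, hab, rfl⟩ := Finset.card_eq_two.1 (hz e he.1)
    simp only [Finset.mem_filter, Finset.mem_univ, true_and]
    have := he.2
    simp only [Finset.mem_insert, Finset.mem_singleton] at this
    rcases this with rfl | rfl
    · exact ⟨b, ⟨hab.symm, he.1⟩, rfl⟩
    · exact ⟨a, ⟨hab, Finset.pair_comm a w ▸ he.1⟩, Finset.pair_comm _ _⟩

/-- Each triangle at `w` has two of its edges at `w`. -/
theorem sum_cnt {R : Finset (Finset W)} (hR : ∀ s ∈ R, s.card = 3) (w : W) :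
    ∑ x ∈ Finset.univ.erase w, cnt R {w, x} = 2 * degIn R w := by
  have h := Finset.sum_card_bipartiteAbove_eq_sum_card_bipartiteBelow
    (s := Finset.univ.erase w) (t := R) (fun x s => {w, x} ⊆ s)
  simp only [Finset.bipartiteAbove, Finset.bipartiteBelow] at h
  unfold cnt degIn
  rw [h, Finset.card_filter, Finset.mul_sum]
  refine Finset.sum_congr rfl fun s hs => ?_
  split_ifs with hw
  · have : {x ∈ Finset.univ.erase w | {w, x} ⊆ s} = s.erase w := by
      ext x
      simp [Finset.insert_subset_iff, hw]
    rw [this, Finset.card_erase_of_mem hw, hR s hs]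
    rfl
  · rw [mul_zero, Finset.card_eq_zero, Finset.filter_eq_empty_iff]
    intro x _ h
    exact hw (h (by simp))

theorem even_card_odd_cnt {R : Finset (Finset W)} (hR : ∀ s ∈ R, s.card = 3) (w : W) :
    Even (Finset.univ.filter fun x => x ≠ w ∧ Odd (cnt R {w, x})).card := by
  have h := sum_cnt hR w
  have h2 : Even (∑ x ∈ Finset.univ.erase w, cnt R {w, x}) := by rw [h]; simp
  rw [Finset.even_sum_iff_even_card_odd] at h2
  convert h2 using 2
  ext x; simp

/-- The boundary of a boundary vanishes. -/
theorem even_degIn_boundary {R E : Finset (Finset W)} (hR : ∀ s ∈ R, s ∈ D.triangles) {w : W}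
    (hE : ∀ e ∈ E, e ∈ D.edges) (hE' : ∀ x, D.skeleton.Adj w x → {w, x} ∈ E) :
    Even (degIn {e ∈ E | Odd (cnt R e)} w) := by
  rw [degIn_eq_card (fun e he => (hE e (Finset.mem_filter.1 he).1).2)]
  convert even_card_odd_cnt (fun s hs => (hR s hs).2) w using 3
  simp only [Finset.mem_filter, and_congr_right_iff, and_iff_right_iff_imp]
  intro hx h
  obtain ⟨c, -, hc⟩ := exists_mem_of_cnt_pos hR hx.symm h.pos
  exact hE' _ hc.adj

theorem even_degIn_boundary' {R E : Finset (Finset W)} (hR : ∀ s ∈ R, s ∈ D.triangles) {w : W}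
    (hE : ∀ e ∈ E, e ∈ D.edges) (hE' : ∀ x, D.skeleton.Adj w x → {w, x} ∈ E) :
    Even {e ∈ E | Odd {s ∈ R | e ⊆ s}.card ∧ w ∈ e}.card := by
  have := even_degIn_boundary hR hE hE'
  unfold degIn cnt at this
  rwa [Finset.filter_filter] at this

namespace IsSurface

/-- The edge set is the boundary-modulo-2 version of a path from `v` to `w`. The parity at `v` is
ignored, which is what makes the boundary map onto. -/
theorem exists_edges_odd_singleton (hD : D.IsSurface) (v w : W) :
    ∃ z ⊆ D.edgeFinset, ∀ u, u ≠ v → (u = w ↔ Odd (degIn z u)) := by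
  refine hD.vertex_induction
    {w | ∃ z ⊆ D.edgeFinset, ∀ u, u ≠ v → (u = w ↔ Odd (degIn z u))} (x := v) ?_ ?_ w
  · exact ⟨∅, by simp, fun u hu => by simp [hu, degIn]⟩
  · rintro y ⟨z, hz, hz'⟩ x hyx
    refine ⟨symmDiff z {{y, x}}, ?_, ?_⟩
    · intro e he
      rw [Finset.mem_symmDiff, Finset.mem_singleton] at he
      rcases he with he | he
      · exact hz he.1
      · rw [he.1, mem_edgeFinset]; exact mem_edges_pair.2 hyx
    · intro u hu
      have h1 : Even (degIn {{y, x}} u) ↔ ¬(u = y ∨ u = x) := by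
        unfold degIn
        rw [Finset.filter_singleton]
        by_cases h2 : u = y ∨ u = x <;> simp [h2]
      rw [← Nat.not_even_iff_odd, even_degIn_symmDiff, h1]
      have h3 := hz' u hu
      rw [← Nat.not_even_iff_odd] at h3
      have hne : y ≠ x := hyx.1
      by_cases hy : u = y
      · subst hy
        tauto
      · tauto

theorem exists_edges_odd (hD : D.IsSurface) (v : W) (Y : Finset W) :
    ∃ z ⊆ D.edgeFinset, ∀ u, u ≠ v → (u ∈ Y ↔ Odd (degIn z u)) := by
  induction Y using Finset.induction_on with
  | empty => exact ⟨∅, by simp, fun u _ => by simp [degIn]⟩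
  | insert w Y hw ih =>
    obtain ⟨z, hz, h⟩ := ih
    obtain ⟨z', hz', h'⟩ := hD.exists_edges_odd_singleton v w
    refine ⟨symmDiff z z', ?_, fun u hu => ?_⟩
    · intro e he
      rw [Finset.mem_symmDiff] at he
      rcases he with he | he
      · exact hz he.1
      · exact hz' he.1
    · rw [← Nat.not_even_iff_odd, even_degIn_symmDiff]
      have h1 := h u hu
      have h2 := h' u hu
      rw [← Nat.not_even_iff_odd] at h1 h2
      rw [Finset.mem_insert]
      by_cases hu' : u = w
      · subst hu'; tauto
      · tauto

/-- In any surface with boundary the boundary map on triangles is injective and the one from edges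
to the vertices other than `v` is onto; this gives one inequality, and the hypothesis that cycles
bound gives the other. The lemma serves to recognize a disc after surgery. -/
theorem euler_char_of_cycles_bound (hD : D.IsSurface) (v : W)
    (h : ∀ z ⊆ D.edgeFinset, (∀ w, w ≠ v → Even (degIn z w)) →
      ∃ R ⊆ D.triFinset, ∀ e ∈ D.edges, (e ∈ z ↔ Odd (cnt R e))) :
    (Nat.card W : ℤ) - D.edges.ncard + D.triangles.ncard = 1 := by
  have h1 : D.edgeFinset.card ≤ (Finset.univ.erase v).card + D.triFinset.card := by
    refine card_le_of_cycles_bound (r := fun w e => w ∈ e) (q := fun e s => e ⊆ s) ?_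
    intro z hz hz'
    obtain ⟨R, hR, hR'⟩ := h z hz (fun w hw => hz' w (by simpa using hw))
    exact ⟨R, hR, fun e he => hR' e (by simpa using he)⟩
  have h2 : D.triFinset.card + (Finset.univ.erase v).card ≤ D.edgeFinset.card := by
    refine card_add_card_le (r := fun w e => w ∈ e) (q := fun e s => e ⊆ s) ?_ ?_ ?_
    · intro R hR hR'
      exact hD.eq_empty_of_even_cnt (fun s hs => by simpa using hR hs)
        (fun e he => hR' e (by simpa using he))
    · intro Y _
      obtain ⟨z, hz, hz'⟩ := hD.exists_edges_odd v Y
      exact ⟨z, hz, fun w hw => hz' w (by simpa using hw)⟩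
    · intro R hR w _
      exact even_degIn_boundary' (D := D) (fun s hs => by simpa using hR hs)
        (fun e he => by simpa using he) (fun x hx => by simpa using mem_edges_pair.2 hx)
  rw [Finset.card_erase_of_mem (Finset.mem_univ _), Finset.card_univ] at h1 h2
  have := Fintype.card_pos_iff.2 ⟨v⟩
  rw [ncard_triangles, ncard_edges, Nat.card_eq_fintype_card]
  omega

end IsSurface

/-- In a disc every cycle modulo 2 is a boundary. -/
theorem IsDisc.cycle_bounds (hD : D.IsDisc) (v : W) {z : Finset (Finset W)}
    (hz : z ⊆ D.edgeFinset) (hz' : ∀ w, w ≠ v → Even (degIn z w)) :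
    ∃ R ⊆ D.triFinset, ∀ e ∈ D.edges, (e ∈ z ↔ Odd (cnt R e)) := by
  have hE := hD.euler_char
  rw [ncard_triangles, ncard_edges, Nat.card_eq_fintype_card] at hE
  have := Fintype.card_pos_iff.2 ⟨v⟩
  -- Euler characteristic 1 reads `#T + (#W - 1) = #E`, the equality case once `v` is dropped from
  -- the vertices.
  obtain ⟨R, hR, hR'⟩ := cycles_bound_of_card_eq (T := D.triFinset) (E := D.edgeFinset)
    (U := Finset.univ.erase v) (r := fun w e => w ∈ e) (q := fun e s => e ⊆ s)
    (by
      intro R hR hR'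
      exact hD.isSurface.eq_empty_of_even_cnt (fun s hs => by simpa using hR hs)
        (fun e he => hR' e (by simpa using he)))
    (by
      intro Y _
      obtain ⟨z, hz, hz'⟩ := hD.isSurface.exists_edges_odd v Y
      exact ⟨z, hz, fun w hw => hz' w (by simpa using hw)⟩)
    (by
      intro R hR w _
      exact even_degIn_boundary' (D := D) (fun s hs => by simpa using hR hs)
        (fun e he => by simpa using he) (fun x hx => by simpa using mem_edges_pair.2 hx))
    (by
      rw [Finset.card_erase_of_mem (Finset.mem_univ _), Finset.card_univ]
      omega) hz (fun w hw => hz' w (by simpa using hw))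
  exact ⟨R, hR, fun e he => hR' e (by simpa using he)⟩

end
end AbstractSimplicialComplex

/-! ### Homology relative to a ball and a relative Gauss–Bonnet formula -/

namespace AbstractSimplicialComplex

section
open scoped Classical

variable {W : Type*} {D : AbstractSimplicialComplex W}

theorem IsSurface.dist_le_succ (hD : D.IsSurface) (v : W) {a b : W} (h : D.skeleton.Adj a b) :
    D.skeleton.dist v a ≤ D.skeleton.dist v b + 1 := by
  have := hD.connected.dist_triangle (u := v) (v := b) (w := a)
  rwa [SimpleGraph.dist_eq_one_iff_adj.2 h.symm] at this

theorem IsSurface.exists_adj_dist (hD : D.IsSurface) {v w : W} {k : ℕ}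
    (h : D.skeleton.dist v w = k + 1) :
    ∃ p, D.skeleton.Adj w p ∧ D.skeleton.dist v p = k := by
  obtain ⟨q, hq⟩ := hD.connected.exists_walk_length_eq_dist w v
  rw [SimpleGraph.dist_comm, h] at hq
  cases q with
  | nil => simp at hq
  | @cons _ p _ hwp q =>
    refine ⟨p, hwp, ?_⟩
    have h1 := SimpleGraph.dist_le q
    have h2 := hD.dist_le_succ v hwp
    rw [SimpleGraph.dist_comm] at h1
    simp only [SimpleGraph.Walk.length_cons] at hq
    omega

theorem IsSurface.dist_eq_zero (hD : D.IsSurface) {v w : W} :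
    D.skeleton.dist v w = 0 ↔ w = v := by
  rw [hD.connected.dist_eq_zero_iff, eq_comm]

theorem degIn_union {z z' : Finset (Finset W)} (h : Disjoint z z') (w : W) :
    degIn (z ∪ z') w = degIn z w + degIn z' w := by
  unfold degIn
  rw [Finset.filter_union, Finset.card_union_of_disjoint (Finset.disjoint_filter_filter h)]

variable [Fintype W]

/-- The edges with an endpoint at distance more than `k` from `v`. -/
noncomputable def outEdges (D : AbstractSimplicialComplex W) (v : W) (k : ℕ) :
    Finset (Finset W) :=
  {e ∈ D.edgeFinset | ∃ w ∈ e, k < D.skeleton.dist v w}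

/-- The triangles with a vertex at distance more than `k` from `v`. -/
noncomputable def outTris (D : AbstractSimplicialComplex W) (v : W) (k : ℕ) :
    Finset (Finset W) :=
  {s ∈ D.triFinset | ∃ w ∈ s, k < D.skeleton.dist v w}

theorem mem_outEdges_pair {v a b : W} {k : ℕ} : {a, b} ∈ D.outEdges v k ↔
    D.skeleton.Adj a b ∧ (k < D.skeleton.dist v a ∨ k < D.skeleton.dist v b) := by
  simp [outEdges, mem_edges_pair]

theorem mem_outTris_triple {v a b c : W} {k : ℕ} : {a, b, c} ∈ D.outTris v k ↔
    D.Tri a b c ∧ (k < D.skeleton.dist v a ∨ k < D.skeleton.dist v b ∨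
      k < D.skeleton.dist v c) := by
  simp only [outTris, Finset.mem_filter, mem_triFinset, Finset.mem_insert,
    Finset.mem_singleton, exists_eq_or_imp, exists_eq_left, and_congr_left_iff]
  exact fun _ => ⟨tri_of_mem, Tri.mem_triangles⟩

theorem mem_edges_of_mem_outEdges {v : W} {k : ℕ} {e : Finset W} (h : e ∈ D.outEdges v k) :
    e ∈ D.edges := by
  simp only [outEdges, Finset.mem_filter, mem_edgeFinset] at h
  exact h.1

theorem mem_triangles_of_mem_outTris {v : W} {k : ℕ} {s : Finset W} (h : s ∈ D.outTris v k) :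
    s ∈ D.triangles := by
  simp only [outTris, Finset.mem_filter, mem_triFinset] at h
  exact h.1

theorem sum_degIn {z : Finset (Finset W)} {m : ℕ} (hz : ∀ e ∈ z, e.card = m) :
    ∑ w, degIn z w = m * z.card := by
  have h := Finset.sum_card_bipartiteAbove_eq_sum_card_bipartiteBelow
    (s := Finset.univ) (t := z) (fun (x : W) s => x ∈ s)
  simp only [Finset.bipartiteAbove, Finset.bipartiteBelow, Finset.filter_univ_mem] at h
  unfold degIn
  rw [h, Finset.sum_congr rfl hz]
  simp [mul_comm]

theorem cnt_filter_out {v : W} {k : ℕ} {R : Finset (Finset W)}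
    {e : Finset W} (he : e ∈ D.outEdges v k) :
    cnt {s ∈ R | ∃ w ∈ s, k < D.skeleton.dist v w} e = cnt R e := by
  unfold cnt
  rw [Finset.filter_filter]
  congr 1
  ext s
  simp only [Finset.mem_filter, and_congr_right_iff, and_iff_right_iff_imp]
  intro _ hes
  simp only [outEdges, Finset.mem_filter] at he
  obtain ⟨w, hw, h⟩ := he.2
  exact ⟨w, hes hw, h⟩

/-- A cycle relative to the ball of radius `k + 1` becomes a cycle relative to the ball of radius
`k` once an edge towards `v` is added at each vertex of the sphere of radius `k + 1` with odd
degree. The added edges lie inside the larger ball, so a filling of the enlarged cycle also fills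
the given one. At radius 0 the ball is the single vertex `v` left out in `IsDisc.cycle_bounds`. -/
theorem IsDisc.exists_relative_filling_triFinset (hD : D.IsDisc) (v : W) (k : ℕ) :
    ∀ z ⊆ D.outEdges v k, (∀ w, k < D.skeleton.dist v w → Even (degIn z w)) →
      ∃ R ⊆ D.triFinset, ∀ e ∈ D.outEdges v k, (e ∈ z ↔ Odd (cnt R e)) := by
  have hS := hD.isSurface
  induction k with
  | zero =>
    intro z hz hz'
    obtain ⟨R, hR, hR'⟩ := hD.cycle_bounds v (z := z)
      (fun e he => by simpa using mem_edges_of_mem_outEdges (hz he))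
      (fun w hw => hz' w (Nat.pos_of_ne_zero fun h => hw (hS.dist_eq_zero.1 h)))
    exact ⟨R, hR, fun e he => hR' e (mem_edges_of_mem_outEdges he)⟩
  | succ k ih =>
    intro z hz hz'
    have hp : ∀ w, ∃ p, D.skeleton.dist v w = k + 1 →
        D.skeleton.Adj w p ∧ D.skeleton.dist v p = k := by
      intro w
      by_cases h : D.skeleton.dist v w = k + 1
      · obtain ⟨p, hp⟩ := hS.exists_adj_dist h
        exact ⟨p, fun _ => hp⟩
      · exact ⟨w, fun h' => absurd h' h⟩
    choose p hp using hp
    set N : Finset (Finset W) := (Finset.univ.filter fun w =>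
      D.skeleton.dist v w = k + 1 ∧ Odd (degIn z w)).image fun w => {w, p w} with hN
    have hN' : ∀ e ∈ N, ∃ w, D.skeleton.dist v w = k + 1 ∧ Odd (degIn z w) ∧ e = {w, p w} := by
      intro e he
      rw [hN, Finset.mem_image] at he
      obtain ⟨w, hw, rfl⟩ := he
      rw [Finset.mem_filter] at hw
      exact ⟨w, hw.2.1, hw.2.2, rfl⟩
    have hout : ∀ e ∈ N, e ∉ D.outEdges v (k + 1) := by
      intro e he
      obtain ⟨w, hw, -, rfl⟩ := hN' e he
      rw [mem_outEdges_pair]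
      have := hp w hw
      omega
    have hdisj : Disjoint z N := Finset.disjoint_left.2 fun e he he' => hout e he' (hz he)
    obtain ⟨R, hR, hR'⟩ := ih (z ∪ N) (by
      intro e he
      rw [Finset.mem_union] at he
      rcases he with he | he
      · have := hz he
        simp only [outEdges, Finset.mem_filter] at this ⊢
        obtain ⟨h1, w, hw, h2⟩ := this
        exact ⟨h1, w, hw, by omega⟩
      · obtain ⟨w, hw, -, rfl⟩ := hN' e he
        exact mem_outEdges_pair.2 ⟨(hp w hw).1, by omega⟩) (by
      intro w hw
      rw [degIn_union hdisj]
      by_cases hodd : D.skeleton.dist v w = k + 1 ∧ Odd (degIn z w)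
      · have : degIn N w = 1 := by
          refine Finset.card_eq_one.2 ⟨{w, p w}, ?_⟩
          ext e
          rw [Finset.mem_filter, Finset.mem_singleton]
          constructor
          · rintro ⟨he, hwe⟩
            obtain ⟨u, hu, -, rfl⟩ := hN' e he
            have := hp u hu
            rw [Finset.mem_insert, Finset.mem_singleton] at hwe
            rcases hwe with rfl | rfl
            · rfl
            · omega
          · rintro rfl
            refine ⟨Finset.mem_image.2 ⟨w, by simpa using hodd, rfl⟩, by simp⟩
        rw [this]
        exact hodd.2.add_one
      · have : degIn N w = 0 := by
          rw [degIn, Finset.card_eq_zero, Finset.filter_eq_empty_iff]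
          intro e he hwe
          obtain ⟨u, hu, hu', rfl⟩ := hN' e he
          have := hp u hu
          rw [Finset.mem_insert, Finset.mem_singleton] at hwe
          rcases hwe with rfl | rfl
          · exact hodd ⟨hu, hu'⟩
          · omega
        rw [this, add_zero]
        by_cases h : D.skeleton.dist v w = k + 1
        · exact Nat.not_odd_iff_even.1 fun h' => hodd ⟨h, h'⟩
        · exact hz' w (by omega))
    refine ⟨R, hR, fun e he => ?_⟩
    have he' : e ∈ D.outEdges v k := by
      simp only [outEdges, Finset.mem_filter] at he ⊢
      obtain ⟨h1, w, hw, h2⟩ := he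
      exact ⟨h1, w, hw, by omega⟩
    rw [← hR' e he', Finset.mem_union]
    exact ⟨Or.inl, fun h => h.resolve_right fun h' => hout e h' he⟩

/-- In a disc every cycle relative to a ball is a boundary relative to that ball. -/
theorem IsDisc.exists_relative_filling (hD : D.IsDisc) (v : W) (k : ℕ) {z : Finset (Finset W)}
    (hz : z ⊆ D.outEdges v k) (hz' : ∀ w, k < D.skeleton.dist v w → Even (degIn z w)) :
    ∃ R ⊆ D.outTris v k, ∀ e ∈ D.outEdges v k, (e ∈ z ↔ Odd (cnt R e)) := by
  obtain ⟨R, hR, hR'⟩ := hD.exists_relative_filling_triFinset v k z hz hz'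
  refine ⟨{s ∈ R | ∃ w ∈ s, k < D.skeleton.dist v w}, Finset.filter_subset_filter _ hR,
    fun e he => ?_⟩
  rw [cnt_filter_out he]
  exact hR' e he

/-- The contribution of the edge from `w` to `x` to the curvature of `w` in `Q`. -/
noncomputable def edgeCurv (D : AbstractSimplicialComplex W) (v : W) (k : ℕ)
    (Q : Finset (Finset W)) (w x : W) : ℤ :=
  cnt Q {w, x} - if 0 < cnt Q {w, x} ∧ (k < D.skeleton.dist v w ∨ k < D.skeleton.dist v x)
    then 3 else 0

/-- The curvature of the vertex `w` in the set of triangles `Q`, relative to the ball of radius `k`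
centred at `v`. -/
noncomputable def curv (D : AbstractSimplicialComplex W) (v : W) (k : ℕ)
    (Q : Finset (Finset W)) (w : W) : ℤ :=
  (if k < D.skeleton.dist v w ∧ ∃ s ∈ Q, w ∈ s then 6 else 0) +
    ∑ x ∈ Finset.univ.erase w, D.edgeCurv v k Q w x

/-- A relative Gauss–Bonnet formula. -/
theorem sum_curv (v : W) (k : ℕ) {Q : Finset (Finset W)} (hQ : ∀ s ∈ Q, s ∈ D.triangles) :
    ∑ w, D.curv v k Q w =
      6 * ((Finset.univ.filter fun w => k < D.skeleton.dist v w ∧ ∃ s ∈ Q, w ∈ s).card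
        - {e ∈ D.outEdges v k | 0 < cnt Q e}.card + Q.card : ℤ) := by
  unfold curv edgeCurv
  -- Summed over all vertices, each edge counts 3 at each of its two ends and each triangle counts
  -- once for each of its six ordered pairs of vertices, so every simplex has weight 6 up to sign.
  simp only [Finset.sum_add_distrib, Finset.sum_sub_distrib]
  have h1 : ∑ w, (if k < D.skeleton.dist v w ∧ ∃ s ∈ Q, w ∈ s then (6 : ℤ) else 0) =
      6 * (Finset.univ.filter fun w => k < D.skeleton.dist v w ∧ ∃ s ∈ Q, w ∈ s).card := by
    rw [← Finset.sum_filter]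
    simp [mul_comm]
  have h2 : ∑ w, ∑ x ∈ Finset.univ.erase w, (cnt Q {w, x} : ℤ) = 6 * Q.card := by
    have : ∀ w, ∑ x ∈ Finset.univ.erase w, (cnt Q {w, x} : ℤ) = ((2 * degIn Q w : ℕ) : ℤ) := by
      intro w
      rw [← sum_cnt (fun s hs => (hQ s hs).2) w]
      push_cast
      rfl
    rw [Finset.sum_congr rfl fun w _ => this w, ← Nat.cast_sum, ← Finset.mul_sum,
      sum_degIn (fun s hs => (hQ s hs).2)]
    push_cast
    ring
  have h3 : ∑ w, ∑ x ∈ Finset.univ.erase w, (if 0 < cnt Q {w, x} ∧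
      (k < D.skeleton.dist v w ∨ k < D.skeleton.dist v x) then (3 : ℤ) else 0) =
      6 * {e ∈ D.outEdges v k | 0 < cnt Q e}.card := by
    have hz : ∀ e ∈ ({e ∈ D.outEdges v k | 0 < cnt Q e} : Finset (Finset W)), e.card = 2 :=
      fun e he => (mem_edges_of_mem_outEdges (Finset.mem_filter.1 he).1).2
    have : ∀ w, ∑ x ∈ Finset.univ.erase w, (if 0 < cnt Q {w, x} ∧
        (k < D.skeleton.dist v w ∨ k < D.skeleton.dist v x) then (3 : ℤ) else 0) =
        ((3 * degIn {e ∈ D.outEdges v k | 0 < cnt Q e} w : ℕ) : ℤ) := by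
      intro w
      rw [degIn_eq_card hz, ← Finset.sum_filter, Finset.sum_const, nsmul_eq_mul, mul_comm]
      push_cast
      congr 3
      ext x
      simp only [Finset.mem_filter, Finset.mem_erase, Finset.mem_univ, and_true, true_and,
        mem_outEdges_pair]
      constructor
      · rintro ⟨h, h', h''⟩
        obtain ⟨c, -, hc⟩ := exists_mem_of_cnt_pos hQ h.symm h'
        exact ⟨h, ⟨hc.adj, h''⟩, h'⟩
      · rintro ⟨h, ⟨-, h''⟩, h'⟩
        exact ⟨h, h', h''⟩
    rw [Finset.sum_congr rfl fun w _ => this w, ← Nat.cast_sum, ← Finset.mul_sum, sum_degIn hz]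
    push_cast
    ring
  rw [h1, h2, h3]
  ring

/-- By Gauss–Bonnet it suffices that every relative cycle `z` in `Q` bounds inside `Q`. A filling
`R` in the whole disc exists; irreducibility of the relative boundary of `Q` (`hirr`) is used to
show that `R` does not leave `Q`. -/
theorem IsDisc.sum_curv_nonneg (hD : D.IsDisc) (v : W) (k : ℕ)
    (hinj : ∀ R ⊆ D.outTris v k, (∀ e ∈ D.outEdges v k, Even (cnt R e)) → R = ∅)
    {Q : Finset (Finset W)} (hQ : Q ⊆ D.outTris v k) (hne : Q.Nonempty)
    (hirr : ∀ z ⊆ {e ∈ D.outEdges v k | Odd (cnt Q e)},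
      (∀ w, k < D.skeleton.dist v w → Even (degIn z w)) →
        z = ∅ ∨ z = {e ∈ D.outEdges v k | Odd (cnt Q e)}) :
    0 ≤ ∑ w, D.curv v k Q w := by
  have hQT : ∀ s ∈ Q, s ∈ D.triangles := fun s hs => mem_triangles_of_mem_outTris (hQ hs)
  rw [sum_curv v k hQT]
  have key : ({e ∈ D.outEdges v k | 0 < cnt Q e} : Finset (Finset W)).card ≤
      (Finset.univ.filter fun w => k < D.skeleton.dist v w ∧ ∃ s ∈ Q, w ∈ s).card +
        Q.card := by
    refine card_le_of_cycles_bound (r := fun w e => w ∈ e) (q := fun e s => e ⊆ s) ?_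
    intro z hz hz'
    have hz1 : z ⊆ D.outEdges v k := hz.trans (Finset.filter_subset _ _)
    obtain ⟨R, hRout, hR'⟩ := hD.exists_relative_filling v k hz1 (by
      intro w hw
      by_cases hw' : ∃ s ∈ Q, w ∈ s
      · exact hz' w (by simp [hw, hw'])
      · have : degIn z w = 0 := by
          rw [degIn, Finset.card_eq_zero, Finset.filter_eq_empty_iff]
          intro e he hwe
          obtain ⟨s, hs⟩ := Finset.card_pos.1 (Finset.mem_filter.1 (hz he)).2
          rw [Finset.mem_filter] at hs
          exact hw' ⟨s, hs.1, hs.2 hwe⟩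
        rw [this]
        exact Even.zero)
    have hRQ : R \ Q ⊆ D.outTris v k := Finset.sdiff_subset.trans hRout
    have hRQT : ∀ s ∈ R \ Q, s ∈ D.triangles := fun s hs => mem_triangles_of_mem_outTris (hRQ hs)
    have hdisj : Disjoint (R \ Q) Q := Finset.sdiff_disjoint
    -- The relative boundary of `R \ Q` lies in that of `Q`: over an edge avoiding `Q` it agrees
    -- with `z`, which is absent there, and over any other edge one triangle of `R \ Q` leaves room
    -- for only one triangle of `Q`.
    have hcases := hirr {e ∈ D.outEdges v k | Odd (cnt (R \ Q) e)} (by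
      intro e he
      rw [Finset.mem_filter] at he ⊢
      refine ⟨he.1, ?_⟩
      obtain ⟨a, b, hab, rfl⟩ := exists_adj_of_mem_edges (mem_edges_of_mem_outEdges he.1)
      have h1 := hD.isSurface.cnt_le_two (R := (R \ Q) ∪ Q)
        (fun s hs => (Finset.mem_union.1 hs).elim (hRQT s) (hQT s)) hab.1
      rw [cnt_union hdisj] at h1
      have h2 := he.2.pos
      by_cases h3 : cnt Q {a, b} = 0
      · exfalso
        have h4 : {a, b} ∉ z := fun h => by
          have := (Finset.mem_filter.1 (hz h)).2
          omega
        rw [hR' _ he.1, ← cnt_sdiff_add R Q] at h4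
        have h5 : cnt (R ∩ Q) {a, b} = 0 := by
          have := cnt_mono (Finset.inter_subset_right : R ∩ Q ⊆ Q) {a, b}
          omega
        rw [h5, add_zero] at h4
        exact h4 he.2
      · have : cnt Q {a, b} = 1 := by omega
        rw [this]
        exact odd_one) (fun w hw => even_degIn_boundary hRQT
          (fun e he => mem_edges_of_mem_outEdges he)
          (fun x hx => mem_outEdges_pair.2 ⟨hx, Or.inl hw⟩))
    rcases hcases with h | h
    · have hempty := hinj (R \ Q) hRQ (by
        intro e he
        rw [← Nat.not_odd_iff_even]
        intro h'
        have : e ∈ (∅ : Finset (Finset W)) := h ▸ Finset.mem_filter.2 ⟨he, h'⟩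
        simp at this)
      refine ⟨R, Finset.sdiff_eq_empty_iff_subset.1 hempty, fun e he => ?_⟩
      exact hR' e (Finset.mem_filter.1 he).1
    · exfalso
      -- If `R \ Q` and `Q` had the same relative boundary, their union would be enclosed by the
      -- ball.
      have hempty := hinj ((R \ Q) ∪ Q) (Finset.union_subset hRQ hQ) (by
        intro e he
        rw [cnt_union hdisj, Nat.even_add, ← Nat.not_odd_iff_even, ← Nat.not_odd_iff_even,
          not_iff_not]
        have := congrArg (e ∈ ·) h
        simpa [he] using this)
      rw [Finset.union_eq_empty] at hempty
      exact hne.ne_empty hempty.2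
  omega

end
end AbstractSimplicialComplex

/-! ### Locally convex spheres and their local consequences -/

namespace AbstractSimplicialComplex

section
open scoped Classical

variable {W : Type*} {D : AbstractSimplicialComplex W}

/-- The sphere of radius `k` centred at `v` is locally convex: each of its edges has an apex on the
previous sphere, and two distinct neighbours of one of its vertices on the previous sphere span a
triangle with this vertex. -/
structure GoodSphere (D : AbstractSimplicialComplex W) (v : W) (k : ℕ) : Prop where
  edge : ∀ a b, D.skeleton.Adj a b → D.skeleton.dist v a = k → D.skeleton.dist v b = k →
    ∃ c, D.Tri a b c ∧ D.skeleton.dist v c + 1 = k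
  vertex : ∀ a b c, D.skeleton.Adj a b → D.skeleton.Adj a c → b ≠ c →
    D.skeleton.dist v a = k → D.skeleton.dist v b + 1 = k → D.skeleton.dist v c + 1 = k →
    D.Tri a b c

theorem IsSurface.goodSphere_zero (hD : D.IsSurface) (v : W) : D.GoodSphere v 0 where
  edge a b hab ha hb := by
    rw [hD.dist_eq_zero] at ha hb
    exact absurd (ha.trans hb.symm) hab.1
  vertex a b c _ _ _ _ hb _ := by omega

section

variable (hD : D.IsSurface) {t : ℕ}
  (hdeg : ∀ w, D.IsInterior w → (D.skeleton.neighborSet w).ncard = t)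

include hD hdeg

theorem IsSurface.card_of_closed_link {w : W} {S : Finset W} (hne : S.Nonempty)
    (hS : ∀ x ∈ S, ∃ y ∈ S, ∃ z ∈ S, y ≠ z ∧ D.Tri w x y ∧ D.Tri w x z) : S.card = t := by
  obtain ⟨h1, h2⟩ := hD.closed_link hne hS
  have := hdeg w h1
  rwa [h2, Set.ncard_coe_finset] at this

/-- Triangles that close up around `w` form its whole link and make `w` interior, so its degree
would be less than `t`. The versions with four and five triangles work in the same way. -/
theorem IsSurface.false_of_closed_three (ht : 4 ≤ t) {w x y z : W} (h1 : D.Tri w x y)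
    (h2 : D.Tri w y z) (h3 : D.Tri w z x) : False := by
  have := hD.card_of_closed_link hdeg (w := w) (S := {x, y, z}) (by simp) (by
    intro u hu
    simp only [Finset.mem_insert, Finset.mem_singleton] at hu
    rcases hu with hu | hu | hu <;> rw [hu]
    · exact ⟨y, by simp, z, by simp, h2.2.2.1, h1, h3.swap'⟩
    · exact ⟨x, by simp, z, by simp, h3.2.2.1.symm, h1.swap', h2⟩
    · exact ⟨x, by simp, y, by simp, h1.2.2.1, h3, h2.swap'⟩)
  have := Finset.card_le_three (a := x) (b := y) (c := z)
  omega

theorem IsSurface.false_of_closed_four (ht : 5 ≤ t) {w x y z p : W} (h1 : D.Tri w x y)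
    (h2 : D.Tri w y z) (h3 : D.Tri w z p) (h4 : D.Tri w p x) (hxz : x ≠ z) (hyp : y ≠ p) :
    False := by
  have := hD.card_of_closed_link hdeg (w := w) (S := {x, y, z, p}) (by simp) (by
    intro u hu
    simp only [Finset.mem_insert, Finset.mem_singleton] at hu
    rcases hu with hu | hu | hu | hu <;> rw [hu]
    · exact ⟨y, by simp, p, by simp, hyp, h1, h4.swap'⟩
    · exact ⟨x, by simp, z, by simp, hxz, h1.swap', h2⟩
    · exact ⟨y, by simp, p, by simp, hyp, h2.swap', h3⟩
    · exact ⟨x, by simp, z, by simp, hxz, h4, h3.swap'⟩)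
  have := Finset.card_le_four (a := x) (b := y) (c := z) (d := p)
  omega

theorem IsSurface.false_of_closed_five (ht : 6 ≤ t) {w x y z q p : W} (h1 : D.Tri w x y)
    (h2 : D.Tri w y z) (h3 : D.Tri w z q) (h4 : D.Tri w q p) (h5 : D.Tri w p x) (hxz : x ≠ z)
    (hyp : y ≠ p) (hyq : y ≠ q) (hzp : z ≠ p) (hqx : q ≠ x) : False := by
  have := hD.card_of_closed_link hdeg (w := w) (S := {x, y, z, q, p}) (by simp) (by
    intro u hu
    simp only [Finset.mem_insert, Finset.mem_singleton] at hu
    rcases hu with hu | hu | hu | hu | hu <;> rw [hu]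
    · exact ⟨y, by simp, p, by simp, hyp, h1, h5.swap'⟩
    · exact ⟨x, by simp, z, by simp, hxz, h1.swap', h2⟩
    · exact ⟨y, by simp, q, by simp, hyq, h2.swap', h3⟩
    · exact ⟨z, by simp, p, by simp, hzp, h3.swap', h4⟩
    · exact ⟨q, by simp, x, by simp, hqx, h4.swap', h5⟩)
  have := Finset.card_le_five (a := x) (b := y) (c := z) (d := q) (e := p)
  omega

namespace GoodSphere

variable {v : W} {k : ℕ} (hk : D.GoodSphere v k)

include hk

/-- Two lower apexes `c`, `d` would themselves span a triangle with `a`, closing the link of `a`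
after three vertices. -/
theorem lower_apex_unique (ht : 4 ≤ t) {a b c d : W} (hc : D.Tri a b c) (hd : D.Tri a b d)
    (ha : D.skeleton.dist v a = k) (hc' : D.skeleton.dist v c + 1 = k)
    (hd' : D.skeleton.dist v d + 1 = k) : c = d := by
  by_contra hne
  exact hD.false_of_closed_three hdeg ht hc
    (hk.vertex a c d hc.adj₁₃ hd.adj₁₃ hne ha hc' hd') hd.swap'

/-- Each side of a flat triangle has a lower apex. If two apexes agree, the common vertex of the two
sides has a link of length 3. If all differ, the apexes of the two sides at `a` span a triangle with
`a`, whose link then has length 4. For `k ≤ 1` the previous sphere has at most one vertex, so the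
apexes cannot differ. -/
theorem not_flat (ht : 4 ≤ t) (htk : 5 ≤ t ∨ k ≤ 1) {a b c : W} (h : D.Tri a b c)
    (ha : D.skeleton.dist v a = k) (hb : D.skeleton.dist v b = k)
    (hc : D.skeleton.dist v c = k) : False := by
  obtain ⟨d, hd, hd'⟩ := hk.edge a b h.adj ha hb
  obtain ⟨e, he, he'⟩ := hk.edge b c h.adj₂₃ hb hc
  obtain ⟨f, hf, hf'⟩ := hk.edge a c h.adj₁₃ ha hc
  by_cases hde : d = e
  · subst hde
    exact hD.false_of_closed_three hdeg ht h.swap he hd.rot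
  by_cases hdf : d = f
  · subst hdf
    exact hD.false_of_closed_three hdeg ht h hf hd.swap'
  by_cases hef : e = f
  · subst hef
    exact hD.false_of_closed_three hdeg ht h.rot.rot he.swap hf.rot
  · rcases htk with ht5 | hk1
    · have h1 := hk.vertex a d f hd.adj₁₃ hf.adj₁₃ hdf ha hd' hf'
      refine hD.false_of_closed_four hdeg ht5 hd h1 hf.swap' h.swap' ?_ ?_
      · rintro rfl; omega
      · rintro rfl; omega
    · apply hde
      rw [hD.dist_eq_zero.1 (show D.skeleton.dist v d = 0 by omega),
        hD.dist_eq_zero.1 (show D.skeleton.dist v e = 0 by omega)]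

/-- Take the lower apexes of the three sphere edges at `u`. Distinct ones span triangles with `u`,
so three distinct apexes close up the link of `u`, whereas a coincidence puts three triangles on the
edge from `u` to the common apex. -/
theorem not_three_neighbors (ht : 4 ≤ t) {u x y z : W} (hu : D.skeleton.dist v u = k)
    (hx : D.skeleton.Adj u x) (hy : D.skeleton.Adj u y) (hz : D.skeleton.Adj u z)
    (hx' : D.skeleton.dist v x = k) (hy' : D.skeleton.dist v y = k)
    (hz' : D.skeleton.dist v z = k) (hxy : x ≠ y) (hxz : x ≠ z) (hyz : y ≠ z) : False := by
  obtain ⟨p, hp, hp'⟩ := hk.edge u x hx hu hx'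
  obtain ⟨q, hq, hq'⟩ := hk.edge u y hy hu hy'
  obtain ⟨r, hr, hr'⟩ := hk.edge u z hz hu hz'
  have two : ∀ x y p q, x ≠ y → D.Tri u x p → D.Tri u y p → D.Tri u p q →
      D.skeleton.dist v x = k → D.skeleton.dist v y = k → D.skeleton.dist v q + 1 = k →
      False := by
    intro x y p q hxy h1 h2 h3 hx hy hq
    rcases hD.tri_eq h1.swap' h2.swap' h3 hxy with rfl | rfl <;> omega
  by_cases hpq : p = q
  · subst hpq
    by_cases hpr : p = r
    · subst hpr
      rcases hD.tri_eq hp.swap' hq.swap' hr.swap' hxy with h | h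
      · exact hxz h.symm
      · exact hyz h.symm
    · exact two x y p r hxy hp hq (hk.vertex u p r hp.adj₁₃ hr.adj₁₃ hpr hu hp' hr') hx' hy' hr'
  · have h1 := hk.vertex u p q hp.adj₁₃ hq.adj₁₃ hpq hu hp' hq'
    by_cases hpr : p = r
    · subst hpr
      exact two x z p q hxz hp hr h1 hx' hz' hq'
    · by_cases hqr : q = r
      · subst hqr
        exact two y z q p hyz hq hr h1.swap' hy' hz' hp'
      · exact hD.false_of_closed_three hdeg ht h1
          (hk.vertex u q r hq.adj₁₃ hr.adj₁₃ hqr hu hq' hr')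
          (hk.vertex u r p hr.adj₁₃ hp.adj₁₃ (Ne.symm hpr) hu hr' hp')

theorem card_neighbors_le_two [Fintype W] (ht : 4 ≤ t) {u : W}
    (hu : D.skeleton.dist v u = k) :
    (Finset.univ.filter fun x => D.skeleton.Adj u x ∧ D.skeleton.dist v x = k).card ≤ 2 := by
  by_contra! h
  obtain ⟨x, hx, y, hy, z, hz, h1, h2, h3⟩ := Finset.two_lt_card.1 h
  simp only [Finset.mem_filter, Finset.mem_univ, true_and] at hx hy hz
  exact hk.not_three_neighbors hD hdeg ht hu hx.1 hy.1 hz.1 hx.2 hy.2 hz.2 h1 h2 h3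

end GoodSphere

end

end
end AbstractSimplicialComplex

/-! ### Curvature estimates at single vertices -/

namespace AbstractSimplicialComplex

section
open scoped Classical

variable {W : Type*} {D : AbstractSimplicialComplex W} [Fintype W]

/-- The sphere neighbours of `w` along which `Q` meets the ball of radius `k`. -/
noncomputable def innerEnds (D : AbstractSimplicialComplex W) (v : W) (k : ℕ)
    (Q : Finset (Finset W)) (w : W) : Finset W :=
  Finset.univ.filter fun x => x ≠ w ∧
    ¬(k < D.skeleton.dist v w ∨ k < D.skeleton.dist v x) ∧ 0 < cnt Q {w, x}

/-- The neighbours of `w` along edges of the boundary of `Q` relative to the ball of radius `k`. -/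
noncomputable def oddEnds (D : AbstractSimplicialComplex W) (v : W) (k : ℕ)
    (Q : Finset (Finset W)) (w : W) : Finset W :=
  Finset.univ.filter fun x => x ≠ w ∧
    (k < D.skeleton.dist v w ∨ k < D.skeleton.dist v x) ∧ Odd (cnt Q {w, x})

/-- The neighbours of `w` along interior edges of `Q`, outside the ball of radius `k`. -/
noncomputable def twoEnds (D : AbstractSimplicialComplex W) (v : W) (k : ℕ)
    (Q : Finset (Finset W)) (w : W) : Finset W :=
  Finset.univ.filter fun x => x ≠ w ∧
    (k < D.skeleton.dist v w ∨ k < D.skeleton.dist v x) ∧ cnt Q {w, x} = 2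

variable (hD : D.IsSurface) {t : ℕ}
  (hdeg : ∀ w, D.IsInterior w → (D.skeleton.neighborSet w).ncard = t)
  {v : W} {k : ℕ} (hk : D.GoodSphere v k) {Q : Finset (Finset W)} (hQ : Q ⊆ D.outTris v k)

include hD hQ

/-- An edge of a triangle outside the ball with both endpoints in the ball is on the sphere, and
its other vertex is on the next sphere. -/
theorem dist_of_mem_outTris {a b c : W} (h : {a, b, c} ∈ Q)
    (ha : D.skeleton.dist v a ≤ k) (hb : D.skeleton.dist v b ≤ k) :
    D.skeleton.dist v a = k ∧ D.skeleton.dist v b = k ∧ D.skeleton.dist v c = k + 1 := by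
  obtain ⟨h1, h2⟩ := mem_outTris_triple.1 (hQ h)
  have h3 := hD.dist_le_succ v h1.adj₁₃.symm
  have h4 := hD.dist_le_succ v h1.adj₂₃.symm
  omega

/-- One coface of a sphere edge has its apex on the previous sphere, hence is not in `Q`. -/
theorem cnt_le_one_of_inner {w x : W} (hk : D.GoodSphere v k) (hne : w ≠ x)
    (hw : D.skeleton.dist v w ≤ k) (hx : D.skeleton.dist v x ≤ k) : cnt Q {w, x} ≤ 1 := by
  have hQT : ∀ s ∈ Q, s ∈ D.triangles := fun s hs => mem_triangles_of_mem_outTris (hQ hs)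
  by_contra! h
  obtain ⟨c, d, hcd, hc, hc', hd, hd'⟩ := exists_two_of_one_lt_cnt hQT hne h
  have h1 := dist_of_mem_outTris hD hQ hc hw hx
  have h2 := dist_of_mem_outTris hD hQ hd hw hx
  obtain ⟨p, hp, hp'⟩ := hk.edge w x hc'.adj h1.1 h1.2.1
  rcases hD.tri_eq hc' hd' hp hcd with rfl | rfl <;> omega

theorem mem_innerEnds {w x : W} (h : x ∈ D.innerEnds v k Q w) :
    D.skeleton.Adj w x ∧ D.skeleton.dist v w = k ∧ D.skeleton.dist v x = k := by
  have hQT : ∀ s ∈ Q, s ∈ D.triangles := fun s hs => mem_triangles_of_mem_outTris (hQ hs)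
  simp only [innerEnds, Finset.mem_filter, Finset.mem_univ, true_and, not_or, not_lt] at h
  obtain ⟨c, hc, hc'⟩ := exists_mem_of_cnt_pos hQT h.1.symm h.2.2
  have := dist_of_mem_outTris hD hQ hc h.2.1.1 h.2.1.2
  exact ⟨hc'.adj, this.1, this.2.1⟩

include hk

/-- The weights are the values of `edgeCurv`: an edge of `Q` on the sphere counts 1, a relative
boundary edge `1 - 3`, an interior edge `2 - 3`. -/
theorem curv_eq (w : W) : D.curv v k Q w =
    (if k < D.skeleton.dist v w ∧ ∃ s ∈ Q, w ∈ s then 6 else 0) +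
      ((D.innerEnds v k Q w).card - 2 * (D.oddEnds v k Q w).card
        - (D.twoEnds v k Q w).card : ℤ) := by
  have hQT : ∀ s ∈ Q, s ∈ D.triangles := fun s hs => mem_triangles_of_mem_outTris (hQ hs)
  unfold curv
  congr 1
  have key : ∀ x ∈ Finset.univ.erase w, D.edgeCurv v k Q w x =
      (if x ∈ D.innerEnds v k Q w then 1 else 0) -
        2 * (if x ∈ D.oddEnds v k Q w then 1 else 0) -
        (if x ∈ D.twoEnds v k Q w then 1 else 0) := by
    intro x hx
    have hxw : x ≠ w := by simpa using hx
    have h2 := hD.cnt_le_two hQT hxw.symm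
    simp only [edgeCurv, innerEnds, oddEnds, twoEnds, Finset.mem_filter, Finset.mem_univ,
      true_and, hxw, ne_eq, not_false_eq_true]
    by_cases hout : k < D.skeleton.dist v w ∨ k < D.skeleton.dist v x
    · simp only [hout, not_true, false_and, and_true, true_and, if_false]
      interval_cases cnt Q {w, x} <;> simp +decide
    · have h1 := cnt_le_one_of_inner hD hQ hk hxw.symm (w := w) (x := x) (by omega) (by omega)
      simp only [hout, not_false_eq_true, false_and, and_false, true_and, if_false]
      interval_cases cnt Q {w, x} <;> simp
  have sum_ind : ∀ S : Finset W, w ∉ S →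
      ∑ x ∈ Finset.univ.erase w, (if x ∈ S then (1 : ℤ) else 0) = S.card := by
    intro S hS
    rw [Finset.sum_boole]
    congr 2
    ext x
    simp only [Finset.mem_filter, Finset.mem_erase, Finset.mem_univ, and_true,
      and_iff_right_iff_imp]
    rintro hx rfl
    exact hS hx
  rw [Finset.sum_congr rfl key, Finset.sum_sub_distrib, Finset.sum_sub_distrib,
    ← Finset.mul_sum, sum_ind _ (by simp [innerEnds]), sum_ind _ (by simp [oddEnds]),
    sum_ind _ (by simp [twoEnds])]

/-- The sphere edges of `Q` and its relative boundary edges together form the full boundary of `Q`,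
which has even degree at `w`. -/
theorem even_card_ends (w : W) :
    Even ((D.innerEnds v k Q w).card + (D.oddEnds v k Q w).card) := by
  have hQT : ∀ s ∈ Q, s ∈ D.triangles := fun s hs => mem_triangles_of_mem_outTris (hQ hs)
  have h := even_card_odd_cnt (fun s hs => (hQT s hs).2) w
  rw [← Finset.card_union_of_disjoint]
  · convert h using 2
    ext x
    simp only [innerEnds, oddEnds, Finset.mem_union, Finset.mem_filter, Finset.mem_univ,
      true_and]
    by_cases hxw : x = w
    · simp [hxw]
    by_cases hout : k < D.skeleton.dist v w ∨ k < D.skeleton.dist v x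
    · simp [hout]
    · have h1 := cnt_le_one_of_inner hD hQ hk (Ne.symm hxw) (w := w) (x := x)
        (by omega) (by omega)
      simp only [hout, not_false_eq_true, hxw, ne_eq, false_and, and_false, or_false, true_and]
      interval_cases cnt Q {w, x} <;> simp
  · rw [Finset.disjoint_left]
    simp only [innerEnds, oddEnds, Finset.mem_filter]
    tauto

include hdeg

/-- With no boundary edge at `w`, once `Q` meets the star of `w` it contains all of it. Then `w` is
interior with `t` interior edges and its curvature is `6 - t`. -/
theorem curv_nonpos_of_out (ht : 6 ≤ t) {w : W} (hw : k < D.skeleton.dist v w)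
    (hodd : D.oddEnds v k Q w = ∅) : D.curv v k Q w ≤ 0 := by
  have hQT : ∀ s ∈ Q, s ∈ D.triangles := fun s hs => mem_triangles_of_mem_outTris (hQ hs)
  rw [curv_eq hD hk hQ w, hodd]
  have hT : D.innerEnds v k Q w = ∅ := by
    rw [Finset.eq_empty_iff_forall_notMem]
    intro x hx
    have := mem_innerEnds hD hQ hx
    omega
  rw [hT]
  split_ifs with hs
  · obtain ⟨-, s, hs, hws⟩ := hs
    obtain ⟨a, b, hab, rfl⟩ := exists_tri_of_mem (hQT s hs) hws
    have hnot : ∀ x, x ≠ w → ¬ Odd (cnt Q {w, x}) := by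
      intro x hx h
      have : x ∈ D.oddEnds v k Q w := by simp [oddEnds, hx, hw, h]
      rw [hodd] at this
      simp at this
    have htwo : ∀ x c, D.Tri w x c → {w, x, c} ∈ Q → cnt Q {w, x} = 2 := by
      intro x c h h'
      have h1 := hD.cnt_le_two hQT h.1
      have h2 := cnt_pos_of_mem h'
      have h3 := hnot x h.1.symm
      rw [Nat.not_odd_iff_even] at h3
      obtain ⟨m, hm⟩ := h3
      omega
    have hstar : ∀ c d, D.Tri w c d → {w, c, d} ∈ Q := fun c d hcd =>
      hD.all_mem_of_star hab hs
        (fun x c d hc hd hmem => hD.mem_of_cnt_eq_two hQT hd (htwo x c hc hmem)) hcd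
    have hall : ∀ x, D.skeleton.Adj w x → cnt Q {w, x} = 2 := by
      intro x hx
      obtain ⟨c, hc⟩ := hD.exists_tri hx
      exact htwo x c hc (hstar x c hc)
    have hint : D.IsInterior w := isInterior_of fun x hx => by
      obtain ⟨c, d, hcd, -, hc, -, hd⟩ := exists_two_of_one_lt_cnt hQT hx.1
        (show 1 < cnt Q {w, x} by rw [hall x hx]; norm_num)
      exact ⟨c, d, hcd, hc, hd⟩
    have hB : (D.twoEnds v k Q w).card = t := by
      rw [← hdeg w hint, ← Set.ncard_coe_finset]
      congr 1
      ext x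
      simp only [twoEnds, Finset.coe_filter, Finset.mem_univ, true_and, Set.mem_ofPred_eq,
        SimpleGraph.mem_neighborSet]
      constructor
      · rintro ⟨h1, -, h2⟩
        obtain ⟨c, -, hc⟩ := exists_mem_of_cnt_pos hQT h1.symm (show 0 < cnt Q {w, x} by omega)
        exact hc.adj
      · intro h
        exact ⟨h.1.symm, Or.inl hw, hall x h⟩
    rw [hB]
    simp only [Finset.card_empty]
    push_cast
    omega
  · simp only [Finset.card_empty]
    push_cast
    omega

theorem card_innerEnds_le_two (ht : 4 ≤ t) (w : W) : (D.innerEnds v k Q w).card ≤ 2 := by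
  by_cases hw : D.skeleton.dist v w = k
  · refine (Finset.card_le_card ?_).trans (hk.card_neighbors_le_two hD hdeg ht hw)
    intro x hx
    have := mem_innerEnds hD hQ hx
    simp [this]
  · have hT : D.innerEnds v k Q w = ∅ := by
      rw [Finset.eq_empty_iff_forall_notMem]
      intro x hx
      have := mem_innerEnds hD hQ hx
      omega
    simp [hT]

/-- If `Q` meets the sphere in an edge at `w` but has no relative boundary at `w`, then there are at
least two interior edges of `Q` at `w`. -/
theorem two_le_card_twoEnds (ht : 6 ≤ t) {w x : W} (hx : x ∈ D.innerEnds v k Q w)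
    (hodd : D.oddEnds v k Q w = ∅) : 2 ≤ (D.twoEnds v k Q w).card := by
  have hQT : ∀ s ∈ Q, s ∈ D.triangles := fun s hs => mem_triangles_of_mem_outTris (hQ hs)
  obtain ⟨hwx, hw, hx'⟩ := mem_innerEnds hD hQ hx
  have hcnt : 0 < cnt Q {w, x} := by
    simp only [innerEnds, Finset.mem_filter] at hx
    exact hx.2.2.2
  have htwo : ∀ y, y ≠ w → D.skeleton.dist v y = k + 1 → 0 < cnt Q {w, y} →
      cnt Q {w, y} = 2 := by
    intro y hy hy' h
    have h1 := hD.cnt_le_two hQT hy.symm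
    have h3 : ¬ Odd (cnt Q {w, y}) := fun h => by
      have : y ∈ D.oddEnds v k Q w := by simp [oddEnds, hy, hy', h]
      rw [hodd] at this
      simp at this
    rw [Nat.not_odd_iff_even] at h3
    obtain ⟨m, hm⟩ := h3
    omega
  obtain ⟨y, hy, hy'⟩ := exists_mem_of_cnt_pos hQT hwx.1 hcnt
  have hyk := (dist_of_mem_outTris hD hQ hy hw.le hx'.le).2.2
  have hy2 := htwo y hy'.2.1.symm hyk (cnt_pos_of_mem (c := x) (by rwa [Finset.pair_comm]))
  obtain ⟨z, hzx, hz, hz'⟩ : ∃ z, z ≠ x ∧ {w, y, z} ∈ Q ∧ D.Tri w y z := by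
    obtain ⟨c, d, hcd, hc, hc', hd, hd'⟩ := exists_two_of_one_lt_cnt hQT hy'.2.1
      (show 1 < cnt Q {w, y} by omega)
    by_cases hcx : c = x
    · exact ⟨d, fun h => hcd (hcx.trans h.symm), hd, hd'⟩
    · exact ⟨c, hcx, hc, hc'⟩
  have h1 := hD.dist_le_succ v hz'.adj₁₃.symm
  have h2 := hD.dist_le_succ v hz'.adj₂₃
  -- If `z` were on the sphere of radius `k`, then `x`, `y`, `z` and the lower apexes of the edges
  -- from `w` to `x` and `z` would close the link of `w` after four or five vertices. This is where
  -- degree at least 6 is needed at a vertex of the sphere.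
  have hzk : D.skeleton.dist v z = k + 1 := by
    by_contra hne
    have hzk : D.skeleton.dist v z = k := by omega
    obtain ⟨p, hp, hp'⟩ := hk.edge w x hwx hw hx'
    obtain ⟨q, hq, hq'⟩ := hk.edge w z hz'.adj₁₃ hw hzk
    by_cases hpq : p = q
    · subst hpq
      refine hD.false_of_closed_four hdeg (by omega) hy' hz' hq hp.swap' (Ne.symm hzx) ?_
      rintro rfl; omega
    · refine hD.false_of_closed_five hdeg ht hy' hz' hq
        (hk.vertex w q p hq.adj₁₃ hp.adj₁₃ (Ne.symm hpq) hw hq' hp') hp.swap'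
        (Ne.symm hzx) ?_ ?_ ?_ ?_ <;> rintro rfl <;> omega
  have hz2 := htwo z hz'.2.1.symm hzk (cnt_pos_of_mem (c := y) (by rwa [Finset.pair_comm]))
  have : ({y, z} : Finset W) ⊆ D.twoEnds v k Q w := by
    intro u hu
    simp only [Finset.mem_insert, Finset.mem_singleton] at hu
    simp only [twoEnds, Finset.mem_filter, Finset.mem_univ, true_and]
    rcases hu with rfl | rfl
    · exact ⟨hy'.2.1.symm, Or.inr (by omega), hy2⟩
    · exact ⟨hz'.2.1.symm, Or.inr (by omega), hz2⟩
  have := Finset.card_le_card this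
  rwa [Finset.card_pair hz'.2.2.1] at this

theorem curv_nonpos_of_inner (ht : 6 ≤ t) {w : W} (hw : D.skeleton.dist v w ≤ k)
    (hodd : D.oddEnds v k Q w = ∅) : D.curv v k Q w ≤ 0 := by
  rw [curv_eq hD hk hQ w, if_neg (by omega), hodd]
  rcases (D.innerEnds v k Q w).eq_empty_or_nonempty with h | ⟨x, hx⟩
  · simp [h]
  · have h1 := two_le_card_twoEnds hD hdeg hk hQ ht hx hodd
    have h2 := card_innerEnds_le_two hD hdeg hk hQ (by omega) w
    simp only [Finset.card_empty]
    push_cast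
    omega

theorem curv_nonpos (ht : 6 ≤ t) {w : W} (hodd : D.oddEnds v k Q w = ∅) :
    D.curv v k Q w ≤ 0 := by
  rcases Nat.lt_or_ge k (D.skeleton.dist v w) with hw | hw
  · exact curv_nonpos_of_out hD hdeg hk hQ ht hw hodd
  · exact curv_nonpos_of_inner hD hdeg hk hQ ht hw hodd

/-- There are at most two inner ends, and their number has the parity of the number of odd ends; as
the latter is positive, it is at least the number of inner ends. -/
theorem curv_le_of_inner (ht : 4 ≤ t) {w : W} (hw : D.skeleton.dist v w ≤ k)
    (hodd : (D.oddEnds v k Q w).Nonempty) :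
    D.curv v k Q w ≤ -(D.oddEnds v k Q w).card - (D.twoEnds v k Q w).card := by
  rw [curv_eq hD hk hQ w, if_neg (by omega)]
  have h2 := card_innerEnds_le_two hD hdeg hk hQ ht w
  obtain ⟨m, hm⟩ := even_card_ends hD hk hQ w
  have := hodd.card_pos
  omega

omit hdeg in
theorem curv_le_of_out {w : W} (hw : k < D.skeleton.dist v w) :
    D.curv v k Q w ≤ 6 - 2 * (D.oddEnds v k Q w).card - (D.twoEnds v k Q w).card := by
  rw [curv_eq hD hk hQ w]
  have hT : D.innerEnds v k Q w = ∅ := by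
    rw [Finset.eq_empty_iff_forall_notMem]
    intro x hx
    have := mem_innerEnds hD hQ hx
    omega
  rw [hT]
  split_ifs
  · simp only [Finset.card_empty]
    push_cast
    omega
  · simp only [Finset.card_empty]
    push_cast
    omega

end
end AbstractSimplicialComplex

/-! ### Induction on the radius for degree at least 6 -/

namespace AbstractSimplicialComplex

section
open scoped Classical

variable {W : Type*} {D : AbstractSimplicialComplex W} [Fintype W]

/-- No set of triangles outside the ball of radius `k` has its boundary inside the ball. -/
def NoEnclosed (D : AbstractSimplicialComplex W) (v : W) (k : ℕ) : Prop :=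
  ∀ R ⊆ D.outTris v k, (∀ e ∈ D.outEdges v k, Even (cnt R e)) → R = ∅

theorem IsSurface.noEnclosed_zero (hD : D.IsSurface) (v : W) : D.NoEnclosed v 0 := by
  intro R hR h
  refine hD.eq_empty_of_even_cnt (fun s hs => mem_triangles_of_mem_outTris (hR hs)) ?_
  intro e he
  obtain ⟨a, b, hab, rfl⟩ := exists_adj_of_mem_edges he
  refine h _ (mem_outEdges_pair.2 ⟨hab, ?_⟩)
  by_contra! hcon
  exact hab.1 ((hD.dist_eq_zero.1 (Nat.le_zero.1 hcon.1)).trans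
    (hD.dist_eq_zero.1 (Nat.le_zero.1 hcon.2)).symm)

variable {t : ℕ} (hdeg : ∀ w, D.IsInterior w → (D.skeleton.neighborSet w).ncard = t)
  {v : W} {k : ℕ}

include hdeg

/-- The boundary of an enclosed set `Q` lies on the sphere of radius `k + 1`, and by convexity it
contains every sphere edge at each vertex it touches. Adding the collar `N` of triangles just below
these vertices moves the boundary into the smaller ball, where `hinj` applies. -/
theorem noEnclosed_succ (hD : D.IsSurface) (ht : 5 ≤ t) (hk : D.GoodSphere v (k + 1))
    (hinj : D.NoEnclosed v k)
    (hint : ∀ w, D.skeleton.dist v w = k → D.IsInterior w) : D.NoEnclosed v (k + 1) := by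
  intro Q hQ hev
  have hQT : ∀ s ∈ Q, s ∈ D.triangles := fun s hs => mem_triangles_of_mem_outTris (hQ hs)
  have hradial : ∀ a b, a ≠ b → D.skeleton.dist v a ≤ k + 1 → D.skeleton.dist v b ≤ k + 1 →
      0 < cnt Q {a, b} → D.skeleton.dist v a = k + 1 ∧ D.skeleton.dist v b = k + 1 := by
    intro a b hab ha hb h
    obtain ⟨c, hc, -⟩ := exists_mem_of_cnt_pos hQT hab h
    have := dist_of_mem_outTris hD hQ hc ha hb
    exact ⟨this.1, this.2.1⟩
  set U : Finset W := Finset.univ.filter fun u => D.skeleton.dist v u = k + 1 ∧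
    ∃ x, x ≠ u ∧ D.skeleton.dist v x = k + 1 ∧ Odd (cnt Q {u, x}) with hU
  -- The boundary of `Q` has positive even degree at `u`, while `u` has at most two neighbours on
  -- its sphere; so it uses both.
  have hUclosed : ∀ u ∈ U, ∀ y, D.skeleton.Adj u y → D.skeleton.dist v y = k + 1 →
      Odd (cnt Q {u, y}) := by
    intro u hu y huy hy
    simp only [hU, Finset.mem_filter, Finset.mem_univ, true_and] at hu
    obtain ⟨huk, x, hxu, hx, hodd⟩ := hu
    have hsub : (Finset.univ.filter fun x => x ≠ u ∧ Odd (cnt Q {u, x})) ⊆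
        Finset.univ.filter fun x => D.skeleton.Adj u x ∧ D.skeleton.dist v x = k + 1 := by
      intro z hz
      simp only [Finset.mem_filter, Finset.mem_univ, true_and] at hz ⊢
      obtain ⟨c, -, hc⟩ := exists_mem_of_cnt_pos hQT hz.1.symm hz.2.pos
      refine ⟨hc.adj, ?_⟩
      by_cases hle : D.skeleton.dist v z ≤ k + 1
      · exact (hradial u z hz.1.symm huk.le hle hz.2.pos).2
      · have := hev _ (mem_outEdges_pair.2 ⟨hc.adj, Or.inr (by omega)⟩)
        exact absurd hz.2 (Nat.not_odd_iff_even.2 this)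
    have hle := hk.card_neighbors_le_two hD hdeg (by omega) huk
    have heven := even_card_odd_cnt (fun s hs => (hQT s hs).2) u
    have hpos : 0 < (Finset.univ.filter fun x => x ≠ u ∧ Odd (cnt Q {u, x})).card :=
      Finset.card_pos.2 ⟨x, by simp [hxu, hodd]⟩
    have heq := Finset.eq_of_subset_of_card_le hsub (by
      obtain ⟨m, hm⟩ := heven
      omega)
    have : y ∈ Finset.univ.filter fun x => x ≠ u ∧ Odd (cnt Q {u, x}) := by
      rw [heq]; simp [huy, hy]
    simp only [Finset.mem_filter] at this
    exact this.2.2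
  have hUmem : ∀ u x, x ≠ u → D.skeleton.dist v u = k + 1 → D.skeleton.dist v x = k + 1 →
      Odd (cnt Q {u, x}) → u ∈ U := by
    intro u x h1 h2 h3 h4
    simp only [hU, Finset.mem_filter, Finset.mem_univ, true_and]
    exact ⟨h2, x, h1, h3, h4⟩
  have hUdist : ∀ u ∈ U, D.skeleton.dist v u = k + 1 := by
    intro u hu
    simp only [hU, Finset.mem_filter] at hu
    exact hu.2.1
  set N : Finset (Finset W) := D.triFinset.filter fun s =>
    (∀ w ∈ s, D.skeleton.dist v w ≤ k + 1) ∧ ∃ u ∈ U, u ∈ s with hN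
  have hNmem : ∀ a b c, {a, b, c} ∈ N ↔ D.Tri a b c ∧ (D.skeleton.dist v a ≤ k + 1 ∧
      D.skeleton.dist v b ≤ k + 1 ∧ D.skeleton.dist v c ≤ k + 1) ∧
        (a ∈ U ∨ b ∈ U ∨ c ∈ U) := by
    intro a b c
    simp only [hN, Finset.mem_filter, mem_triFinset, Finset.mem_insert, Finset.mem_singleton,
      forall_eq_or_imp, forall_eq]
    constructor
    · rintro ⟨h1, h2, u, hu, rfl | rfl | rfl⟩ <;> exact ⟨tri_of_mem h1, h2, by tauto⟩
    · rintro ⟨h1, h2, h | h | h⟩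
      · exact ⟨h1.mem_triangles, h2, a, h, by simp⟩
      · exact ⟨h1.mem_triangles, h2, b, h, by simp⟩
      · exact ⟨h1.mem_triangles, h2, c, h, by simp⟩
  have hNT : ∀ s ∈ N, s ∈ D.triangles := by
    intro s hs
    simp only [hN, Finset.mem_filter, mem_triFinset] at hs
    exact hs.1
  have hdisj : Disjoint Q N := by
    rw [Finset.disjoint_left]
    intro s hs hs'
    obtain ⟨a, b, c, -, rfl⟩ := exists_tri_of_mem_triangles (hQT s hs)
    have h1 := (mem_outTris_triple.1 (hQ hs)).2
    have h2 := ((hNmem a b c).1 hs').2.1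
    omega
  have hcntN0 : ∀ a b, a ≠ b → (∀ c, {a, b, c} ∉ N) → cnt N {a, b} = 0 := by
    intro a b hab h
    by_contra h0
    obtain ⟨c, hc, -⟩ := exists_mem_of_cnt_pos hNT hab (Nat.pos_of_ne_zero h0)
    exact h c hc
  -- edges between the spheres of radius `k` and `k + 1`
  have hrad : ∀ p u, D.skeleton.Adj p u → D.skeleton.dist v p = k →
      D.skeleton.dist v u = k + 1 → Even (cnt (Q ∪ N) {p, u}) := by
    intro p u hpu hp hu
    have hQ0 : cnt Q {p, u} = 0 := by
      by_contra h0
      have := hradial p u hpu.1 (by omega) hu.le (Nat.pos_of_ne_zero h0)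
      omega
    have hle : ∀ c, D.Tri p u c → D.skeleton.dist v c ≤ k + 1 := by
      intro c hc
      have := hD.dist_le_succ v hc.adj₁₃.symm
      omega
    rw [cnt_union hdisj, hQ0, zero_add]
    by_cases huU : u ∈ U
    · obtain ⟨b, hb⟩ := hD.exists_tri hpu
      obtain ⟨c, hcb, hc⟩ := (hint p hp).exists_tri_ne hb
      have h1 := one_lt_cnt (R := N) hb ((hNmem _ _ _).2 ⟨hb, ⟨by omega, hu.le, hle b hb⟩,
        by tauto⟩) ((hNmem _ _ _).2 ⟨hc, ⟨by omega, hu.le, hle c hc⟩, by tauto⟩) hcb.symm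
      have h2 := hD.cnt_le_two hNT hpu.1
      have : cnt N {p, u} = 2 := by omega
      rw [this]; exact even_two
    · rw [hcntN0 p u hpu.1 ?_]
      · exact Even.zero
      · intro x hx
        obtain ⟨h1, h2, h3 | h3 | h3⟩ := (hNmem _ _ _).1 hx
        · have := hUdist p h3
          omega
        · exact huU h3
        · have hx := hUdist x h3
          refine huU (hUmem u x h1.2.2.1.symm hu hx ?_)
          rw [Finset.pair_comm]
          exact hUclosed x h3 u h1.adj₂₃.symm hu
  have hflat : ∀ a b c, D.Tri a b c → D.skeleton.dist v a = k + 1 →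
      D.skeleton.dist v b = k + 1 → D.skeleton.dist v c ≤ k + 1 →
      D.skeleton.dist v c + 1 = k + 1 := by
    intro a b c h ha hb hc
    have h1 := hD.dist_le_succ v h.adj₁₃
    have h2 : D.skeleton.dist v c ≠ k + 1 := fun h2 =>
      hk.not_flat hD hdeg (by omega) (Or.inl ht) h ha hb h2
    omega
  have hempty := hinj (Q ∪ N) (by
    intro s hs
    obtain ⟨a, b, c, habc, rfl⟩ := exists_tri_of_mem_triangles
      ((Finset.mem_union.1 hs).elim (hQT s) (hNT s))
    rw [mem_outTris_triple]
    refine ⟨habc, ?_⟩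
    rcases Finset.mem_union.1 hs with hs | hs
    · have := (mem_outTris_triple.1 (hQ hs)).2
      omega
    · rcases ((hNmem a b c).1 hs).2.2 with h | h | h <;> have := hUdist _ h <;> omega) (by
    intro e he
    obtain ⟨a, b, hab, rfl⟩ := exists_adj_of_mem_edges (mem_edges_of_mem_outEdges he)
    have hk' := (mem_outEdges_pair.1 he).2
    by_cases hout : k + 1 < D.skeleton.dist v a ∨ k + 1 < D.skeleton.dist v b
    · rw [cnt_union hdisj, hcntN0 a b hab.1 (fun c hc => by
        have := ((hNmem a b c).1 hc).2.1
        omega), add_zero]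
      exact hev _ (mem_outEdges_pair.2 ⟨hab, hout⟩)
    · have h1 := hD.dist_le_succ v hab
      have h2 := hD.dist_le_succ v hab.symm
      by_cases ha : D.skeleton.dist v a = k + 1
      · by_cases hb : D.skeleton.dist v b = k + 1
        · rw [cnt_union hdisj]
          by_cases hodd : Odd (cnt Q {a, b})
          · have haU := hUmem a b hab.1.symm ha hb hodd
            obtain ⟨c, hc, hc'⟩ := hk.edge a b hab ha hb
            have hcN : {a, b, c} ∈ N :=
              (hNmem _ _ _).2 ⟨hc, ⟨ha.le, hb.le, by omega⟩, Or.inl haU⟩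
            -- On the sphere itself `N` contributes exactly the triangle over the unique lower apex,
            -- cancelling the odd count of `Q`.
            have h3 : ¬ 1 < cnt N {a, b} := fun h3 => by
              obtain ⟨x, y, hxy, hx, hx', hy, hy'⟩ := exists_two_of_one_lt_cnt hNT hab.1 h3
              have h4 := hflat a b x hx' ha hb ((hNmem _ _ _).1 hx).2.1.2.2
              have h5 := hflat a b y hy' ha hb ((hNmem _ _ _).1 hy).2.1.2.2
              exact hxy (hk.lower_apex_unique hD hdeg (by omega) hx' hy' ha h4 h5)
            have h4 := cnt_pos_of_mem hcN
            have h5 : cnt N {a, b} = 1 := by omega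
            rw [h5]
            exact hodd.add_one
          · rw [hcntN0 a b hab.1, add_zero]
            · exact Nat.not_odd_iff_even.1 hodd
            · intro c hc
              obtain ⟨h3, h4, h5 | h5 | h5⟩ := (hNmem _ _ _).1 hc
              · exact hodd (hUclosed a h5 b hab hb)
              · rw [Finset.pair_comm] at hodd
                exact hodd (hUclosed b h5 a hab.symm ha)
              · have h6 := hUdist c h5
                have := hflat a b c h3 ha hb h6.le
                omega
        · rw [Finset.pair_comm]
          exact hrad b a hab.symm (by omega) ha
      · exact hrad a b hab (by omega) (by omega))
  exact (Finset.union_eq_empty.1 hempty).1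

-- This is the form in which Gauss–Bonnet is applied to a path: the relative boundary of `Q` at each
-- vertex can be read off from `z`, and irreducibility of `z` makes the total curvature nonnegative.
omit hdeg in
theorem IsDisc.exists_relative_filling_oddEnds (hD : D.IsDisc) {z : Finset (Finset W)}
    (hinj : D.NoEnclosed v k) (hz : z ⊆ D.outEdges v k) (hne : z.Nonempty)
    (hz' : ∀ w, k < D.skeleton.dist v w → Even (degIn z w))
    (hirr : ∀ y ⊆ z, (∀ w, k < D.skeleton.dist v w → Even (degIn y w)) → y = ∅ ∨ y = z) :
    ∃ Q ⊆ D.outTris v k, 0 ≤ ∑ w, D.curv v k Q w ∧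
      (∀ w x, {w, x} ∈ z → 0 < cnt Q {w, x}) ∧
      ∀ w x, x ∈ D.oddEnds v k Q w ↔ {w, x} ∈ z := by
  obtain ⟨Q, hQ, h⟩ := hD.exists_relative_filling v k hz hz'
  have hQT : ∀ s ∈ Q, s ∈ D.triangles := fun s hs => mem_triangles_of_mem_outTris (hQ hs)
  have hzeq : ({e ∈ D.outEdges v k | Odd (cnt Q e)} : Finset (Finset W)) = z := by
    ext e
    rw [Finset.mem_filter]
    constructor
    · rintro ⟨h1, h2⟩
      exact (h e h1).2 h2
    · intro h1
      exact ⟨hz h1, (h e (hz h1)).1 h1⟩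
  have hpos : ∀ e ∈ z, 0 < cnt Q e := fun e he => ((h e (hz he)).1 he).pos
  refine ⟨Q, hQ, hD.sum_curv_nonneg v k hinj hQ ?_ ?_, fun w x h => hpos _ h, fun w x => ?_⟩
  · obtain ⟨e, he⟩ := hne
    obtain ⟨s, hs⟩ := Finset.card_pos.1 (hpos e he)
    exact ⟨s, (Finset.mem_filter.1 hs).1⟩
  · rw [hzeq]
    exact hirr
  · simp only [oddEnds, Finset.mem_filter, Finset.mem_univ, true_and]
    constructor
    · rintro ⟨h1, h2, h3⟩
      obtain ⟨c, -, hc⟩ := exists_mem_of_cnt_pos hQT h1.symm h3.pos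
      exact (h _ (mem_outEdges_pair.2 ⟨hc.adj, h2⟩)).2 h3
    · intro h1
      have h2 := mem_outEdges_pair.1 (hz h1)
      exact ⟨h2.1.1.symm, h2.2, (h _ (hz h1)).1 h1⟩

omit hdeg [Fintype W] in
theorem even_degIn_iff {y : Finset (Finset W)} {w : W} {e f : Finset W} (hef : e ≠ f)
    (he : w ∈ e) (hf : w ∈ f) (h : ∀ g ∈ y, w ∈ g → g = e ∨ g = f) :
    Even (degIn y w) ↔ (e ∈ y ↔ f ∈ y) := by
  have h1 : {g ∈ y | w ∈ g} = ({e, f} : Finset (Finset W)).filter (· ∈ y) := by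
    ext g
    simp only [Finset.mem_filter, Finset.mem_insert, Finset.mem_singleton]
    constructor
    · rintro ⟨h1, h2⟩
      exact ⟨h g h1 h2, h1⟩
    · rintro ⟨rfl | rfl, h1⟩
      · exact ⟨h1, he⟩
      · exact ⟨h1, hf⟩
  rw [degIn, h1, Finset.filter_insert, Finset.filter_singleton]
  by_cases h2 : e ∈ y <;> by_cases h3 : f ∈ y <;> simp [h2, h3, Finset.card_pair hef]

omit hdeg in
/-- An edge of `Q` outside the ball that is not in its relative boundary is interior to `Q`. -/
theorem mem_twoEnds_of_notMem_oddEnds (hD : D.IsSurface) {Q : Finset (Finset W)}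
    (hQ : Q ⊆ D.outTris v k) {w x c : W} (h : {w, x, c} ∈ Q)
    (hout : k < D.skeleton.dist v w ∨ k < D.skeleton.dist v x)
    (hodd : x ∉ D.oddEnds v k Q w) : x ∈ D.twoEnds v k Q w := by
  have hQT : ∀ s ∈ Q, s ∈ D.triangles := fun s hs => mem_triangles_of_mem_outTris (hQ hs)
  have hT := (mem_outTris_triple.1 (hQ h)).1
  have h1 := hD.cnt_le_two hQT hT.1
  have h2 := cnt_pos_of_mem h
  simp only [oddEnds, Finset.mem_filter, Finset.mem_univ, true_and, hout, hT.1.symm, ne_eq,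
    not_false_eq_true, Nat.not_odd_iff_even] at hodd
  simp only [twoEnds, Finset.mem_filter, Finset.mem_univ, true_and]
  obtain ⟨m, hm⟩ := hodd
  exact ⟨hT.1.symm, hout, by omega⟩

-- Fill the path `b, a, a', b'`, where `b` and `b'` are neighbours on the sphere of radius `k`.
-- Apart from interior edges, `a` and `a'` have curvature at most `6 - 2 * 2 = 2` and `b` and `b'`
-- at most `-1`. If the edge from `a` to `a'` has no lower apex, then `Q` has enough interior edges
-- along the path to make the total negative.
set_option maxHeartbeats 1000000 in
theorem IsDisc.exists_lower_apex (hD : D.IsDisc) (ht : 6 ≤ t) (hk : D.GoodSphere v k)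
    (hinj : D.NoEnclosed v k) {a a' : W} (haa : D.skeleton.Adj a a')
    (ha : D.skeleton.dist v a = k + 1) (ha' : D.skeleton.dist v a' = k + 1) :
    ∃ c, D.Tri a a' c ∧ D.skeleton.dist v c + 1 = k + 1 := by
  have hS := hD.isSurface
  by_contra! hnot
  obtain ⟨b, hab, hb⟩ := hS.exists_adj_dist ha
  obtain ⟨b', hab', hb'⟩ := hS.exists_adj_dist ha'
  have hne1 : a ≠ b' := by rintro rfl; omega
  have hne2 : a' ≠ b := by rintro rfl; omega
  set z : Finset (Finset W) := {{a, b}, {a, a'}, {a', b'}} with hzdef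
  have hpair : ∀ w x, ({w, x} : Finset W) ∈ z ↔
      (w = a ∧ x = b ∨ w = b ∧ x = a) ∨ (w = a ∧ x = a' ∨ w = a' ∧ x = a) ∨
        (w = a' ∧ x = b' ∨ w = b' ∧ x = a') := by
    intro w x
    simp only [hzdef, Finset.mem_insert, Finset.mem_singleton, pair_eq_pair_iff]
  have hz : z ⊆ D.outEdges v k := by
    intro e he
    simp only [hzdef, Finset.mem_insert, Finset.mem_singleton] at he
    rcases he with rfl | rfl | rfl <;>
      exact mem_outEdges_pair.2 ⟨by assumption, by omega⟩
  have hev1 : ∀ y ⊆ z, (Even (degIn y a) ↔ (({a, b} : Finset W) ∈ y ↔ {a, a'} ∈ y)) := by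
    intro y hy
    refine even_degIn_iff (fun h => hne2 (eq_of_pair_eq h hab.1.symm).symm) (by simp)
      (by simp) ?_
    intro g hg hag
    have := hy hg
    simp only [hzdef, Finset.mem_insert, Finset.mem_singleton] at this
    rcases this with h | h | h
    · exact Or.inl h
    · exact Or.inr h
    · rw [h, Finset.mem_insert, Finset.mem_singleton] at hag
      exact absurd hag (by simp [haa.1, hne1])
  have hev2 : ∀ y ⊆ z, (Even (degIn y a') ↔ (({a', b'} : Finset W) ∈ y ↔ {a, a'} ∈ y)) := by
    intro y hy
    refine even_degIn_iff (fun h => ?_) (by simp) (by simp) ?_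
    · rw [Finset.pair_comm a a'] at h
      exact hne1 (eq_of_pair_eq h hab'.1.symm).symm
    intro g hg hag
    have := hy hg
    simp only [hzdef, Finset.mem_insert, Finset.mem_singleton] at this
    rcases this with h | h | h
    · rw [h, Finset.mem_insert, Finset.mem_singleton] at hag
      exact absurd hag (by simp [haa.1.symm, hne2])
    · exact Or.inr h
    · exact Or.inl h
  obtain ⟨Q, hQ, hsum, hpos, hodd⟩ := hD.exists_relative_filling_oddEnds hinj hz
    (by simp [hzdef])
    (by
      intro w hw
      by_cases hwa : w = a
      · subst hwa
        rw [hev1 z subset_rfl]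
        simp [hzdef]
      by_cases hwa' : w = a'
      · subst hwa'
        rw [hev2 z subset_rfl]
        simp [hzdef]
      have h1 : w ≠ b := by rintro rfl; omega
      have h2 : w ≠ b' := by rintro rfl; omega
      have : degIn z w = 0 := by
        rw [degIn, Finset.card_eq_zero, Finset.filter_eq_empty_iff]
        simp [hzdef, hwa, hwa', h1, h2]
      rw [this]
      exact Even.zero)
    (by
      intro y hy hev
      have h1 := (hev1 y hy).1 (hev a (by omega))
      have h2 := (hev2 y hy).1 (hev a' (by omega))
      by_cases h3 : ({a, a'} : Finset W) ∈ y
      · right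
        refine Finset.Subset.antisymm hy ?_
        intro e he
        simp only [hzdef, Finset.mem_insert, Finset.mem_singleton] at he
        rcases he with rfl | rfl | rfl <;> simp_all
      · left
        rw [Finset.eq_empty_iff_forall_notMem]
        intro e he
        have := hy he
        simp only [hzdef, Finset.mem_insert, Finset.mem_singleton] at this
        rcases this with rfl | rfl | rfl <;> simp_all)
  have hQT : ∀ s ∈ Q, s ∈ D.triangles := fun s hs => mem_triangles_of_mem_outTris (hQ hs)
  have hOa : D.oddEnds v k Q a = {b, a'} := by
    ext x
    rw [hodd, hpair, Finset.mem_insert, Finset.mem_singleton]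
    grind [hab.1, haa.1]
  have hOa' : D.oddEnds v k Q a' = {b', a} := by
    ext x
    rw [hodd, hpair, Finset.mem_insert, Finset.mem_singleton]
    grind [hab'.1, haa.1]
  have hOb : D.oddEnds v k Q b ⊆ {a, a'} := by
    intro x hx
    rw [hodd, hpair] at hx
    rw [Finset.mem_insert, Finset.mem_singleton]
    grind [hab.1]
  have hab_mem : a ∈ D.oddEnds v k Q b := by
    rw [hodd, hpair]; simp
  have hab_mem' : a' ∈ D.oddEnds v k Q b' := by
    rw [hodd, hpair]; simp
  have hOw : ∀ w, w ≠ a → w ≠ a' → w ≠ b → w ≠ b' → D.oddEnds v k Q w = ∅ := by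
    intro w h1 h2 h3 h4
    rw [Finset.eq_empty_iff_forall_notMem]
    intro x
    rw [hodd, hpair]
    grind
  have hface : ∀ c, D.Tri a a' c → D.skeleton.dist v c ≠ k := by
    intro c hc h
    exact hnot c hc (by omega)
  -- The apex `x` of the triangle of `Q` on the middle edge is not on the lower sphere, hence is
  -- neither `b` nor `b'`; so both `a` and `a'` have an interior edge, leading to `x`.
  obtain ⟨x, hx, hx'⟩ := exists_mem_of_cnt_pos hQT haa.1 (hpos a a' ((hpair _ _).2 (by simp)))
  obtain ⟨y, hy, hy'⟩ := exists_mem_of_cnt_pos hQT hab.1 (hpos a b ((hpair _ _).2 (by simp)))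
  have hxb : x ≠ b := by rintro rfl; exact hface _ hx' hb
  have hxb' : x ≠ b' := by rintro rfl; exact hface _ hx' hb'
  have hya' : y ≠ a' := by rintro rfl; exact hface _ hy'.swap' hb
  have hxB : x ∈ D.twoEnds v k Q a := by
    refine mem_twoEnds_of_notMem_oddEnds hS hQ (c := a') (by rwa [Finset.pair_comm]) (by omega) ?_
    rw [hOa]
    simp [hxb, hx'.2.2.1.symm]
  have hxB' : x ∈ D.twoEnds v k Q a' := by
    refine mem_twoEnds_of_notMem_oddEnds hS hQ (c := a)
      (by rwa [Finset.pair_comm x a, Finset.insert_comm]) (by omega) ?_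
    rw [hOa']
    simp [hxb', hx'.2.1.symm]
  have hyB : y ∈ D.twoEnds v k Q a := by
    refine mem_twoEnds_of_notMem_oddEnds hS hQ (c := b) (by rwa [Finset.pair_comm]) (by omega) ?_
    rw [hOa]
    simp [hya', hy'.2.2.1.symm]
  have hBa := Finset.card_pos.2 ⟨x, hxB⟩
  have hBa' := Finset.card_pos.2 ⟨x, hxB'⟩
  have hca := curv_le_of_out hS hk hQ (w := a) (by omega)
  rw [hOa, Finset.card_pair hne2.symm] at hca
  have hca' := curv_le_of_out hS hk hQ (w := a') (by omega)
  rw [hOa', Finset.card_pair hne1.symm] at hca'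
  have hcb := curv_le_of_inner hS hdeg hk hQ (by omega) hb.le ⟨a, hab_mem⟩
  have hcb' := curv_le_of_inner hS hdeg hk hQ (by omega) hb'.le ⟨a', hab_mem'⟩
  have hOb1 := Finset.card_pos.2 ⟨a, hab_mem⟩
  have hOb1' := Finset.card_pos.2 ⟨a', hab_mem'⟩
  -- So far the bounds only add up to `1 + 1 - 1 - 1 = 0`. The triangle of `Q` over the edge from
  -- `a` to `b` provides one more interior edge: at `a` if its apex `y` is on the lower sphere (then
  -- `y ≠ x`), at `b` otherwise.
  have hextra : 2 ≤ (D.twoEnds v k Q a).card ∨ 1 ≤ (D.twoEnds v k Q b).card := by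
    have h1 := hS.dist_le_succ v hy'.adj₁₃
    have h2 := hS.dist_le_succ v hy'.adj₂₃.symm
    by_cases hyk : D.skeleton.dist v y = k
    · left
      have hxy : x ≠ y := by rintro rfl; exact hface _ hx' hyk
      rw [← Finset.card_pair hxy]
      exact Finset.card_le_card (by
        intro u hu
        simp only [Finset.mem_insert, Finset.mem_singleton] at hu
        rcases hu with rfl | rfl <;> assumption)
    · right
      refine Finset.card_pos.2
        ⟨y, mem_twoEnds_of_notMem_oddEnds hS hQ (c := a) ?_ (by omega) fun h => ?_⟩
      · rwa [Finset.pair_comm y a, Finset.insert_comm]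
      · have := hOb h
        rw [Finset.mem_insert, Finset.mem_singleton] at this
        rcases this with h | h
        · exact hy'.2.1 h.symm
        · exact hya' h
  have hle : ∀ w ∈ Finset.univ, D.curv v k Q w ≤
      (if w = a then 2 - ((D.twoEnds v k Q a).card : ℤ) else 0) +
      (if w = a' then 1 else 0) +
      (if w = b then -1 - ((D.twoEnds v k Q b).card : ℤ) else 0) +
      (if w = b' then -1 else 0) := by
    intro w _
    by_cases hwa : w = a
    · subst hwa
      rw [if_pos rfl, if_neg haa.1, if_neg hab.1, if_neg hne1]
      omega
    by_cases hwa' : w = a'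
    · subst hwa'
      rw [if_neg hwa, if_pos rfl, if_neg hne2, if_neg hab'.1]
      omega
    by_cases hwb : w = b
    · subst hwb
      rw [if_neg hwa, if_neg hwa', if_pos rfl]
      -- When `b = b'` both contributions `-1` fall on one vertex, which indeed has two odd ends.
      by_cases hbb : w = b'
      · subst hbb
        rw [if_pos rfl]
        have : 2 ≤ (D.oddEnds v k Q w).card := by
          rw [← Finset.card_pair haa.1]
          exact Finset.card_le_card (by
            intro u hu
            simp only [Finset.mem_insert, Finset.mem_singleton] at hu
            rcases hu with rfl | rfl <;> assumption)
        omega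
      · rw [if_neg hbb]
        omega
    by_cases hwb' : w = b'
    · subst hwb'
      rw [if_neg hwa, if_neg hwa', if_neg hwb, if_pos rfl]
      omega
    rw [if_neg hwa, if_neg hwa', if_neg hwb, if_neg hwb']
    exact curv_nonpos hS hdeg hk hQ ht (hOw w hwa hwa' hwb hwb')
  have := Finset.sum_le_sum hle
  rw [Finset.sum_add_distrib, Finset.sum_add_distrib, Finset.sum_add_distrib] at this
  simp only [Finset.sum_ite_eq', Finset.mem_univ, if_true] at this
  omega

/-- Fill the path `b, a, c`. If its vertices span no triangle, `Q` has an interior edge at `a`,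
whose curvature is then at most `6 - 4 - 1 = 1`, while `b` and `c` contribute at most `-1` each. -/
theorem IsDisc.tri_of_lower_neighbors (hD : D.IsDisc) (ht : 6 ≤ t) (hk : D.GoodSphere v k)
    (hinj : D.NoEnclosed v k) {a b c : W} (hab : D.skeleton.Adj a b)
    (hac : D.skeleton.Adj a c) (hbc : b ≠ c) (ha : D.skeleton.dist v a = k + 1)
    (hb : D.skeleton.dist v b + 1 = k + 1) (hc : D.skeleton.dist v c + 1 = k + 1) :
    D.Tri a b c := by
  have hS := hD.isSurface
  by_contra hnot
  have hb : D.skeleton.dist v b = k := by omega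
  have hc : D.skeleton.dist v c = k := by omega
  have hpair : ∀ w x, ({w, x} : Finset W) ∈ ({{a, b}, {a, c}} : Finset (Finset W)) ↔
      (w = a ∧ (x = b ∨ x = c)) ∨ (x = a ∧ (w = b ∨ w = c)) := by
    intro w x
    simp only [Finset.mem_insert, Finset.mem_singleton, pair_eq_pair_iff]
    tauto
  have hz : ({{a, b}, {a, c}} : Finset (Finset W)) ⊆ D.outEdges v k := by
    intro e he
    simp only [Finset.mem_insert, Finset.mem_singleton] at he
    rcases he with rfl | rfl
    · exact mem_outEdges_pair.2 ⟨hab, by omega⟩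
    · exact mem_outEdges_pair.2 ⟨hac, by omega⟩
  have hne : ({a, b} : Finset W) ≠ {a, c} := fun h => hbc (eq_of_pair_eq h hab.1.symm)
  obtain ⟨Q, hQ, hsum, hpos, hodd⟩ := hD.exists_relative_filling_oddEnds hinj hz (by simp)
    (by
      intro w hw
      rw [degIn, Finset.filter_insert, Finset.filter_singleton]
      by_cases hwa : w = a
      · subst hwa
        simp [Finset.card_pair hne]
      · have h1 : w ≠ b := by rintro rfl; omega
        have h2 : w ≠ c := by rintro rfl; omega
        simp [hwa, h1, h2])
    (by
      intro y hy hev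
      have := hev a (by omega)
      have h1 : ∀ e ∈ y, a ∈ e := by
        intro e he
        have := hy he
        simp only [Finset.mem_insert, Finset.mem_singleton] at this
        rcases this with rfl | rfl <;> simp
      rw [degIn, Finset.filter_true_of_mem h1] at this
      have h2 := Finset.card_le_card hy
      rw [Finset.card_pair hne] at h2
      rcases Nat.eq_zero_or_pos y.card with h0 | h0
      · exact Or.inl (Finset.card_eq_zero.1 h0)
      · right
        refine Finset.eq_of_subset_of_card_le hy ?_
        rw [Finset.card_pair hne]
        obtain ⟨m, hm⟩ := this
        omega)
  have hQT : ∀ s ∈ Q, s ∈ D.triangles := fun s hs => mem_triangles_of_mem_outTris (hQ hs)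
  have hOa : D.oddEnds v k Q a = {b, c} := by
    ext x
    rw [hodd, hpair, Finset.mem_insert, Finset.mem_singleton]
    have := hab.1
    have := hac.1
    constructor
    · rintro (h | ⟨-, h | h⟩) <;> tauto
    · tauto
  have hOb : ∀ w, w = b ∨ w = c → D.oddEnds v k Q w = {a} := by
    intro w hw
    ext x
    rw [hodd, hpair, Finset.mem_singleton]
    have h1 := hab.1
    have h2 := hac.1
    have h3 : w ≠ a := by rcases hw with rfl | rfl <;> exact Ne.symm ‹_›
    tauto
  have hOw : ∀ w, w ≠ a → w ≠ b → w ≠ c → D.oddEnds v k Q w = ∅ := by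
    intro w h1 h2 h3
    rw [Finset.eq_empty_iff_forall_notMem]
    intro x
    rw [hodd, hpair]
    grind
  obtain ⟨x, hx, hx'⟩ := exists_mem_of_cnt_pos hQT hab.1 (hpos a b ((hpair _ _).2 (by simp)))
  have hxc : x ≠ c := fun h => hnot (h ▸ hx')
  have hxB : x ∈ D.twoEnds v k Q a := by
    refine mem_twoEnds_of_notMem_oddEnds hS hQ (c := b) (by rwa [Finset.pair_comm]) (by omega) ?_
    rw [hOa]
    simp [hxc, hx'.2.2.1.symm]
  have hBa := Finset.card_pos.2 ⟨x, hxB⟩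
  have hca := curv_le_of_out hS hk hQ (w := a) (by omega)
  rw [hOa, Finset.card_pair hbc] at hca
  have hcb : ∀ w, w = b ∨ w = c → D.curv v k Q w ≤ -1 := by
    intro w hw
    have := curv_le_of_inner hS hdeg hk hQ (by omega) (w := w)
      (by rcases hw with rfl | rfl <;> omega) (by rw [hOb w hw]; simp)
    rw [hOb w hw, Finset.card_singleton] at this
    push_cast at this
    omega
  have hle : ∀ w ∈ Finset.univ, D.curv v k Q w ≤ (if w = a then 1 else 0) +
      (if w = b then -1 else 0) + (if w = c then -1 else 0) := by
    intro w _
    by_cases hwa : w = a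
    · subst hwa
      rw [if_pos rfl, if_neg hab.1, if_neg hac.1]
      omega
    · by_cases hwb : w = b
      · subst hwb
        rw [if_neg hwa, if_pos rfl, if_neg hbc]
        have := hcb w (Or.inl rfl)
        omega
      · by_cases hwc : w = c
        · subst hwc
          rw [if_neg hwa, if_neg hwb, if_pos rfl]
          have := hcb w (Or.inr rfl)
          omega
        · rw [if_neg hwa, if_neg hwb, if_neg hwc]
          exact curv_nonpos hS hdeg hk hQ ht (hOw w hwa hwb hwc)
  have := Finset.sum_le_sum hle
  rw [Finset.sum_add_distrib, Finset.sum_add_distrib] at this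
  simp only [Finset.sum_ite_eq', Finset.mem_univ, if_true] at this
  omega

theorem IsDisc.goodSphere_succ (hD : D.IsDisc) (ht : 6 ≤ t) (hk : D.GoodSphere v k)
    (hinj : D.NoEnclosed v k) : D.GoodSphere v (k + 1) where
  edge _ _ := hD.exists_lower_apex hdeg ht hk hinj
  vertex _ _ _ := hD.tri_of_lower_neighbors hdeg ht hk hinj

theorem IsDisc.goodSphere_of_six_le (hD : D.IsDisc) (ht : 6 ≤ t) {n : ℕ}
    (hn : ∀ w, D.skeleton.dist v w < n → D.IsInterior w) (k : ℕ) (hk : k ≤ n) :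
    D.GoodSphere v k ∧ D.NoEnclosed v k := by
  induction k with
  | zero => exact ⟨hD.isSurface.goodSphere_zero v, hD.isSurface.noEnclosed_zero v⟩
  | succ k ih =>
    obtain ⟨h1, h2⟩ := ih (by omega)
    have h3 := hD.goodSphere_succ hdeg ht h1 h2
    exact ⟨h3, noEnclosed_succ hdeg hD.isSurface (by omega) h3 h2
      fun w hw => hn w (by omega)⟩

end
end AbstractSimplicialComplex

/-! ### The double count of sphere edges and triangles -/

namespace AbstractSimplicialComplex

section
open scoped Classical

variable {W : Type*} {D : AbstractSimplicialComplex W} [Fintype W]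

/-- The finite set of edges of the sphere of radius `k` centred at `v`. -/
noncomputable def sphereFinset (D : AbstractSimplicialComplex W) (v : W) (k : ℕ) :
    Finset (Finset W) :=
  {e ∈ D.edgeFinset | ∀ w ∈ e, D.skeleton.dist v w = k}

/-- The finite set of triangles inside the sphere of radius `n` centred at `v`. -/
noncomputable def ballFinset (D : AbstractSimplicialComplex W) (v : W) (n : ℕ) :
    Finset (Finset W) :=
  {s ∈ D.triFinset | ∀ w ∈ s, D.skeleton.dist v w ≤ n}

theorem sphereLength_eq_card (v : W) (k : ℕ) :
    D.sphereLength v k = (D.sphereFinset v k).card := by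
  rw [sphereLength, sphere, ← Set.ncard_coe_finset]
  congr 1
  ext e
  simp [sphereFinset]

theorem sphereArea_eq_card (v : W) (n : ℕ) : D.sphereArea v n = (D.ballFinset v n).card := by
  rw [sphereArea, ← Set.ncard_coe_finset]
  congr 1
  ext e
  simp [ballFinset]

theorem mem_sphereFinset_pair {v a b : W} {k : ℕ} : {a, b} ∈ D.sphereFinset v k ↔
    D.skeleton.Adj a b ∧ D.skeleton.dist v a = k ∧ D.skeleton.dist v b = k := by
  simp [sphereFinset, mem_edges_pair]

theorem mem_ballFinset_triple {v a b c : W} {n : ℕ} : {a, b, c} ∈ D.ballFinset v n ↔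
    D.Tri a b c ∧ D.skeleton.dist v a ≤ n ∧ D.skeleton.dist v b ≤ n ∧
      D.skeleton.dist v c ≤ n := by
  simp only [ballFinset, Finset.mem_filter, mem_triFinset, Finset.mem_insert,
    Finset.mem_singleton, forall_eq_or_imp, forall_eq, and_congr_left_iff]
  exact fun _ => ⟨tri_of_mem, Tri.mem_triangles⟩

theorem mem_triangles_of_mem_ballFinset {v : W} {n : ℕ} {s : Finset W}
    (h : s ∈ D.ballFinset v n) : s ∈ D.triangles := by
  simp only [ballFinset, Finset.mem_filter, mem_triFinset] at h
  exact h.1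

theorem exists_of_mem_sphereFinset {v : W} {k : ℕ} {e : Finset W}
    (h : e ∈ D.sphereFinset v k) : ∃ a b, D.skeleton.Adj a b ∧ D.skeleton.dist v a = k ∧
      D.skeleton.dist v b = k ∧ e = {a, b} := by
  have he : e ∈ D.edges := by
    simp only [sphereFinset, Finset.mem_filter, mem_edgeFinset] at h
    exact h.1
  obtain ⟨a, b, -, rfl⟩ := exists_adj_of_mem_edges he
  obtain ⟨h1, h2, h3⟩ := mem_sphereFinset_pair.1 h
  exact ⟨a, b, h1, h2, h3, rfl⟩

theorem sphere_edges_in_triangle {v a b c : W} {n : ℕ} (h : D.Tri a b c)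
    (hab : D.skeleton.dist v a = D.skeleton.dist v b)
    (hac : D.skeleton.dist v a ≠ D.skeleton.dist v c) (ha : D.skeleton.dist v a ≤ n) :
    {e ∈ (Finset.range (n + 1)).biUnion (D.sphereFinset v) | e ⊆ {a, b, c}} = {{a, b}} := by
  ext e
  simp only [Finset.mem_filter, Finset.mem_biUnion, Finset.mem_range, Finset.mem_singleton]
  constructor
  · rintro ⟨⟨k, -, he⟩, hsub⟩
    obtain ⟨p, q, hpq, hp, hq, rfl⟩ := exists_of_mem_sphereFinset he
    have hp' : p ∈ ({a, b, c} : Finset W) := hsub (by simp)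
    have hq' : q ∈ ({a, b, c} : Finset W) := hsub (by simp)
    have hne := hpq.1
    simp only [Finset.mem_insert, Finset.mem_singleton] at hp' hq'
    rw [pair_eq_pair_iff]
    rcases hp' with rfl | rfl | rfl <;> rcases hq' with rfl | rfl | rfl <;>
      first | tauto | omega
  · rintro rfl
    exact ⟨⟨_, by omega, mem_sphereFinset_pair.2 ⟨h.adj, rfl, hab.symm⟩⟩, by
      intro x; simp; tauto⟩

/-- The area formula for a ball all of whose spheres are locally convex. -/
theorem IsSurface.sphereArea_eq (hD : D.IsSurface) {t : ℕ} (ht : 4 ≤ t)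
    (hdeg : ∀ w, D.IsInterior w → (D.skeleton.neighborSet w).ncard = t) {v : W} {n : ℕ}
    (htn : 5 ≤ t ∨ n ≤ 1) (hn : ∀ w, D.skeleton.dist v w < n → D.IsInterior w)
    (hgood : ∀ k ≤ n, D.GoodSphere v k) :
    (D.sphereArea v n : ℤ) =
      2 * (∑ k ∈ Finset.range (n + 1), (D.sphereLength v k : ℤ)) - D.sphereLength v n := by
  have hflat : ∀ a b c, D.Tri a b c → D.skeleton.dist v a ≤ n →
      D.skeleton.dist v a = D.skeleton.dist v b → D.skeleton.dist v a ≠ D.skeleton.dist v c := by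
    intro a b c h ha hab hac
    exact (hgood _ ha).not_flat hD hdeg ht (by omega) h rfl hab.symm hac.symm
  -- The three distances in a triangle pairwise differ by at most one, so two of them agree; not all
  -- three do, by `hflat`.
  have hone : ∀ s ∈ D.ballFinset v n,
      {e ∈ (Finset.range (n + 1)).biUnion (D.sphereFinset v) | e ⊆ s}.card = 1 := by
    intro s hs
    obtain ⟨a, b, c, habc, rfl⟩ := exists_tri_of_mem_triangles
      (mem_triangles_of_mem_ballFinset hs)
    obtain ⟨-, ha, hb, hc⟩ := mem_ballFinset_triple.1 hs
    have h1 := hD.dist_le_succ v habc.adj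
    have h2 := hD.dist_le_succ v habc.adj.symm
    have h3 := hD.dist_le_succ v habc.adj₁₃
    have h4 := hD.dist_le_succ v habc.adj₁₃.symm
    have h5 := hD.dist_le_succ v habc.adj₂₃
    have h6 := hD.dist_le_succ v habc.adj₂₃.symm
    by_cases hab : D.skeleton.dist v a = D.skeleton.dist v b
    · rw [sphere_edges_in_triangle habc hab (hflat a b c habc ha hab) ha,
        Finset.card_singleton]
    by_cases hac : D.skeleton.dist v a = D.skeleton.dist v c
    · rw [Finset.pair_comm, sphere_edges_in_triangle habc.swap' hac hab ha,
        Finset.card_singleton]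
    · have hbc : D.skeleton.dist v b = D.skeleton.dist v c := by omega
      have : ({a, b, c} : Finset W) = {b, c, a} := by ext; simp; tauto
      rw [this, sphere_edges_in_triangle habc.rot hbc (Ne.symm hab) hb, Finset.card_singleton]
  have hBT : ∀ s ∈ D.ballFinset v n, s ∈ D.triangles :=
    fun s => mem_triangles_of_mem_ballFinset
  -- An apex over an edge of radius `k` is at distance at most `k + 1 ≤ n`, and the endpoints are
  -- interior, so both cofaces are in the ball.
  have hlt : ∀ k < n, ∀ e ∈ D.sphereFinset v k, cnt (D.ballFinset v n) e = 2 := by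
    intro k hk e he
    obtain ⟨a, b, hab, ha, hb, rfl⟩ := exists_of_mem_sphereFinset he
    have hmem : ∀ c, D.Tri a b c → {a, b, c} ∈ D.ballFinset v n := by
      intro c hc
      have := hD.dist_le_succ v hc.adj₁₃.symm
      exact mem_ballFinset_triple.2 ⟨hc, by omega, by omega, by omega⟩
    obtain ⟨c, hc⟩ := hD.exists_tri hab
    obtain ⟨d, hdc, hd⟩ := (hn a (by omega)).exists_tri_ne hc
    have h1 := one_lt_cnt hc (hmem c hc) (hmem d hd) hdc.symm
    have h2 := hD.cnt_le_two hBT hab.1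
    omega
  -- Over an edge of the last sphere only lower apexes stay in the ball, and there is exactly one.
  have heq : ∀ e ∈ D.sphereFinset v n, cnt (D.ballFinset v n) e = 1 := by
    intro e he
    obtain ⟨a, b, hab, ha, hb, rfl⟩ := exists_of_mem_sphereFinset he
    obtain ⟨c, hc, hc'⟩ := (hgood n le_rfl).edge a b hab ha hb
    have h1 := cnt_pos_of_mem (mem_ballFinset_triple.2 ⟨hc, ha.le, hb.le,
      (by omega : D.skeleton.dist v c ≤ n)⟩)
    have h2 : ¬ 1 < cnt (D.ballFinset v n) {a, b} := fun h => by
      obtain ⟨x, y, hxy, hx, hx', hy, hy'⟩ := exists_two_of_one_lt_cnt hBT hab.1 h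
      have hlow : ∀ x, D.Tri a b x → {a, b, x} ∈ D.ballFinset v n →
          D.skeleton.dist v x + 1 = n := by
        intro x hx hx'
        have h3 := (mem_ballFinset_triple.1 hx').2.2.2
        have h4 := hflat a b x hx (by omega) (by omega)
        have h5 := hD.dist_le_succ v hx.adj₁₃
        omega
      exact hxy ((hgood n le_rfl).lower_apex_unique hD hdeg ht hx' hy' ha
        (hlow x hx' hx) (hlow y hy' hy))
    omega
  have hcount := Finset.sum_card_bipartiteAbove_eq_sum_card_bipartiteBelow
    (s := (Finset.range (n + 1)).biUnion (D.sphereFinset v)) (t := D.ballFinset v n)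
    (fun e s => e ⊆ s)
  unfold cnt at hlt heq
  simp only [Finset.bipartiteAbove, Finset.bipartiteBelow] at hcount
  rw [Finset.sum_congr rfl hone, Finset.sum_const, smul_eq_mul, mul_one,
    Finset.sum_biUnion] at hcount
  · rw [Finset.sum_range_succ,
      Finset.sum_congr rfl (fun k hk => Finset.sum_congr rfl (hlt k (Finset.mem_range.1 hk))),
      Finset.sum_congr rfl heq] at hcount
    simp only [Finset.sum_const, smul_eq_mul, mul_one] at hcount
    rw [sphereArea_eq_card, ← hcount, Finset.sum_range_succ]
    simp only [sphereLength_eq_card]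
    push_cast
    rw [← Finset.sum_mul]
    ring
  · intro i _ j _ hij
    refine Finset.disjoint_left.2 fun e he he' => hij ?_
    obtain ⟨a, b, -, ha, -, rfl⟩ := exists_of_mem_sphereFinset he
    exact ha.symm.trans (mem_sphereFinset_pair.1 he').2.1

end
end AbstractSimplicialComplex

/-! ### Replacing the inside of a 3-cycle by one triangle: the surface axioms -/

namespace AbstractSimplicialComplex

section
open scoped Classical

variable {W : Type*}

theorem linkGraph_connected_of {D : AbstractSimplicialComplex W} {w : W}
    (hne : ∃ x, D.skeleton.Adj w x)
    (h : ∀ (S : Set W) (x y : W), D.skeleton.Adj w x → D.skeleton.Adj w y → x ∈ S →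
      (∀ u ∈ S, ∀ z, D.Tri w u z → z ∈ S) → y ∈ S) : (D.linkGraph w).Connected := by
  obtain ⟨x₀, hx₀⟩ := hne
  have : Nonempty {x // D.skeleton.Adj w x} := ⟨⟨x₀, hx₀⟩⟩
  refine ⟨fun x y => ?_⟩
  obtain ⟨_, hy⟩ := h {z | ∃ hz : D.skeleton.Adj w z, (D.linkGraph w).Reachable x ⟨z, hz⟩}
    x.1 y.1 x.2 y.2 ⟨x.2, SimpleGraph.Reachable.refl _⟩ (by
      rintro u ⟨hu, hu'⟩ z hz
      refine ⟨hz.adj₁₃, hu'.trans (SimpleGraph.Adj.reachable ?_)⟩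
      exact ⟨fun h => hz.2.2.1 (congrArg Subtype.val h), hz.2.2.2⟩)
  exact hy

theorem skeleton_connected_of {D : AbstractSimplicialComplex W} [Nonempty W]
    (h : ∀ (S : Set W) (x y : W), x ∈ S →
      (∀ u ∈ S, ∀ z, D.skeleton.Adj u z → z ∈ S) → y ∈ S) : D.skeleton.Connected :=
  ⟨fun x y => h {z | D.skeleton.Reachable x z} x y (SimpleGraph.Reachable.refl _)
    fun _ hu _ hz => hu.trans hz.reachable⟩

/-- The vertices of the members of `N`. -/
def genVerts (N : Finset (Finset W)) : Set W := {w | ∃ s ∈ N, w ∈ s}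

/-- The type of vertices of the members of `N`. -/
structure GenVert (N : Finset (Finset W)) where
  /-- the underlying vertex -/
  val : W
  mem : val ∈ genVerts N

theorem GenVert.val_injective {N : Finset (Finset W)} :
    Function.Injective (GenVert.val : GenVert N → W)
  | ⟨_, _⟩, ⟨_, _⟩, rfl => rfl

/-- The inclusion of the vertices. -/
def GenVert.emb {N : Finset (Finset W)} : GenVert N ↪ W := ⟨GenVert.val, GenVert.val_injective⟩

@[simp] theorem GenVert.emb_apply {N : Finset (Finset W)} (p : GenVert N) :
    GenVert.emb p = p.val := rfl

/-- The complex generated by the members of `N`. -/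
def gen (N : Finset (Finset W)) : AbstractSimplicialComplex (GenVert N) where
  faces := {s | s.Nonempty ∧ ∃ r ∈ N, s.map GenVert.emb ⊆ r}
  isRelLowerSet_faces := by
    rintro s ⟨hs, r, hr, hsr⟩
    exact ⟨hs, fun t hts ht => ⟨ht, r, hr, (Finset.map_subset_map.2 hts).trans hsr⟩⟩
  singleton_mem v := ⟨Finset.singleton_nonempty _, by
    obtain ⟨s, hs, hv⟩ := v.2
    exact ⟨s, hs, by simpa using hv⟩⟩

section gen

variable {N : Finset (Finset W)}

theorem GenVert.exists_map_eq [Finite W] {r : Finset W} (hr : r ∈ N) :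
    ∃ r' : Finset (GenVert N), r'.map GenVert.emb = r := by
  have : Finite (GenVert N) := Finite.of_injective _ GenVert.val_injective
  have := Fintype.ofFinite (GenVert N)
  refine ⟨Finset.univ.filter fun w => w.val ∈ r, ?_⟩
  ext x
  simp only [Finset.mem_map, Finset.mem_filter, Finset.mem_univ, true_and, GenVert.emb_apply]
  exact ⟨fun ⟨w, hw, hx⟩ => hx ▸ hw, fun hx => ⟨⟨x, r, hr, hx⟩, hx, rfl⟩⟩

theorem GenVert.map_pair (p q : GenVert N) :
    ({p, q} : Finset (GenVert N)).map GenVert.emb = {p.val, q.val} := by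
  simp [Finset.map_insert]

theorem mem_triangles_gen (hN : ∀ r ∈ N, r.card = 3) {s : Finset (GenVert N)} :
    s ∈ (gen N).triangles ↔ s.map GenVert.emb ∈ N := by
  constructor
  · rintro ⟨⟨-, r, hr, hsr⟩, h3⟩
    rwa [Finset.eq_of_subset_of_card_le hsr (by rw [hN r hr, Finset.card_map, h3])]
  · intro h
    have h3 := hN _ h
    rw [Finset.card_map] at h3
    exact ⟨⟨Finset.card_pos.1 (by omega), _, h, subset_rfl⟩, h3⟩

theorem tri_gen (hN : ∀ r ∈ N, r.card = 3) {p q r : GenVert N} :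
    (gen N).Tri p q r ↔ ({p.1, q.1, r.1} : Finset W) ∈ N := by
  have h : (({p, q, r} : Finset (GenVert N)).map GenVert.emb) =
      {p.1, q.1, r.1} := by
    ext x
    simp only [Finset.mem_map, Finset.mem_insert, Finset.mem_singleton]
    constructor
    · rintro ⟨y, rfl | rfl | rfl, rfl⟩ <;> simp [-Finset.mem_map]
    · rintro (rfl | rfl | rfl)
      · exact ⟨p, by simp⟩
      · exact ⟨q, by simp⟩
      · exact ⟨r, by simp⟩
  rw [← h, ← mem_triangles_gen hN]
  exact ⟨Tri.mem_triangles, tri_of_mem⟩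

theorem adj_gen {p q : GenVert N} :
    (gen N).skeleton.Adj p q ↔ p.1 ≠ q.1 ∧ ∃ r ∈ N, p.1 ∈ r ∧ q.1 ∈ r := by
  have h : (({p, q} : Finset (GenVert N)).map GenVert.emb) =
      {p.1, q.1} := by
    ext x
    simp only [Finset.mem_map, Finset.mem_insert, Finset.mem_singleton]
    constructor
    · rintro ⟨y, rfl | rfl, rfl⟩ <;> simp [-Finset.mem_map]
    · rintro (rfl | rfl)
      · exact ⟨p, by simp⟩
      · exact ⟨q, by simp⟩
  constructor
  · rintro ⟨h1, -, r, hr, h2⟩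
    refine ⟨fun h => h1 (GenVert.val_injective h), r, hr, ?_⟩
    rw [h, Finset.insert_subset_iff, Finset.singleton_subset_iff] at h2
    exact h2
  · rintro ⟨h1, r, hr, h2⟩
    refine ⟨fun h => h1 (congrArg _ h), by simp, r, hr, ?_⟩
    rw [h, Finset.insert_subset_iff, Finset.singleton_subset_iff]
    exact h2

end gen

/-- `P` is a set of triangles of `D` that is bounded by the three edges in `s`, while `s` is not
itself a triangle of `D`. -/
structure Patch (D : AbstractSimplicialComplex W) (s : Finset W) (P : Finset (Finset W)) :
    Prop where
  card_eq : s.card = 3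
  adj : ∀ p ∈ s, ∀ q ∈ s, p ≠ q → D.skeleton.Adj p q
  notMem : s ∉ D
  triangles : ∀ r ∈ P, r ∈ D.triangles
  odd_iff : ∀ e ∈ D.edges, (e ⊆ s ↔ Odd (cnt P e))

variable [Fintype W]

/-- The result of replacing the triangles in `P` by the triangle `s`. -/
noncomputable def patched (D : AbstractSimplicialComplex W) (s : Finset W)
    (P : Finset (Finset W)) : Finset (Finset W) := insert s (D.triFinset \ P)

variable {D : AbstractSimplicialComplex W} {s : Finset W} {P : Finset (Finset W)}

/-- The three edges of the rim form a cycle modulo 2, which bounds in a disc. -/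
theorem IsDisc.exists_patch (hD : D.IsDisc) (hs : s.card = 3)
    (hadj : ∀ p ∈ s, ∀ q ∈ s, p ≠ q → D.skeleton.Adj p q) (hsD : s ∉ D) :
    ∃ P, D.Patch s P := by
  obtain ⟨v, -⟩ := Finset.card_pos.1 (show 0 < s.card by omega)
  obtain ⟨P, hP, hP'⟩ := hD.cycle_bounds v (z := {e ∈ D.edgeFinset | e ⊆ s})
    (Finset.filter_subset _ _) (by
      intro w _
      rw [degIn_eq_card (by
        intro e he
        simp only [Finset.mem_filter, mem_edgeFinset] at he
        exact he.1.2)]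
      by_cases hw : w ∈ s
      · have : (Finset.univ.filter fun x => x ≠ w ∧
            ({w, x} : Finset W) ∈ ({e ∈ D.edgeFinset | e ⊆ s} : Finset (Finset W))) =
            s.erase w := by
          ext x
          simp only [Finset.mem_filter, Finset.mem_univ, true_and, mem_edgeFinset,
            mem_edges_pair, Finset.insert_subset_iff, Finset.singleton_subset_iff,
            Finset.mem_erase]
          constructor
          · rintro ⟨h1, -, -, h2⟩
            exact ⟨h1, h2⟩
          · rintro ⟨h1, h2⟩
            exact ⟨h1, hadj w hw x h2 h1.symm, hw, h2⟩
        rw [this, Finset.card_erase_of_mem hw, hs]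
        exact even_two
      · have : (Finset.univ.filter fun x => x ≠ w ∧
            ({w, x} : Finset W) ∈ ({e ∈ D.edgeFinset | e ⊆ s} : Finset (Finset W))) = ∅ := by
          rw [Finset.filter_eq_empty_iff]
          rintro x - ⟨-, h⟩
          simp only [Finset.mem_filter, Finset.insert_subset_iff] at h
          exact hw h.2.1
        rw [this]
        exact Even.zero)
  exact ⟨P, hs, hadj, hsD, fun r hr => by simpa using hP hr, fun e he => by
    rw [← hP' e he]
    simp [he]⟩

namespace Patch

variable (h : D.Patch s P)

include h

theorem card_patched : ∀ r ∈ patched D s P, r.card = 3 := by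
  intro r hr
  simp only [patched, Finset.mem_insert, Finset.mem_sdiff, mem_triFinset] at hr
  rcases hr with rfl | hr
  · exact h.card_eq
  · exact hr.1.2

omit h in
theorem mem_patched_iff {p q r : W} : {p, q, r} ∈ patched D s P ↔
    {p, q, r} = s ∨ (D.Tri p q r ∧ {p, q, r} ∉ P) := by
  simp only [patched, Finset.mem_insert, Finset.mem_sdiff, mem_triFinset]
  exact or_congr Iff.rfl (and_congr_left fun _ => ⟨tri_of_mem, Tri.mem_triangles⟩)

omit [Fintype W] in
/-- The cofaces of an edge not in the rim are either all in `P` or all outside `P`. -/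
theorem mem_of_mem (hD : D.IsSurface) {p q r r' : W} (hpq : ¬ ({p, q} : Finset W) ⊆ s)
    (hr : D.Tri p q r) (hr' : D.Tri p q r') (hP : {p, q, r} ∈ P) : {p, q, r'} ∈ P := by
  have h1 := mt (h.odd_iff _ (mem_edges_pair.2 hr.adj)).2 hpq
  rw [Nat.not_odd_iff_even] at h1
  have h2 := cnt_pos_of_mem hP
  have h3 := hD.cnt_le_two h.triangles hr.1
  refine hD.mem_of_cnt_eq_two h.triangles hr' ?_
  obtain ⟨m, hm⟩ := h1
  omega

omit [Fintype W] in
theorem exists_third {p q : W} (hpq : p ≠ q) (hs : {p, q} ⊆ s) : ∃ r, s = {p, q, r} ∧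
    p ≠ r ∧ q ≠ r := by
  have h1 : (s \ {p, q}).card = 1 := by
    rw [Finset.card_sdiff_of_subset hs, h.card_eq, Finset.card_pair hpq]
  obtain ⟨c, hc⟩ := Finset.card_eq_one.1 h1
  have hc' : c ∈ s \ {p, q} := by rw [hc]; simp
  simp only [Finset.mem_sdiff, Finset.mem_insert, Finset.mem_singleton, not_or] at hc'
  refine ⟨c, ?_, fun h => hc'.2.1 h.symm, fun h => hc'.2.2 h.symm⟩
  rw [← Finset.sdiff_union_of_subset hs, hc]
  ext x; simp; tauto

omit h in
theorem subset_genVerts {w : W} (hw : w ∈ s) : w ∈ genVerts (patched D s P) :=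
  ⟨s, by simp [patched], hw⟩

/-- Outside the rim, a vertex is in no triangle of `P` or only in triangles of `P`. -/
theorem star_notMem (hD : D.IsSurface) {w : W} (hw : w ∈ genVerts (patched D s P))
    (hws : w ∉ s) {p q : W} (hpq : D.Tri w p q) : {w, p, q} ∉ P := by
  obtain ⟨r, hr, hwr⟩ := hw
  simp only [patched, Finset.mem_insert, Finset.mem_sdiff, mem_triFinset] at hr
  rcases hr with rfl | ⟨hr, hrP⟩
  · exact absurd hwr hws
  obtain ⟨x, y, hxy, rfl⟩ := exists_tri_of_mem hr hwr
  have hnot : ∀ x, ¬ ({w, x} : Finset W) ⊆ s := fun x hx => hws (hx (by simp))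
  have := hD.all_mem_of_star (R := D.triFinset \ P) hxy (by simp [hr, hrP]) (by
    intro u c d hc hd hmem
    rw [Finset.mem_sdiff, mem_triFinset] at hmem ⊢
    exact ⟨hd.mem_triangles, fun h' => hmem.2 (h.mem_of_mem hD (hnot u) hd hc h')⟩) hpq
  rw [Finset.mem_sdiff] at this
  exact this.2

theorem tri_star (hD : D.IsSurface) {w : W} (hw : w ∈ genVerts (patched D s P))
    (hws : w ∉ s) {p q : W} (hpq : D.Tri w p q) : {w, p, q} ∈ patched D s P :=
  mem_patched_iff.2 (Or.inr ⟨hpq, h.star_notMem hD hw hws hpq⟩)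

theorem adj_of_adj_gen {p q : GenVert (patched D s P)}
    (hpq : (gen (patched D s P)).skeleton.Adj p q) : D.skeleton.Adj p.val q.val := by
  obtain ⟨hne, r, hr, hp, hq⟩ := adj_gen.1 hpq
  simp only [patched, Finset.mem_insert, Finset.mem_sdiff, mem_triFinset] at hr
  rcases hr with rfl | ⟨hr, -⟩
  · exact h.adj _ hp _ hq hne
  · obtain ⟨c, hc, -⟩ := exists_apex_of_subset hr hne
      (by simp [Finset.insert_subset_iff, hp, hq])
    exact hc.adj

omit h in
theorem adj_gen_of_subset {p q : GenVert (patched D s P)} (hpq : p.1 ≠ q.1)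
    (hs : ({p.1, q.1} : Finset W) ⊆ s) : (gen (patched D s P)).skeleton.Adj p q :=
  adj_gen.2 ⟨hpq, s, by simp [patched], hs (by simp), hs (by simp)⟩

/-- An edge of the patched complex not in the rim is in no triangle of `P`. -/
theorem notMem_of_adj_gen (hD : D.IsSurface) {p q : GenVert (patched D s P)}
    (hpq : (gen (patched D s P)).skeleton.Adj p q) (hs : ¬ ({p.1, q.1} : Finset W) ⊆ s) {r : W}
    (hr : D.Tri p.1 q.1 r) : {p.1, q.1, r} ∉ P := by
  obtain ⟨hne, t, ht, hp, hq⟩ := adj_gen.1 hpq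
  have hsub : ({p.1, q.1} : Finset W) ⊆ t := by simp [Finset.insert_subset_iff, hp, hq]
  simp only [patched, Finset.mem_insert, Finset.mem_sdiff, mem_triFinset] at ht
  rcases ht with rfl | ⟨ht, htP⟩
  · exact absurd hsub hs
  · obtain ⟨c, hc, rfl⟩ := exists_apex_of_subset ht hne hsub
    exact fun h' => htP (h.mem_of_mem hD hs hr hc h')

theorem image_apexes {p q : GenVert (patched D s P)} :
    GenVert.val '' {r | (gen (patched D s P)).Tri p q r} =
      {r | {p.1, q.1, r} ∈ patched D s P} := by
  ext r
  constructor
  · rintro ⟨r, hr, rfl⟩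
    exact (tri_gen h.card_patched).1 hr
  · intro hr
    exact ⟨⟨r, _, hr, by simp⟩, (tri_gen h.card_patched).2 hr, rfl⟩

/-- A rim edge loses its only coface in `P` and gains `s`, which is new since it is not in `D`. Any
other surviving edge has no coface in `P`. -/
theorem cofaceCount_eq (hD : D.IsSurface) {p q : GenVert (patched D s P)}
    (hpq : (gen (patched D s P)).skeleton.Adj p q) :
    (gen (patched D s P)).cofaceCount {p, q} = D.cofaceCount {p.1, q.1} := by
  have hpq' := h.adj_of_adj_gen hpq
  rw [cofaceCount_pair _ hpq.1, cofaceCount_pair _ hpq'.1,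
    ← Set.ncard_image_of_injective _ GenVert.val_injective, h.image_apexes]
  by_cases hs : ({p.1, q.1} : Finset W) ⊆ s
  · obtain ⟨r, hr, hpr, hqr⟩ := h.exists_third hpq'.1 hs
    have hodd := (h.odd_iff _ (mem_edges_pair.2 hpq')).1 hs
    obtain ⟨d, hd, hd'⟩ := exists_mem_of_cnt_pos h.triangles hpq'.1 hodd.pos
    have h1 : cnt P {p.1, q.1} = 1 := by
      have := hD.cnt_le_two h.triangles hpq'.1
      obtain ⟨m, hm⟩ := hodd
      omega
    have hA : {x | {p.1, q.1, x} ∈ patched D s P} =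
        insert r {x | D.Tri p.1 q.1 x ∧ {p.1, q.1, x} ∉ P} := by
      ext x
      simp only [mem_patched_iff, Set.mem_ofPred_eq, Set.mem_insert_iff]
      refine or_congr ⟨fun hx => ?_, fun hx => by subst hx; exact hr.symm⟩ Iff.rfl
      exact (eq_of_triple_eq hpr.symm hqr.symm (hx.trans hr).symm).symm
    have hB : {x | D.Tri p.1 q.1 x} =
        insert d {x | D.Tri p.1 q.1 x ∧ {p.1, q.1, x} ∉ P} := by
      ext x
      simp only [Set.mem_ofPred_eq, Set.mem_insert_iff]
      constructor
      · intro hx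
        by_cases hxP : {p.1, q.1, x} ∈ P
        · exact Or.inl (eq_of_cnt_eq_one hx h1 hxP hd)
        · exact Or.inr ⟨hx, hxP⟩
      · rintro (rfl | hx)
        · exact hd'
        · exact hx.1
    rw [hA, hB, Set.ncard_insert_of_notMem, Set.ncard_insert_of_notMem]
    · exact fun h' => h'.2 hd
    · exact fun h' => h.notMem (hr ▸ h'.1.2.2.2)
  · congr 1
    ext x
    simp only [mem_patched_iff, Set.mem_ofPred_eq]
    constructor
    · rintro (hx | hx)
      · have hsub : ({p.1, q.1} : Finset W) ⊆ {p.1, q.1, x} := by intro y; simp; tauto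
        exact absurd (hsub.trans hx.subset) hs
      · exact hx.1
    · exact fun hx => Or.inr ⟨hx, h.notMem_of_adj_gen hD hpq hs hx⟩

/-- Coface numbers are preserved, so the point is that no boundary edge is lost: off the rim an edge
with a coface in `P` has two cofaces there, hence is not a boundary edge. -/
theorem mem_boundaryEdges_iff (hD : D.IsSurface) {p q : W} :
    ({p, q} : Finset W) ∈ D.boundaryEdges ↔ ∃ p' q' : GenVert (patched D s P),
      ({p', q'} : Finset (GenVert (patched D s P))) ∈ (gen (patched D s P)).boundaryEdges ∧
        p'.1 = p ∧ q'.1 = q := by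
  constructor
  · rintro ⟨h1, h2⟩
    have hpq := mem_edges_pair.1 h1
    have key : ∃ r ∈ patched D s P, p ∈ r ∧ q ∈ r := by
      by_cases hs : ({p, q} : Finset W) ⊆ s
      · exact ⟨s, by simp [patched], hs (by simp), hs (by simp)⟩
      · obtain ⟨c, hc⟩ := hD.exists_tri hpq
        refine ⟨{p, q, c}, mem_patched_iff.2 (Or.inr ⟨hc, fun hP => ?_⟩), by simp, by simp⟩
        have h3 := mt (h.odd_iff _ h1).2 hs
        rw [Nat.not_odd_iff_even] at h3
        have h4 := cnt_pos_of_mem hP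
        obtain ⟨x, y, hxy, -, hx, -, hy⟩ := exists_two_of_one_lt_cnt h.triangles hpq.1
          (show 1 < cnt P {p, q} by
            obtain ⟨m, hm⟩ := h3
            omega)
        rw [cofaceCount_pair D hpq.1] at h2
        obtain ⟨u, hu⟩ := Set.ncard_eq_one.1 h2
        have h5 : x ∈ ({u} : Set W) := hu ▸ hx
        have h6 : y ∈ ({u} : Set W) := hu ▸ hy
        exact hxy (h5.trans h6.symm)
    obtain ⟨r, hr, hp, hq⟩ := key
    have hadj : (gen (patched D s P)).skeleton.Adj ⟨p, r, hr, hp⟩ ⟨q, r, hr, hq⟩ :=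
      adj_gen.2 ⟨hpq.1, r, hr, hp, hq⟩
    exact ⟨_, _, ⟨mem_edges_pair.2 hadj, (h.cofaceCount_eq hD hadj).trans h2⟩, rfl, rfl⟩
  · rintro ⟨p', q', ⟨h1, h2⟩, rfl, rfl⟩
    have hadj := mem_edges_pair.1 h1
    exact ⟨mem_edges_pair.2 (h.adj_of_adj_gen hadj), (h.cofaceCount_eq hD hadj).symm.trans h2⟩

/-- Both connectedness claims compare with `D`: a closed set that avoids the rim meets no triangle
of `P`, so it is closed in `D` as well and must be everything. Hence every nonempty closed set
contains a chosen rim vertex, and applying this to a closed set and to its complement shows that one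
of them is empty. -/
theorem isSurface_gen (hD : D.IsSurface) : (gen (patched D s P)).IsSurface where
  finite := Finite.of_injective _ GenVert.val_injective
  card_le_three := by
    rintro r ⟨-, t, ht, hrt⟩
    have := Finset.card_le_card hrt
    rwa [Finset.card_map, h.card_patched t ht] at this
  edge_cofaces := by
    intro e he
    obtain ⟨p, q, hpq, rfl⟩ := exists_adj_of_mem_edges he
    rw [h.cofaceCount_eq hD hpq]
    exact hD.edge_cofaces _ (mem_edges_pair.2 (h.adj_of_adj_gen hpq))
  link_connected := by
    intro w
    refine linkGraph_connected_of ?_ ?_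
    · obtain ⟨r, hr, hw⟩ := w.2
      obtain ⟨x, hx, hne⟩ := Finset.exists_mem_ne
        (show 1 < r.card by rw [h.card_patched r hr]; norm_num) w.1
      exact ⟨⟨x, r, hr, hx⟩, adj_gen.2 ⟨hne.symm, r, hr, hw, hx⟩⟩
    · intro S x y hx hy hxS hS
      by_cases hw : w.1 ∈ s
      · obtain ⟨p, hp, hne⟩ := Finset.exists_mem_ne
          (show 1 < s.card by rw [h.card_eq]; norm_num) w.1
        obtain ⟨q, hq, hwq, hpq⟩ := h.exists_third hne.symm (show {w.1, p} ⊆ s by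
          simp [Finset.insert_subset_iff, hw, hp])
        have hqs : q ∈ s := by rw [hq]; simp
        set p' : GenVert (patched D s P) := ⟨p, subset_genVerts hp⟩ with hp'
        set q' : GenVert (patched D s P) := ⟨q, subset_genVerts hqs⟩ with hq'
        have htri : (gen (patched D s P)).Tri w p' q' := (tri_gen h.card_patched).2
          (mem_patched_iff.2 (Or.inl hq.symm))
        have key : ∀ S : Set (GenVert (patched D s P)), ∀ x, x ∈ S →
            (gen (patched D s P)).skeleton.Adj w x →
            (∀ u ∈ S, ∀ z, (gen (patched D s P)).Tri w u z → z ∈ S) → p' ∈ S := by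
          intro S x hxS hx hS
          by_contra hpS
          -- The new triangle joins `p'` and `q'` in the link of `w`, so a closed set avoiding one
          -- avoids both.
          have hqS : q' ∉ S := fun hqS => hpS (hS q' hqS p' htri.swap')
          have := hD.link_induction
            {u | ∃ hu : u ∈ genVerts (patched D s P), (⟨u, hu⟩ : GenVert _) ∈ S ∧
              (gen (patched D s P)).skeleton.Adj w ⟨u, hu⟩} (w := w.1) (x := x.1)
            ⟨x.2, hxS, hx⟩ (h.adj_of_adj_gen hx) (by
              rintro u ⟨hu, huS, hadj⟩ z hz
              have hnot : ¬ ({w.1, u} : Finset W) ⊆ s := by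
                intro hsub
                have hus : u ∈ s := hsub (by simp)
                rw [hq] at hus
                simp only [Finset.mem_insert, Finset.mem_singleton] at hus
                rcases hus with rfl | rfl | rfl
                · exact hz.1 rfl
                · exact hpS huS
                · exact hqS huS
              have hmem : {w.1, u, z} ∈ patched D s P := mem_patched_iff.2
                (Or.inr ⟨hz, h.notMem_of_adj_gen hD hadj hnot hz⟩)
              have hz' : (gen (patched D s P)).Tri w ⟨u, hu⟩ ⟨z, _, hmem, by simp⟩ :=
                (tri_gen h.card_patched).2 hmem
              exact ⟨_, hS _ huS _ hz', hz'.adj₁₃⟩)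
            (h.adj w.1 hw p hp hne.symm)
          obtain ⟨_, h', -⟩ := this
          exact hpS h'
        by_contra hyS
        exact key Sᶜ y hyS hy (fun u hu z hz hzS => hu (hS z hzS u hz.swap'))
          (key S x hxS hx hS)
      · have := hD.link_induction
          {u | ∃ hu : u ∈ genVerts (patched D s P), (⟨u, hu⟩ : GenVert _) ∈ S} (w := w.1)
          (x := x.1) ⟨x.2, hxS⟩ (h.adj_of_adj_gen hx) (by
            rintro u ⟨hu, huS⟩ z hz
            have hmem := h.tri_star hD w.2 hw hz
            have hz' : (gen (patched D s P)).Tri w ⟨u, hu⟩ ⟨z, _, hmem, by simp⟩ :=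
              (tri_gen h.card_patched).2 hmem
            exact ⟨_, hS _ huS _ hz'⟩) (h.adj_of_adj_gen hy)
        obtain ⟨_, h'⟩ := this
        exact h'
  connected := by
    obtain ⟨a, ha⟩ := Finset.card_pos.1 (show 0 < s.card by rw [h.card_eq]; norm_num)
    set a' : GenVert (patched D s P) := ⟨a, subset_genVerts ha⟩ with ha'
    have : Nonempty (GenVert (patched D s P)) := ⟨a'⟩
    refine skeleton_connected_of ?_
    have key : ∀ S : Set (GenVert (patched D s P)), ∀ x, x ∈ S →
        (∀ u ∈ S, ∀ z, (gen (patched D s P)).skeleton.Adj u z → z ∈ S) → a' ∈ S := by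
      intro S x hxS hS
      by_contra haS
      have := hD.vertex_induction
        {u | ∃ hu : u ∈ genVerts (patched D s P), (⟨u, hu⟩ : GenVert _) ∈ S} (x := x.1)
        ⟨x.2, hxS⟩ (by
          rintro u ⟨hu, huS⟩ z hz
          have hus : u ∉ s := by
            intro hus
            by_cases hua : u = a
            · subst hua
              exact haS huS
            · exact haS (hS _ huS _ (adj_gen_of_subset hua
                (by simpa [Finset.insert_subset_iff, hus] using ha)))
          obtain ⟨c, hc⟩ := hD.exists_tri hz
          have hmem := h.tri_star hD hu hus hc
          exact ⟨⟨_, hmem, by simp⟩, hS _ huS _ (adj_gen.2 ⟨hz.1, _, hmem, by simp, by simp⟩)⟩) a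
      obtain ⟨_, h'⟩ := this
      exact haS h'
    intro S x y hxS hS
    by_contra hyS
    exact key Sᶜ y hyS (fun u hu z hz hzS => hu (hS z hzS u hz.symm)) (key S x hxS hS)
  boundary_nonempty := by
    obtain ⟨e, he⟩ := hD.boundary_nonempty
    obtain ⟨p, q, -, rfl⟩ := exists_adj_of_mem_edges he.1
    obtain ⟨p', q', h', -⟩ := (h.mem_boundaryEdges_iff hD).1 he
    exact ⟨_, h'⟩

end Patch

end
end AbstractSimplicialComplex

/-! ### The patched complex is a disc of smaller area and still a filling -/

namespace AbstractSimplicialComplex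

section
open scoped Classical

variable {W : Type*} [Fintype W] {D : AbstractSimplicialComplex W} {s : Finset W}
  {P : Finset (Finset W)}

namespace Patch

variable (h : D.Patch s P)

include h

omit [Fintype W] in
/-- The only nonempty cycle in the rim is the whole rim. -/
theorem eq_empty_or_of_even {y : Finset (Finset W)} (hy : ∀ e ∈ y, e ∈ D.edges)
    (hys : ∀ e ∈ y, e ⊆ s) (hev : ∀ w, Even (degIn y w)) :
    y = ∅ ∨ ∀ e ∈ D.edges, e ⊆ s → e ∈ y := by
  rcases y.eq_empty_or_nonempty with h0 | ⟨e, he⟩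
  · exact Or.inl h0
  right
  have key : ∀ p q r, s = {p, q, r} → q ≠ r → p ≠ q → p ≠ r →
      (({p, q} : Finset W) ∈ y ↔ {p, r} ∈ y) := by
    intro p q r hs hqr hpq hpr
    refine (even_degIn_iff (w := p) (fun h' => hqr (eq_of_pair_eq h' hpq.symm)) (by simp)
      (by simp) ?_).1 (hev p)
    intro g hg hpg
    obtain ⟨x, hx, rfl⟩ := exists_adj_of_mem_edge (hy g hg) hpg
    have hxs : x ∈ s := hys _ hg (by simp)
    rw [hs] at hxs
    simp only [Finset.mem_insert, Finset.mem_singleton] at hxs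
    rcases hxs with rfl | rfl | rfl
    · exact absurd rfl hx.1
    · exact Or.inl rfl
    · exact Or.inr rfl
  obtain ⟨p, q, hpq, rfl⟩ := exists_adj_of_mem_edges (hy e he)
  obtain ⟨r, hs, hpr, hqr⟩ := h.exists_third hpq.1 (hys _ he)
  have h1 := (key p q r hs hqr hpq.1 hpr).1 he
  have h2 := (key q p r (by rw [hs, Finset.insert_comm]) hpr hpq.1.symm hqr).1
    (by rwa [Finset.pair_comm])
  intro f hf hfs
  obtain ⟨x, z, hxz, rfl⟩ := exists_adj_of_mem_edges hf
  have hx := hfs (show x ∈ ({x, z} : Finset W) by simp)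
  have hz := hfs (show z ∈ ({x, z} : Finset W) by simp)
  have hne := hxz.1
  rw [hs] at hx hz
  simp only [Finset.mem_insert, Finset.mem_singleton] at hx hz
  have h3 := he
  have h4 := h1
  have h5 := h2
  rw [Finset.pair_comm] at h3 h4 h5
  rcases hx with rfl | rfl | rfl <;> rcases hz with rfl | rfl | rfl <;>
    first | assumption | exact absurd rfl hne

/-- The boundary of `R ∩ P` lies in the rim, so it is empty or the whole rim. In the first case `R ∩
P` has no boundary; in the second `P \ R` has none. A set of triangles without boundary is empty. -/
theorem inter_eq_empty_or_subset (hD : D.IsSurface) {R : Finset (Finset W)}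
    (hR : ∀ r ∈ R, r ∈ D.triangles)
    (hev : ∀ e ∈ D.edges, ¬ e ⊆ s → 0 < cnt P e → Even (cnt R e)) :
    R ∩ P = ∅ ∨ P ⊆ R := by
  have hRP : ∀ r ∈ R ∩ P, r ∈ D.triangles := fun r hr => hR r (Finset.mem_inter.1 hr).1
  have hout : ∀ e ∈ D.edges, ¬ e ⊆ s → Even (cnt (R ∩ P) e) := by
    intro e he hes
    have h1 := mt (h.odd_iff e he).2 hes
    rw [Nat.not_odd_iff_even] at h1
    rcases Nat.eq_zero_or_pos (cnt P e) with h0 | h0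
    · have := cnt_mono (Finset.inter_subset_right : R ∩ P ⊆ P) e
      rw [Nat.le_zero.1 (this.trans h0.le)]
      exact Even.zero
    · obtain ⟨p, q, hpq, rfl⟩ := exists_adj_of_mem_edges he
      have h2 := hev _ he hes h0
      have h3 := hD.cnt_le_two (R := R \ P ∪ P) (fun r hr => (Finset.mem_union.1 hr).elim
        (fun h' => hR r (Finset.mem_sdiff.1 h').1) (h.triangles r)) hpq.1
      rw [cnt_union Finset.sdiff_disjoint] at h3
      have h4 := cnt_sdiff_add R P {p, q}
      have h5 : cnt (R ∩ P) {p, q} = cnt R {p, q} := by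
        obtain ⟨m, hm⟩ := h1
        omega
      rwa [h5]
  rcases h.eq_empty_or_of_even (y := {e ∈ D.edgeFinset | Odd (cnt (R ∩ P) e)})
    (by
      intro e he
      simp only [Finset.mem_filter, mem_edgeFinset] at he
      exact he.1)
    (by
      intro e he
      simp only [Finset.mem_filter, mem_edgeFinset] at he
      by_contra hes
      exact Nat.not_even_iff_odd.2 he.2 (hout e he.1 hes))
    (fun w => even_degIn_boundary hRP (fun e he => by simpa using he)
      (fun x hx => by simpa using mem_edges_pair.2 hx)) with h0 | hall
  · left
    refine hD.eq_empty_of_even_cnt hRP fun e he => ?_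
    rw [Finset.filter_eq_empty_iff] at h0
    exact Nat.not_odd_iff_even.1 (h0 (by simpa using he))
  · right
    rw [← Finset.sdiff_eq_empty_iff_subset]
    refine hD.eq_empty_of_even_cnt (fun r hr => h.triangles r (Finset.mem_sdiff.1 hr).1)
      fun e he => ?_
    have h1 := cnt_sdiff_add P R e
    rw [Finset.inter_comm] at h1
    by_cases hes : e ⊆ s
    · have h2 := (h.odd_iff e he).1 hes
      have h3 := (Finset.mem_filter.1 (hall e he hes)).2
      rw [← h1, Nat.odd_add] at h2
      by_contra h4
      exact Nat.not_odd_iff_even.2 (h2.1 (Nat.not_even_iff_odd.1 h4)) h3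
    · have h2 := mt (h.odd_iff e he).2 hes
      rw [Nat.not_odd_iff_even, ← h1, Nat.even_add] at h2
      exact h2.2 (hout e he hes)

/-- The Euler characteristic is obtained by showing that cycles bound. A cycle of the patched
complex is filled by some `R` in `D`; it uses no edge in the inside of `P`, so `R` contains all of
`P` or none of it, and in the former case `P` is exchanged for `s`. -/
theorem isDisc_gen (hD : D.IsDisc) : (gen (patched D s P)).IsDisc := by
  have hS := hD.isSurface
  have hG := h.isSurface_gen hS
  set N := patched D s P with hN
  have : Finite (GenVert N) := hG.finite
  have := Fintype.ofFinite (GenVert N)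
  obtain ⟨a, ha⟩ := Finset.card_pos.1 (show 0 < s.card by rw [h.card_eq]; norm_num)
  set a' : GenVert N := ⟨a, subset_genVerts ha⟩ with ha'
  refine ⟨hG.finite, hG.card_le_three, hG.edge_cofaces, hG.link_connected, hG.connected,
    hG.boundary_nonempty, hG.euler_char_of_cycles_bound a' ?_⟩
  intro z hz hz'
  set z₀ : Finset (Finset W) := z.image (Finset.map GenVert.emb) with hz₀
  have hz₀' : ∀ e' : Finset (GenVert N), e'.map GenVert.emb ∈ z₀ ↔ e' ∈ z := by
    intro e'
    rw [hz₀, Finset.mem_image]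
    exact ⟨fun ⟨f, hf, hfe⟩ => Finset.map_injective _ hfe ▸ hf, fun h' => ⟨e', h', rfl⟩⟩
  have hz₀edge : ∀ e ∈ z₀, ∃ p q : GenVert N, (gen N).skeleton.Adj p q ∧
      e = {p.val, q.val} := by
    intro e he
    obtain ⟨e', he', rfl⟩ := Finset.mem_image.1 he
    obtain ⟨p, q, hpq, rfl⟩ := exists_adj_of_mem_edges (mem_edgeFinset.1 (hz he'))
    exact ⟨p, q, hpq, GenVert.map_pair p q⟩
  obtain ⟨R, hR, hR'⟩ := hD.cycle_bounds a (z := z₀) (by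
    intro e he
    obtain ⟨p, q, hpq, rfl⟩ := hz₀edge e he
    simpa using mem_edges_pair.2 (h.adj_of_adj_gen hpq)) (by
    intro w hw
    by_cases hwN : w ∈ genVerts N
    · have : degIn z₀ w = degIn z ⟨w, hwN⟩ := by
        unfold degIn
        rw [hz₀, Finset.filter_image, Finset.card_image_of_injective _ (Finset.map_injective _)]
        congr 1
        ext e
        simp only [Finset.mem_filter, Finset.mem_map, GenVert.emb_apply, and_congr_right_iff]
        intro _
        exact ⟨fun ⟨x, hx, hxw⟩ => by subst hxw; exact hx, fun hx => ⟨_, hx, rfl⟩⟩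
      rw [this]
      exact hz' _ fun h' => hw (congrArg GenVert.val h')
    · have : degIn z₀ w = 0 := by
        rw [degIn, Finset.card_eq_zero, Finset.filter_eq_empty_iff]
        intro e he hwe
        obtain ⟨p, q, hpq, rfl⟩ := hz₀edge e he
        simp only [Finset.mem_insert, Finset.mem_singleton] at hwe
        rcases hwe with rfl | rfl
        · exact hwN p.mem
        · exact hwN q.mem
      rw [this]
      exact Even.zero)
  have hRT : ∀ r ∈ R, r ∈ D.triangles := fun r hr => by simpa using hR hr
  have hcntP : ∀ p q : GenVert N, (gen N).skeleton.Adj p q →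
      ¬ ({p.val, q.val} : Finset W) ⊆ s → cnt P {p.val, q.val} = 0 := by
    intro p q hpq hs
    by_contra h0
    obtain ⟨c, hc, hc'⟩ := exists_mem_of_cnt_pos h.triangles (h.adj_of_adj_gen hpq).1
      (Nat.pos_of_ne_zero h0)
    exact h.notMem_of_adj_gen hS hpq hs hc' hc
  have hcases := h.inter_eq_empty_or_subset hS hRT (by
    intro e he hes hpos
    rw [← Nat.not_odd_iff_even, ← hR' e he]
    intro hez
    obtain ⟨p, q, hpq, rfl⟩ := hz₀edge e hez
    have := hcntP p q hpq hes
    omega)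
  -- Over each rim edge `s` has the same parity as `P`, and over the other remaining edges both
  -- counts vanish.
  set Z : Finset (Finset W) := if P ⊆ R then {s} else ∅ with hZ
  have hdisj : Disjoint (R \ P) Z := by
    rw [hZ]
    split_ifs
    · rw [Finset.disjoint_singleton_right]
      exact fun h' => h.notMem (hRT s (Finset.mem_sdiff.1 h').1).1
    · exact Finset.disjoint_empty_right _
  have hNR : R \ P ∪ Z ⊆ N := by
    intro r hr
    rw [hN, patched, Finset.mem_insert, Finset.mem_sdiff]
    rcases Finset.mem_union.1 hr with hr | hr
    · rw [Finset.mem_sdiff] at hr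
      exact Or.inr ⟨hR hr.1, hr.2⟩
    · rw [hZ] at hr
      split_ifs at hr
      · exact Or.inl (by simpa using hr)
      · simp at hr
  refine ⟨Finset.univ.filter fun r => r.map GenVert.emb ∈ R \ P ∪ Z, ?_, ?_⟩
  · intro r hr
    rw [Finset.mem_filter] at hr
    rw [mem_triFinset, mem_triangles_gen h.card_patched]
    exact hNR hr.2
  · intro e he
    obtain ⟨p, q, hpq, rfl⟩ := exists_adj_of_mem_edges he
    have hpq' := h.adj_of_adj_gen hpq
    have hcnt : cnt (Finset.univ.filter fun r => r.map GenVert.emb ∈ R \ P ∪ Z) {p, q} =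
        cnt (R \ P ∪ Z) {p.val, q.val} := by
      unfold cnt
      refine Finset.card_bij (fun r _ => r.map GenVert.emb) ?_ ?_ ?_
      · intro r hr
        simp only [Finset.mem_filter, Finset.mem_univ, true_and] at hr ⊢
        refine ⟨hr.1, ?_⟩
        rw [← GenVert.map_pair]
        exact Finset.map_subset_map.2 hr.2
      · intro r _ r' _ hrr
        exact Finset.map_injective _ hrr
      · intro r hr
        rw [Finset.mem_filter] at hr
        obtain ⟨r', rfl⟩ := GenVert.exists_map_eq (hNR hr.1)
        refine ⟨r', ?_, rfl⟩
        simp only [Finset.mem_filter, Finset.mem_univ, true_and]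
        refine ⟨hr.1, ?_⟩
        rw [← GenVert.map_pair] at hr
        exact Finset.map_subset_map.1 hr.2
    rw [hcnt, ← hz₀', GenVert.map_pair, hR' _ (mem_edges_pair.2 hpq'), cnt_union hdisj,
      ← cnt_sdiff_add R P {p.val, q.val}]
    by_cases hs : ({p.val, q.val} : Finset W) ⊆ s
    · have hodd := (h.odd_iff _ (mem_edges_pair.2 hpq')).1 hs
      by_cases hPR : P ⊆ R
      · have h1 : cnt Z {p.val, q.val} = 1 := by
          rw [hZ, if_pos hPR, cnt, Finset.filter_singleton, if_pos hs, Finset.card_singleton]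
        rw [h1, Finset.inter_eq_right.2 hPR]
        simp only [Nat.odd_add, Nat.not_even_iff_odd.2 hodd,
          Nat.not_even_iff_odd.2 odd_one]
      · have h1 : cnt Z {p.val, q.val} = 0 := by
          rw [hZ, if_neg hPR, cnt, Finset.filter_empty, Finset.card_empty]
        have h2 : cnt (R ∩ P) {p.val, q.val} = 0 := by
          rw [hcases.resolve_right hPR, cnt, Finset.filter_empty, Finset.card_empty]
        rw [h1, h2]
    · have h1 : cnt Z {p.val, q.val} = 0 := by
        rw [hZ, cnt, Finset.card_eq_zero, Finset.filter_eq_empty_iff]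
        intro r hr hsub
        split_ifs at hr
        · rw [Finset.mem_singleton] at hr
          exact hs (hr ▸ hsub)
        · simp at hr
      have h2 : cnt (R ∩ P) {p.val, q.val} = 0 := by
        have := cnt_mono (Finset.inter_subset_right : R ∩ P ⊆ P) {p.val, q.val}
        have := hcntP p q hpq hs
        omega
      rw [h1, h2]

/-- One triangle is added and at least two are removed: a single triangle of `P` containing two rim
edges would be `s`, which is not in `D`. -/
theorem area_gen_lt : (gen (patched D s P)).area < D.area := by
  set N := patched D s P with hN
  have : Finite (GenVert N) := Finite.of_injective _ GenVert.val_injective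
  have := Fintype.ofFinite (GenVert N)
  have h1 : (gen N).triFinset.card ≤ N.card := by
    refine Finset.card_le_card_of_injOn (Finset.map GenVert.emb) ?_
      (Finset.map_injective _).injOn
    intro r hr
    simp only [Finset.mem_coe, mem_triFinset] at hr
    exact (mem_triangles_gen h.card_patched).1 hr
  have h2 : N.card ≤ (D.triFinset \ P).card + 1 := Finset.card_insert_le _ _
  have h3 : P ⊆ D.triFinset := fun r hr => by simpa using h.triangles r hr
  rw [Finset.card_sdiff_of_subset h3] at h2
  have h4 := Finset.card_le_card h3
  have h5 : 1 < P.card := by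
    obtain ⟨p, q, r, hpq, hpr, hqr, hs⟩ := Finset.card_eq_three.1 h.card_eq
    have hex : ∀ x y, x ∈ s → y ∈ s → x ≠ y → ∃ c, {x, y, c} ∈ P := by
      intro x y hx hy hxy
      obtain ⟨c, hc, -⟩ := exists_mem_of_cnt_pos h.triangles hxy
        ((h.odd_iff _ (mem_edges_pair.2 (h.adj x hx y hy hxy))).1
          (by simp [Finset.insert_subset_iff, hx, hy])).pos
      exact ⟨c, hc⟩
    obtain ⟨c, hc⟩ := hex p q (by simp [hs]) (by simp [hs]) hpq
    obtain ⟨d, hd⟩ := hex p r (by simp [hs]) (by simp [hs]) hpr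
    refine Finset.one_lt_card.2 ⟨_, hc, _, hd, fun heq => ?_⟩
    have hr : r ∈ ({p, q, c} : Finset W) := by rw [heq]; simp
    simp only [Finset.mem_insert, Finset.mem_singleton] at hr
    have hrc : r = c := by
      rcases hr with h' | h' | h'
      · exact absurd h'.symm hpr
      · exact absurd h'.symm hqr
      · exact h'
    subst hrc
    exact h.notMem (hs ▸ (h.triangles _ hc).1)
  rw [area, area, ncard_triangles, ncard_triangles]
  omega

end Patch

end

section
open scoped Classical

variable {V : Type*} {X : AbstractSimplicialComplex V} {x : V} {γ : X.skeleton.Walk x x}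

/-- Flagness of `X` is what lets the map extend over the new triangle: the images of its vertices
are pairwise equal or adjacent. -/
theorem Patch.isFilling_gen {W : Type*} [Fintype W] {D : AbstractSimplicialComplex W}
    {s : Finset W} {P : Finset (Finset W)} (h : D.Patch s P) (hX : X.IsFlag) {f : W → V}
    (hf : IsFilling γ D f) :
    IsFilling γ (gen (patched D s P)) (fun w => f w.val) := by
  have hS := hf.disc.isSurface
  refine ⟨h.isDisc_gen hf.disc, ?_, ?_, ?_⟩
  · rintro r ⟨hr, t, ht, hrt⟩
    have himg : r.image (fun w => f w.val) = (r.map GenVert.emb).image f := by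
      rw [Finset.map_eq_image, Finset.image_image]
      rfl
    have himg' : (Finset.image (fun w => f w.val) r : Finset V) ∈ X := by
      rw [himg]
      have hne : (r.map GenVert.emb).Nonempty := hr.map
      simp only [patched, Finset.mem_insert, Finset.mem_sdiff, mem_triFinset] at ht
      rcases ht with rfl | ⟨ht, -⟩
      · refine hX _ (hne.image f) ?_
        intro a ha b hb hab
        obtain ⟨p, hp, rfl⟩ := Finset.mem_image.1 ha
        obtain ⟨q, hq, rfl⟩ := Finset.mem_image.1 hb
        have hpq := h.adj p (hrt hp) q (hrt hq) (fun h' => hab (congrArg f h'))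
        refine ⟨hab, ?_⟩
        have := hf.simplicial _ hpq.2
        rwa [Finset.image_insert, Finset.image_singleton] at this
      · exact hf.simplicial _ (mem_of_subset ht.1 hrt hne)
    exact himg'
  · have hb : ∀ w ∈ (gen (patched D s P)).boundaryVertices, w.val ∈ D.boundaryVertices := by
      rintro w ⟨e, he, hw⟩
      obtain ⟨y, -, rfl⟩ := exists_adj_of_mem_edge he.1 hw
      exact ⟨_, (h.mem_boundaryEdges_iff hS).2 ⟨w, y, he, rfl, rfl⟩, by simp⟩
    intro p hp q hq hpq
    exact GenVert.val_injective (hf.injOn_boundary (hb p hp) (hb q hq) hpq)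
  · intro y z
    rw [hf.boundary_edges]
    constructor
    · rintro ⟨a, b, hab, rfl, rfl⟩
      obtain ⟨p, q, hpq, rfl, rfl⟩ := (h.mem_boundaryEdges_iff hS).1 hab
      exact ⟨p, q, hpq, rfl, rfl⟩
    · rintro ⟨p, q, hpq, rfl, rfl⟩
      exact ⟨_, _, (h.mem_boundaryEdges_iff hS).2 ⟨p, q, hpq, rfl, rfl⟩, rfl, rfl⟩

/-- In a minimal filling diagram of a loop in a flag complex every 3-cycle bounds a triangle. -/
theorem IsMinimalFilling.tri_of_adj {W : Type} {D : AbstractSimplicialComplex W}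
    (hX : X.IsFlag) {f : W → V} (hD : IsMinimalFilling γ D f) {a b c : W}
    (hab : D.skeleton.Adj a b) (hac : D.skeleton.Adj a c) (hbc : D.skeleton.Adj b c) :
    D.Tri a b c := by
  refine ⟨hab.1, hac.1, hbc.1, ?_⟩
  by_contra hnot
  have := hD.disc.finite
  have := Fintype.ofFinite W
  obtain ⟨P, hP⟩ := hD.disc.exists_patch (s := {a, b, c})
    (Finset.card_eq_three.2 ⟨a, b, c, hab.1, hac.1, hbc.1, rfl⟩) (by
      intro p hp q hq hpq
      simp only [Finset.mem_insert, Finset.mem_singleton] at hp hq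
      rcases hp with rfl | rfl | rfl <;> rcases hq with rfl | rfl | rfl <;>
        first | assumption | exact absurd rfl hpq | (apply SimpleGraph.Adj.symm; assumption))
      hnot
  exact absurd (hD.area_le _ _ _ (hP.isFilling_gen hX hD.toIsFilling))
    (not_le.2 hP.area_gen_lt)

end
end AbstractSimplicialComplex

/-! ### Links of vertices of degree 4 and 5 -/

namespace AbstractSimplicialComplex

section
open scoped Classical

variable {W : Type*} {D : AbstractSimplicialComplex W} (hD : D.IsSurface)

include hD

theorem IsSurface.exists_not_isInterior : ∃ w, ¬ D.IsInterior w := by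
  obtain ⟨e, he⟩ := hD.boundary_nonempty
  obtain ⟨p, q, -, rfl⟩ := exists_adj_of_mem_edges he.1
  exact ⟨p, fun h => h ⟨_, he, by simp⟩⟩

theorem IsSurface.goodSphere_one
    (hflag : ∀ a b c, D.skeleton.Adj a b → D.skeleton.Adj a c → D.skeleton.Adj b c → D.Tri a b c)
    (v : W) : D.GoodSphere v 1 where
  edge a b hab ha hb :=
    ⟨v, hflag a b v hab (SimpleGraph.dist_eq_one_iff_adj.1 ha).symm
      (SimpleGraph.dist_eq_one_iff_adj.1 hb).symm, by simp⟩
  vertex a b c _ _ hbc _ hb hc :=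
    absurd ((hD.dist_eq_zero.1 (show D.skeleton.dist v b = 0 by omega)).trans
      (hD.dist_eq_zero.1 (show D.skeleton.dist v c = 0 by omega)).symm) hbc

/-- The link of an interior vertex of degree 4 is a 4-cycle. -/
theorem IsSurface.link_four
    (hdeg : ∀ w, D.IsInterior w → (D.skeleton.neighborSet w).ncard = 4) {w x y : W}
    (hw : D.IsInterior w) (h1 : D.Tri w x y) :
    ∃ z p, D.Tri w y z ∧ D.Tri w z p ∧ D.Tri w p x ∧ x ≠ z ∧ y ≠ p ∧
      ∀ u, D.skeleton.Adj w u → u = x ∨ u = y ∨ u = z ∨ u = p := by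
  obtain ⟨z, hzx, h2⟩ := hw.exists_tri_ne h1.swap'
  obtain ⟨p, hpy, h3⟩ := hw.exists_tri_ne h2.swap'
  have hpx : p ≠ x := by
    rintro rfl
    exact hD.false_of_closed_three hdeg le_rfl h1 h2 h3
  have hall : D.skeleton.neighborSet w = ({x, y, z, p} : Finset W) := by
    have := hD.finite
    symm
    refine Set.eq_of_subset_of_ncard_le ?_ ?_ (Set.toFinite _)
    · intro u hu
      simp only [Finset.coe_insert, Finset.coe_singleton, Set.mem_insert_iff,
        Set.mem_singleton_iff] at hu
      rcases hu with rfl | rfl | rfl | rfl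
      · exact h1.adj
      · exact h2.adj
      · exact h3.adj
      · exact h3.adj₁₃
    · rw [hdeg w hw, Set.ncard_coe_finset]
      repeat rw [Finset.card_insert_of_notMem]
      · simp
      · simpa using h3.2.2.1
      · simpa using ⟨h2.2.2.1, hpy.symm⟩
      · simpa using ⟨h1.2.2.1, hzx.symm, hpx.symm⟩
  have hmem : ∀ u, D.skeleton.Adj w u → u = x ∨ u = y ∨ u = z ∨ u = p := by
    intro u hu
    have : u ∈ D.skeleton.neighborSet w := hu
    rw [hall] at this
    simpa using this
  -- The four neighbours are used up, so the next vertex around `w` is an old one, and only `x`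
  -- still has room for another triangle.
  obtain ⟨q, hqz, h4⟩ := hw.exists_tri_ne h3.swap'
  have hqx : q = x := by
    rcases hmem q h4.adj₁₃ with h | h | h | h
    · exact h
    · subst h
      rcases hD.tri_eq h1.swap' h2 h4.swap' hzx.symm with h | h
      · exact absurd h hpx
      · exact absurd h h3.2.2.1.symm
    · exact absurd h hqz
    · exact absurd h h4.2.2.1.symm
  subst hqx
  exact ⟨z, p, h2, h3, h4, hzx.symm, hpy.symm, hmem⟩

/-- The link of an interior vertex of degree 5 is a 5-cycle. -/
theorem IsSurface.link_five
    (hdeg : ∀ w, D.IsInterior w → (D.skeleton.neighborSet w).ncard = 5) {w x y : W}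
    (hw : D.IsInterior w) (h1 : D.Tri w x y) :
    ∃ z p q, D.Tri w y z ∧ D.Tri w z p ∧ D.Tri w p q ∧ D.Tri w q x ∧ x ≠ z ∧ x ≠ p ∧ y ≠ p ∧
      y ≠ q ∧ z ≠ q ∧
      ∀ u, D.skeleton.Adj w u → u = x ∨ u = y ∨ u = z ∨ u = p ∨ u = q := by
  obtain ⟨z, hzx, h2⟩ := hw.exists_tri_ne h1.swap'
  obtain ⟨p, hpy, h3⟩ := hw.exists_tri_ne h2.swap'
  have hpx : p ≠ x := by
    rintro rfl
    exact hD.false_of_closed_three hdeg (by norm_num) h1 h2 h3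
  obtain ⟨q, hqz, h4⟩ := hw.exists_tri_ne h3.swap'
  have hqx : q ≠ x := by
    rintro rfl
    exact hD.false_of_closed_four hdeg le_rfl h1 h2 h3 h4 hzx.symm hpy.symm
  have hqy : q ≠ y := by
    rintro rfl
    rcases hD.tri_eq h1.swap' h2 h4.swap' hzx.symm with h | h
    · exact absurd h hpx
    · exact absurd h h3.2.2.1.symm
  have hmem : ∀ u, D.skeleton.Adj w u → u = x ∨ u = y ∨ u = z ∨ u = p ∨ u = q := by
    have hall : D.skeleton.neighborSet w = ({x, y, z, p, q} : Finset W) := by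
      have := hD.finite
      symm
      refine Set.eq_of_subset_of_ncard_le ?_ ?_ (Set.toFinite _)
      · intro u hu
        simp only [Finset.coe_insert, Finset.coe_singleton, Set.mem_insert_iff,
          Set.mem_singleton_iff] at hu
        rcases hu with rfl | rfl | rfl | rfl | rfl
        · exact h1.adj
        · exact h2.adj
        · exact h3.adj
        · exact h4.adj
        · exact h4.adj₁₃
      · rw [hdeg w hw, Set.ncard_coe_finset]
        repeat rw [Finset.card_insert_of_notMem]
        · simp
        · simpa using h4.2.2.1
        · simpa using ⟨h3.2.2.1, hqz.symm⟩
        · simpa using ⟨h2.2.2.1, hpy.symm, hqy.symm⟩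
        · simpa using ⟨h1.2.2.1, hzx.symm, hpx.symm, hqx.symm⟩
    intro u hu
    have : u ∈ D.skeleton.neighborSet w := hu
    rw [hall] at this
    simpa using this
  obtain ⟨r, hrp, h5⟩ := hw.exists_tri_ne h4.swap'
  have hrx : r = x := by
    rcases hmem r h5.adj₁₃ with h | h | h | h | h
    · exact h
    · subst h
      rcases hD.tri_eq h1.swap' h2 h5.swap' hzx.symm with h | h
      · exact absurd h hqx
      · exact absurd h hqz
    · subst h
      rcases hD.tri_eq h2.swap' h3 h5.swap' hpy.symm with h | h
      · exact absurd h hqy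
      · exact absurd h h4.2.2.1.symm
    · exact absurd h hrp
    · exact absurd h h5.2.2.1.symm
  subst hrx
  exact ⟨z, p, q, h2, h3, h4, h5, hzx.symm, hpx.symm, hpy.symm, hqy.symm, hqz.symm, hmem⟩

end
end AbstractSimplicialComplex

/-! ### Small degrees: the octahedron and the icosahedron -/

namespace AbstractSimplicialComplex

section
open scoped Classical

variable {W : Type*} {D : AbstractSimplicialComplex W} (hD : D.IsSurface)

include hD

theorem IsSurface.exists_opposite_of_four
    (hdeg : ∀ w, D.IsInterior w → (D.skeleton.neighborSet w).ncard = 4) {w v b d : W}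
    (hw : D.IsInterior w) (hb : D.Tri w v b) (hd : D.Tri w v d) (hbd : b ≠ d) :
    ∃ c, D.Tri w b c ∧ D.Tri w c d ∧ v ≠ c ∧
      ∀ u, D.skeleton.Adj w u → u = v ∨ u = b ∨ u = c ∨ u = d := by
  obtain ⟨c, p, h2, h3, h4, hvc, hbp, hmem⟩ := hD.link_four hdeg hw hb
  rcases hD.tri_eq hb hd h4.swap' hbd with rfl | rfl
  · exact absurd rfl hbp
  · exact ⟨c, h2, h3, hvc, hmem⟩

theorem IsSurface.exists_opposite_of_five
    (hdeg : ∀ w, D.IsInterior w → (D.skeleton.neighborSet w).ncard = 5) {w v b d : W}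
    (hw : D.IsInterior w) (hb : D.Tri w v b) (hd : D.Tri w v d) (hbd : b ≠ d) :
    ∃ c e, D.Tri w b c ∧ D.Tri w c e ∧ D.Tri w e d ∧ v ≠ c ∧ v ≠ e ∧ b ≠ e ∧ c ≠ d ∧
      ∀ u, D.skeleton.Adj w u → u = v ∨ u = b ∨ u = c ∨ u = e ∨ u = d := by
  obtain ⟨c, e, q, h2, h3, h4, h5, hvc, hve, hbe, hbq, hcq, hmem⟩ := hD.link_five hdeg hw hb
  rcases hD.tri_eq hb hd h5.swap' hbd with rfl | rfl
  · exact absurd rfl hbq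
  · exact ⟨c, e, h2, h3, h4, hvc, hve, hbe, hcq, hmem⟩

/-- In a surface with boundary no interior vertex of degree 4 has only interior neighbours of
degree 4: such a configuration closes up to an octahedron. -/
theorem IsSurface.false_of_interior_neighbors_of_four
    (hdeg : ∀ w, D.IsInterior w → (D.skeleton.neighborSet w).ncard = 4) {v : W}
    (hv : D.IsInterior v) (hn : ∀ w, D.skeleton.Adj v w → D.IsInterior w) : False := by
  obtain ⟨x, hx⟩ := hD.exists_adj v
  obtain ⟨y, h1⟩ := hD.exists_tri hx
  obtain ⟨z, p, h2, h3, h4, hxz, hyp, hmem⟩ := hD.link_four hdeg hv h1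
  obtain ⟨c, hxc, hxc', hvc, hx'⟩ :=
    hD.exists_opposite_of_four hdeg (hn x h1.adj) h1.swap h4.swap'.swap hyp
  -- The edge from `a` to `d` has only the apexes `v` and `c`, so the vertex opposite `v` in the
  -- link of `a` is `c` again. Thus one vertex `c` is opposite `v` all around.
  have key : ∀ {a b d c : W}, D.Tri v a b → D.Tri v d a → b ≠ d → D.Tri a d c → c ≠ v →
      D.Tri a b c ∧ ∀ u, D.skeleton.Adj a u → u = v ∨ u = b ∨ u = c ∨ u = d := by
    intro a b d c hab hda hbd hc hcv
    obtain ⟨c', hbc, hcd, hvc, hmem⟩ :=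
      hD.exists_opposite_of_four hdeg (hn a hab.adj) hab.swap hda.swap'.swap hbd
    rcases hD.tri_eq hda.rot.swap hcd.swap' hc hvc with h | h
    · exact absurd h hcv
    · subst h
      exact ⟨hbc, hmem⟩
  obtain ⟨hyc, hy'⟩ := key h2 h1 hxz.symm hxc.swap hvc.symm
  obtain ⟨hzc, hz'⟩ := key h3 h2 hyp.symm hyc.swap hvc.symm
  obtain ⟨hpc, hp'⟩ := key h4 h3 hxz hzc.swap hvc.symm
  obtain ⟨hc, hc'⟩ := hD.closed_link (w := c) (S := {x, y, z, p}) (by simp) (by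
    intro u hu
    simp only [Finset.mem_insert, Finset.mem_singleton] at hu
    rcases hu with hu | hu | hu | hu <;> rw [hu]
    · exact ⟨y, by simp, p, by simp, hyp, hxc.rot.rot, hpc.rot.rot.swap'⟩
    · exact ⟨z, by simp, x, by simp, hxz.symm, hyc.rot.rot, hxc.rot.rot.swap'⟩
    · exact ⟨p, by simp, y, by simp, hyp.symm, hzc.rot.rot, hyc.rot.rot.swap'⟩
    · exact ⟨x, by simp, z, by simp, hxz, hpc.rot.rot, hzc.rot.rot.swap'⟩)
  -- The six vertices of the octahedron are closed under adjacency, hence are all of them, and all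
  -- are interior.
  have hall := hD.vertex_induction (x := v) {v, x, y, z, p, c} (by simp) (by
    intro u hu w hw
    simp only [Set.mem_insert_iff, Set.mem_singleton_iff] at hu ⊢
    rcases hu with rfl | rfl | rfl | rfl | rfl | rfl
    · have := hmem _ hw; tauto
    · have := hx' _ hw; tauto
    · have := hy' _ hw; tauto
    · have := hz' _ hw; tauto
    · have := hp' _ hw; tauto
    · have : w ∈ D.skeleton.neighborSet u := hw
      rw [hc'] at this
      simp only [Finset.coe_insert, Finset.coe_singleton, Set.mem_insert_iff,
        Set.mem_singleton_iff] at this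
      tauto)
  obtain ⟨w, hw⟩ := hD.exists_not_isInterior
  have hwS := hall w
  simp only [Set.mem_insert_iff, Set.mem_singleton_iff] at hwS
  rcases hwS with rfl | rfl | rfl | rfl | rfl | rfl
  · exact hw hv
  · exact hw (hn _ h1.adj)
  · exact hw (hn _ h2.adj)
  · exact hw (hn _ h3.adj)
  · exact hw (hn _ h4.adj)
  · exact hw hc

/-- The first two spheres around an interior vertex of degree 5 all of whose neighbours are
interior vertices of degree 5. -/
structure IsIcosahedralCap (D : AbstractSimplicialComplex W) (v : W) (a b : ZMod 5 → W) :
    Prop where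
  center : ∀ i, D.Tri v (a i) (a (i + 1))
  outer : ∀ i, D.Tri (a i) (a (i + 1)) (b i)
  inner : ∀ i, D.Tri (a (i + 1)) (b i) (b (i + 1))
  center_ne : ∀ i, v ≠ b i
  ne_outer : ∀ i, b (i + 1) ≠ a i
  outer_ne : ∀ i, b i ≠ a (i + 1 + 1)
  eq_of_adj_center : ∀ u, D.skeleton.Adj v u → ∃ i, u = a i
  eq_of_adj : ∀ i u, D.skeleton.Adj (a (i + 1)) u →
    u = v ∨ u = a i ∨ u = a (i + 1 + 1) ∨ u = b i ∨ u = b (i + 1)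
  skip_ne : ∀ i, a i ≠ a (i + 1 + 1)

/-- The link of `a (i + 1)` is a 5-cycle containing `a i, v, a (i + 1 + 1)`, so two further vertices
complete it; neighbouring links share one of these, which yields a single outer circle indexed by
`ZMod 5`. -/
theorem IsSurface.exists_isIcosahedralCap
    (hdeg : ∀ w, D.IsInterior w → (D.skeleton.neighborSet w).ncard = 5) {v : W}
    (hv : D.IsInterior v) (hn : ∀ w, D.skeleton.Adj v w → D.IsInterior w) :
    ∃ a b : ZMod 5 → W, D.IsIcosahedralCap v a b := by
  obtain ⟨x, hx⟩ := hD.exists_adj v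
  obtain ⟨y, h1⟩ := hD.exists_tri hx
  obtain ⟨z, p, q, h2, h3, h4, h5, hxz, hxp, hyp, hyq, hzq, hmem⟩ := hD.link_five hdeg hv h1
  let a : ZMod 5 → W := ![x, y, z, p, q]
  have hc : ∀ i, D.Tri v (a i) (a (i + 1)) := by
    intro i
    fin_cases i
    exacts [h1, h2, h3, h4, h5]
  have hskip : ∀ i, a i ≠ a (i + 1 + 1) := by
    intro i
    fin_cases i
    exacts [hxz, hyp, hzq, hxp.symm, hyq.symm]
  have hex : ∀ i, ∃ c e, D.Tri (a (i + 1)) (a (i + 1 + 1)) c ∧ D.Tri (a (i + 1)) c e ∧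
      D.Tri (a (i + 1)) e (a i) ∧ v ≠ c ∧ v ≠ e ∧ a (i + 1 + 1) ≠ e ∧ c ≠ a i ∧
      ∀ u, D.skeleton.Adj (a (i + 1)) u →
        u = v ∨ u = a (i + 1 + 1) ∨ u = c ∨ u = e ∨ u = a i := fun i =>
    hD.exists_opposite_of_five hdeg (hn _ (hc i).adj₁₃) (hc (i + 1)).swap (hc i).rot.rot
      (hskip i).symm
  choose c e h1 h2 h3 h4 h5 h6 h7 h8 using hex
  -- Both are the apex other than `v` over the edge from `a (i + 1)` to `a (i + 1 + 1)`.
  have hce : ∀ i, e (i + 1) = c i := fun i => by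
    rcases hD.tri_eq (hc (i + 1)).rot (h1 i) (h3 (i + 1)).rot.rot (h4 i) with h | h
    · exact absurd h.symm (h5 _)
    · exact h
  refine ⟨a, e, hc, fun i => (h3 i).rot.rot, fun i => hce i ▸ (h2 i).swap', h5,
    fun i => hce i ▸ h7 i, fun i => (h6 i).symm, fun u hu => ?_, fun i u hu => ?_, hskip⟩
  · rcases hmem u hu with h | h | h | h | h
    exacts [⟨0, h⟩, ⟨1, h⟩, ⟨2, h⟩, ⟨3, h⟩, ⟨4, h⟩]
  · rw [hce]
    have := h8 i u hu
    tauto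

namespace IsIcosahedralCap

variable {v : W} {a b : ZMod 5 → W} (h : D.IsIcosahedralCap v a b)

include h

omit hD in
theorem outer_ne_outer_succ (i : ZMod 5) : b i ≠ b (i + 1) := (h.inner i).2.2.1

variable (hdeg : ∀ w, D.IsInterior w → (D.skeleton.neighborSet w).ncard = 5)

include hdeg

/-- If they agreed, the link of `b (i + 1)` would close up after three vertices. -/
theorem outer_ne_outer_add_two (i : ZMod 5) : b i ≠ b (i + 1 + 1) := fun heq =>
  hD.false_of_closed_three hdeg (z := b i) (by norm_num) (h.outer (i + 1)).rot.rot
    (by rw [heq]; exact (h.inner (i + 1)).swap) (h.inner i).rot.swap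

theorem outer_injective : Function.Injective b := by
  intro i j hij
  have key : ∀ i j : ZMod 5, i = j ∨ j = i + 1 ∨ j = i + 1 + 1 ∨ i = j + 1 ∨ i = j + 1 + 1 := by
    decide
  rcases key i j with hh | rfl | rfl | rfl | rfl
  · exact hh
  · exact absurd hij (h.outer_ne_outer_succ i)
  · exact absurd hij (h.outer_ne_outer_add_two hD hdeg i)
  · exact absurd hij.symm (h.outer_ne_outer_succ j)
  · exact absurd hij.symm (h.outer_ne_outer_add_two hD hdeg j)

/-- If the vertices of the outer circle are interior, then the surface closes up to an
icosahedron. -/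
theorem exists_outer_not_isInterior (hv : D.IsInterior v) (ha : ∀ i, D.IsInterior (a i)) :
    ∃ i, ¬ D.IsInterior (b i) := by
  by_contra! hb
  have hex : ∀ i, ∃ e, D.Tri (b (i + 1)) (b (i + 1 + 1)) e ∧ D.Tri (b (i + 1)) e (b i) ∧
      a (i + 1) ≠ e ∧ a (i + 1 + 1) ≠ e ∧ ∀ u, D.skeleton.Adj (b (i + 1)) u →
        u = a (i + 1) ∨ u = a (i + 1 + 1) ∨ u = b (i + 1 + 1) ∨ u = e ∨ u = b i := by
    intro i
    obtain ⟨c, e, h1, h2, h3, h4, h5, h6, h7, h8⟩ := hD.exists_opposite_of_five hdeg (hb (i + 1))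
      (h.outer (i + 1)).rot.rot (h.inner i).rot.rot (h.outer_ne i).symm
    have : c = b (i + 1 + 1) := by
      rcases hD.tri_eq (h.outer (i + 1)).rot.swap (h.inner (i + 1)).swap h1
        (h.ne_outer (i + 1)).symm with hh | hh
      · exact absurd hh.symm h4
      · exact hh
    subst this
    exact ⟨e, h2, h3, h5, h6, h8⟩
  choose e h1 h2 h3 h4 h5 using hex
  -- The edge from `b (i + 1)` to `b (i + 1 + 1)` has one apex besides `a (i + 1 + 1)`, so the fifth
  -- neighbours of the `b i` all coincide in the vertex antipodal to `v`.
  have hsucc : ∀ i, e (i + 1) = e i := fun i => by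
    rcases hD.tri_eq (h.inner (i + 1)).rot (h1 i) (h2 (i + 1)).rot.rot (h4 i) with hh | hh
    · exact absurd hh.symm (h3 (i + 1))
    · exact hh
  have hconst : ∀ i, e i = e 0 := by
    have h0 := hsucc 0
    have h1 := hsucc 1
    have h2 := hsucc 2
    have h3 := hsucc 3
    intro i
    fin_cases i
    exacts [rfl, h0, h1.trans h0, h2.trans (h1.trans h0), h3.trans (h2.trans (h1.trans h0))]
  have hpred : ∀ i : ZMod 5, ∃ j, i = j + 1 := fun i => ⟨i - 1, by ring⟩
  simp only [hconst] at h1 h2 h5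
  obtain ⟨hc, hc'⟩ := hD.closed_link (w := e 0) (S := Finset.univ.image b) (by simp) (by
    intro u hu
    obtain ⟨i, -, rfl⟩ := Finset.mem_image.1 hu
    obtain ⟨j, rfl⟩ := hpred i
    exact ⟨b (j + 1 + 1), by simp, b j, by simp, (h.outer_ne_outer_add_two hD hdeg j).symm,
      (h1 j).rot.rot, (h2 j).swap⟩)
  have hall := hD.vertex_induction (x := v) {u | u = v ∨ (∃ i, u = a i) ∨ (∃ i, u = b i) ∨ u = e 0}
    (Or.inl rfl) (by
    rintro u (rfl | ⟨i, rfl⟩ | ⟨i, rfl⟩ | rfl) w hw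
    · exact Or.inr (Or.inl (h.eq_of_adj_center w hw))
    · obtain ⟨j, rfl⟩ := hpred i
      rcases h.eq_of_adj j w hw with rfl | rfl | rfl | rfl | rfl <;> simp
    · obtain ⟨j, rfl⟩ := hpred i
      rcases h5 j w hw with rfl | rfl | rfl | rfl | rfl <;> simp
    · have : w ∈ D.skeleton.neighborSet (e 0) := hw
      rw [hc'] at this
      obtain ⟨i, -, rfl⟩ := by simpa only [Finset.coe_image, Set.mem_image] using this
      simp)
  obtain ⟨w, hw⟩ := hD.exists_not_isInterior
  rcases hall w with rfl | ⟨i, rfl⟩ | ⟨i, rfl⟩ | rfl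
  exacts [hw hv, hw (ha i), hw (hb i), hw hc]

omit hD hdeg in
theorem dist_inner (i : ZMod 5) : D.skeleton.dist v (a i) = 1 :=
  SimpleGraph.dist_eq_one_iff_adj.2 (h.center i).adj

variable
    (hflag : ∀ a b c, D.skeleton.Adj a b → D.skeleton.Adj a c → D.skeleton.Adj b c → D.Tri a b c)

include hflag

omit hdeg in
-- If `b i` were adjacent to `v`, then by `hflag` it would be a third apex over the edge from `v` to
-- `a i`.
theorem dist_outer (i : ZMod 5) : D.skeleton.dist v (b i) = 2 := by
  have h1 := hD.dist_le_succ v (h.outer i).adj₁₃.symm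
  rw [h.dist_inner] at h1
  have h0 : D.skeleton.dist v (b i) ≠ 0 := fun h0 => h.center_ne i (hD.dist_eq_zero.1 h0).symm
  have h2 : D.skeleton.dist v (b i) ≠ 1 := by
    intro h1
    rw [SimpleGraph.dist_eq_one_iff_adj] at h1
    obtain ⟨j, rfl⟩ : ∃ j, i = j + 1 := ⟨i - 1, by ring⟩
    rcases hD.tri_eq (h.center j).swap' (h.center (j + 1))
      (hflag _ _ _ (h.center (j + 1)).adj h1 (h.outer (j + 1)).adj₁₃) (h.skip_ne j) with hh | hh
    · exact h.ne_outer j hh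
    · exact (h.outer (j + 1)).2.2.1 hh.symm
  omega

/-- A chord from `b i` to `b (i + 1 + 1)` would by `hflag` span a triangle with `b (i + 1)` and
close the link of that vertex after four vertices. -/
theorem eq_succ_of_adj_outer {i j : ZMod 5} (hij : D.skeleton.Adj (b i) (b j)) :
    j = i + 1 ∨ i = j + 1 := by
  have key : ∀ i j : ZMod 5, i = j ∨ j = i + 1 ∨ j = i + 1 + 1 ∨ i = j + 1 ∨ i = j + 1 + 1 := by
    decide
  have hskip : ∀ i, ¬ D.skeleton.Adj (b i) (b (i + 1 + 1)) := fun i hi =>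
    hD.false_of_closed_four hdeg le_rfl (h.outer (i + 1)).rot.rot
      (h.inner (i + 1)).swap
      (hflag _ _ _ (h.inner (i + 1)).adj₂₃ (h.inner i).adj₂₃.symm hi.symm)
      (h.inner i).rot.swap (h.ne_outer (i + 1)).symm (h.outer_ne i).symm
  rcases key i j with rfl | hh | rfl | hh | rfl
  · exact absurd rfl hij.1
  · exact Or.inl hh
  · exact absurd hij (hskip i)
  · exact Or.inr hh
  · exact absurd hij.symm (hskip j)

omit hdeg in
theorem eq_of_adj_outer {i : ZMod 5} {u : W} (hu : D.skeleton.dist v u = 1)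
    (hinj : Function.Injective b) (hadj : D.skeleton.Adj (b i) u) :
    u = a i ∨ u = a (i + 1) := by
  obtain ⟨j, rfl⟩ := h.eq_of_adj_center u (SimpleGraph.dist_eq_one_iff_adj.1 hu)
  obtain ⟨k, rfl⟩ : ∃ k, j = k + 1 := ⟨j - 1, by ring⟩
  have hd := h.dist_outer hD hflag i
  rcases h.eq_of_adj k _ hadj.symm with hh | hh | hh | hh | hh
  · exact absurd hh.symm (h.center_ne i)
  · rw [hh, h.dist_inner] at hd; omega
  · rw [hh, h.dist_inner] at hd; omega
  · rw [hinj hh]; simp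
  · rw [hinj hh]; simp

theorem goodSphere_two : D.GoodSphere v 2 := by
  have hout : ∀ u, D.skeleton.dist v u = 2 → ∃ i, u = b i := by
    intro u hu
    obtain ⟨p, hp, hp1⟩ := hD.exists_adj_dist hu
    obtain ⟨j, rfl⟩ := h.eq_of_adj_center p (SimpleGraph.dist_eq_one_iff_adj.1 hp1)
    obtain ⟨k, rfl⟩ : ∃ k, j = k + 1 := ⟨j - 1, by ring⟩
    rcases h.eq_of_adj k _ hp.symm with rfl | rfl | rfl | hh | hh
    · simp at hu
    · rw [h.dist_inner] at hu; omega
    · rw [h.dist_inner] at hu; omega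
    · exact ⟨_, hh⟩
    · exact ⟨_, hh⟩
  constructor
  · intro x y hxy hx hy
    obtain ⟨i, rfl⟩ := hout x hx
    obtain ⟨j, rfl⟩ := hout y hy
    rcases h.eq_succ_of_adj_outer hD hdeg hflag hxy with rfl | rfl
    · exact ⟨a (i + 1), (h.inner i).rot, by rw [h.dist_inner]⟩
    · exact ⟨a (j + 1), (h.inner j).rot.swap, by rw [h.dist_inner]⟩
  · intro x y z hxy hxz hyz hx hy hz
    obtain ⟨i, rfl⟩ := hout x hx
    have hinj := h.outer_injective hD hdeg
    rcases h.eq_of_adj_outer hD hflag (by omega) hinj hxy with rfl | rfl <;>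
    rcases h.eq_of_adj_outer hD hflag (by omega) hinj hxz with rfl | rfl
    · exact absurd rfl hyz
    · exact (h.outer i).rot.rot
    · exact (h.outer i).rot.rot.swap'
    · exact absurd rfl hyz

end IsIcosahedralCap

end
end AbstractSimplicialComplex

/-! ### The area formula, case by case in the degree -/

theorem theorem3p3 {V : Type*} (X : AbstractSimplicialComplex V) (t : ℕ) (hX : X.IsUniform t)
    (x : V) (γ : X.skeleton.Walk x x) (hγ : γ.IsCycle)
    (W : Type) (D : AbstractSimplicialComplex W) (f : W → V)
    (hD : AbstractSimplicialComplex.IsMinimalFilling γ D f)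
    (v : W) (hv : D.IsInterior v)
    (n : ℕ) (hn : ∀ w : W, D.skeleton.dist v w < n → D.IsInterior w) :
    (D.sphereArea v n : ℤ) =
      2 * (∑ k ∈ Finset.range (n + 1), (D.sphereLength v k : ℤ)) - D.sphereLength v n := by
  have := hD.disc.finite
  have := Fintype.ofFinite W
  have hS := hD.disc.isSurface
  have hdeg := hX.degree_eq x γ hγ W D f hD
  have hflag : ∀ a b c, D.skeleton.Adj a b → D.skeleton.Adj a c → D.skeleton.Adj b c →
      D.Tri a b c := fun _ _ _ => hD.tri_of_adj hX.flag
  have hadj : 2 ≤ n → ∀ w, D.skeleton.Adj v w → D.IsInterior w := fun h2 w hw =>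
    hn w (by rw [SimpleGraph.dist_eq_one_iff_adj.2 hw]; omega)
  have ht := hX.four_le
  have hsmall : ∀ k ≤ 1, D.GoodSphere v k := by
    intro k hk
    interval_cases k
    exacts [hS.goodSphere_zero v, hS.goodSphere_one hflag v]
  refine hS.sphereArea_eq ht hdeg ?_ hn fun k hk => ?_
  -- For `t = 4` and `n ≥ 2` all neighbours of `v` would be interior and the disc would be an
  -- octahedron.
  · by_contra! h
    obtain rfl : t = 4 := by omega
    exact hS.false_of_interior_neighbors_of_four hdeg hv (hadj (by omega))
  by_cases hk1 : k ≤ 1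
  · exact hsmall k hk1
  obtain ht | rfl | rfl : 6 ≤ t ∨ t = 5 ∨ t = 4 := by omega
  · exact (hD.disc.goodSphere_of_six_le hdeg ht hn k hk).1
  · obtain ⟨a, b, hab⟩ := hS.exists_isIcosahedralCap hdeg hv (hadj (by omega))
    obtain ⟨i, hi⟩ := hab.exists_outer_not_isInterior hS hdeg hv
      fun i => hadj (by omega) _ (hab.center i).adj
    -- Some vertex at distance exactly 2 is on the boundary, which limits the radius to 2.
    have hn2 : n ≤ 2 := by
      by_contra! h
      exact hi (hn _ (by rw [hab.dist_outer hS hflag]; exact h))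
    obtain rfl : k = 2 := by omega
    exact hab.goodSphere_two hS hdeg hflag
  · exact (hS.false_of_interior_neighbors_of_four hdeg hv (hadj (by omega))).elim
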